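/- Let $\mathbb G$ be a compact quantum group, i.e. a separable nonzero unital $C^*$-algebra $C(\mathbb G)$ with a coassociative unital $*$-homomorphism $\Delta\colon C(\mathbb G)\to C(\mathbb G)\otimes C(\mathbb G)$ (minimal tensor product) such that $(C(\mathbb G)\otimes 1)\Delta(C(\mathbb G))$ and $(1\otimes C(\mathbb G))\Delta(C(\mathbb G))$ span dense subspaces. Let $d\ge 1$ and let $\alpha=(\alpha_{ij})\in M_d(C(\mathbb G))$ be a unitary representation of $\mathbb G$ on $\mathbb C^d$, i.e. a unitary matrix with $\Delta(\alpha_{ij})=\sum_k\alpha_{ik}\otimes\alpha_{kj}$. Let $\mathcal O_d$ be the Cuntz algebra, the universal unital $C^*$-algebra generated by $S_1,\dots,S_d$ with $S_i^*S_j=\delta_{ij}1$ and $\sum_jS_jS_j^*=1$; let $\underline\delta\colon\mathcal O_d\to\mathcal O_d\otimes C(\mathbb G)$ be the action with $\underline\delta(S_i)=\sum_jS_j\otimes\alpha_{ji}$, and let $$\mathcal O^\alpha=\{T\in\mathcal O_d:\ \underline\delta(T)=T\otimes 1\}$$ be its fixed point algebra. Let $\mathfrak T_\alpha$ be the set of (classes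 of) irreducible unitary representations of $\mathbb G$ that are contained in some tensor power $\alpha^{\ell}$, $\ell\in\mathbb N$. Assume: (C1) for every $\beta\in\mathfrak T_\alpha$ there is $\beta'\in\mathfrak T_\alpha$ such that $\beta\otimes\beta'$ has a nonzero invariant vector; (C2) $\alpha$ is not irreducible. Then $\mathcal O^\alpha$ is simple and purely infinite: it is a simple $C^*$-algebra, it is not reduced to the scalars, and for every nonzero $T\in\mathcal O^\alpha$ and every $\varepsilon>0$ there are $A,B\in\mathcal O^\alpha$ with $\|ATB-1\|\le\varepsilon$. -/

import Mathlib

open scoped TensorProduct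

universe u v

noncomputable section

/-! ### C*-seminorms on `*`-algebras and their completions -/

/-- A C*-seminorm on a complex unital `*`-algebra `R`. -/
structure CStarSeminorm (R : Type u) [Ring R] [StarRing R] [Algebra ℂ R] extends
    Seminorm ℂ R where
  mul_le' : ∀ x y, toFun (x * y) ≤ toFun x * toFun y
  star_mul_self' : ∀ x, toFun (star x * x) = toFun x ^ 2

namespace CStarSeminorm

section Basic

variable {R : Type u} [Ring R] [StarRing R] [Algebra ℂ R]

instance : CoeFun (CStarSeminorm R) (fun _ => R → ℝ) := ⟨fun p => p.toFun⟩

theorem mul_le (p : CStarSeminorm R) (x y : R) : p (x * y) ≤ p x * p y := p.mul_le' x y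

theorem star_mul_self (p : CStarSeminorm R) (x : R) : p (star x * x) = p x ^ 2 :=
  p.star_mul_self' x

theorem nonneg (p : CStarSeminorm R) (x : R) : 0 ≤ p x := apply_nonneg p.toSeminorm x

theorem add_le (p : CStarSeminorm R) (x y : R) : p (x + y) ≤ p x + p y :=
  map_add_le_add p.toSeminorm x y

theorem smul_eq (p : CStarSeminorm R) (c : ℂ) (x : R) : p (c • x) = ‖c‖ * p x :=
  map_smul_eq_mul p.toSeminorm c x

theorem star_eq (p : CStarSeminorm R) (x : R) : p (star x) = p x := by
  have key : ∀ y : R, p y ≤ p (star y) := by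
    intro y
    by_cases hy : p y = 0
    · rw [hy]; exact p.nonneg _
    · have h1 : p y ^ 2 ≤ p (star y) * p y := by
        rw [← p.star_mul_self]; exact p.mul_le _ _
      have h2 : 0 < p y := lt_of_le_of_ne (p.nonneg y) (Ne.symm hy)
      nlinarith
  refine le_antisymm ?_ (key x)
  simpa using key (star x)

theorem one_le_one (p : CStarSeminorm R) : p 1 ≤ 1 := by
  have h := p.star_mul_self 1
  have h0 := p.nonneg 1
  simp only [star_one, mul_one] at h
  nlinarith

/-- The pointwise supremum of a pointwise bounded family of C*-seminorms. -/
def iSup {ι : Type v} (p : ι → CStarSeminorm R)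
    (hp : ∀ x, ∃ C : ℝ, ∀ i, p i x ≤ C) : CStarSeminorm R where
  toFun x := ⨆ i, p i x
  map_zero' := by
    have : ∀ i, p i 0 = 0 := fun i => map_zero (p i).toSeminorm
    simp [this]
  add_le' x y := by
    obtain ⟨C, hC⟩ := hp x
    obtain ⟨D, hD⟩ := hp y
    refine Real.iSup_le (fun i => ((p i).add_le x y).trans (add_le_add ?_ ?_)) ?_
    · exact le_ciSup (f := fun i => p i x) ⟨C, by rintro _ ⟨i, rfl⟩; exact hC i⟩ i
    · exact le_ciSup (f := fun i => p i y) ⟨D, by rintro _ ⟨i, rfl⟩; exact hD i⟩ i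
    · exact add_nonneg (Real.iSup_nonneg fun i => (p i).nonneg x)
        (Real.iSup_nonneg fun i => (p i).nonneg y)
  neg' x := by
    have : ∀ i, p i (-x) = p i x := fun i => map_neg_eq_map (p i).toSeminorm x
    simp [this]
  smul' c x := by
    have : ∀ i, p i (c • x) = ‖c‖ * p i x := fun i => (p i).smul_eq c x
    simp only [this]
    exact (Real.mul_iSup_of_nonneg (norm_nonneg c) _).symm
  mul_le' x y := by
    obtain ⟨C, hC⟩ := hp x
    obtain ⟨D, hD⟩ := hp y
    refine Real.iSup_le (fun i => ((p i).mul_le x y).trans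
      (mul_le_mul ?_ ?_ ((p i).nonneg y) (Real.iSup_nonneg fun i => (p i).nonneg x))) ?_
    · exact le_ciSup (f := fun i => p i x) ⟨C, by rintro _ ⟨i, rfl⟩; exact hC i⟩ i
    · exact le_ciSup (f := fun i => p i y) ⟨D, by rintro _ ⟨i, rfl⟩; exact hD i⟩ i
    · exact mul_nonneg (Real.iSup_nonneg fun i => (p i).nonneg x)
        (Real.iSup_nonneg fun i => (p i).nonneg y)
  star_mul_self' x := by
    obtain ⟨C, hC⟩ := hp x
    have hb : BddAbove (Set.range fun i => p i x) := ⟨C, by rintro _ ⟨i, rfl⟩; exact hC i⟩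
    have hn : 0 ≤ ⨆ i, p i x := Real.iSup_nonneg fun i => (p i).nonneg x
    have h : ∀ i, p i (star x * x) = p i x ^ 2 := fun i => (p i).star_mul_self x
    simp only [h]
    refine le_antisymm (Real.iSup_le (fun i => ?_) (by positivity)) ?_
    · exact pow_le_pow_left₀ ((p i).nonneg x) (le_ciSup hb i) 2
    · have hb2 : BddAbove (Set.range fun i => p i x ^ 2) :=
        ⟨C ^ 2, by rintro _ ⟨i, rfl⟩; exact pow_le_pow_left₀ ((p i).nonneg x) (hC i) 2⟩
      have hn2 : 0 ≤ ⨆ i, p i x ^ 2 := Real.iSup_nonneg fun i => by positivity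
      have : (⨆ i, p i x) ≤ Real.sqrt (⨆ i, p i x ^ 2) :=
        Real.iSup_le (fun i => Real.le_sqrt_of_sq_le (le_ciSup hb2 i)) (Real.sqrt_nonneg _)
      calc (⨆ i, p i x) ^ 2 ≤ Real.sqrt (⨆ i, p i x ^ 2) ^ 2 := pow_le_pow_left₀ hn this 2
        _ = _ := Real.sq_sqrt hn2

theorem le_iSup {ι : Type v} (p : ι → CStarSeminorm R)
    (hp : ∀ x, ∃ C : ℝ, ∀ i, p i x ≤ C) (i : ι) (x : R) : p i x ≤ iSup p hp x := by
  obtain ⟨C, hC⟩ := hp x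
  exact le_ciSup (f := fun i => p i x) ⟨C, by rintro _ ⟨i, rfl⟩; exact hC i⟩ i

theorem iSup_le {ι : Type v} (p : ι → CStarSeminorm R)
    (hp : ∀ x, ∃ C : ℝ, ∀ i, p i x ≤ C) (x : R) (C : ℝ) (h0 : 0 ≤ C) (h : ∀ i, p i x ≤ C) :
    iSup p hp x ≤ C :=
  Real.iSup_le h h0

/-- The C*-seminorm `x ↦ ‖f x‖` given by a `*`-homomorphism into a C*-algebra. -/
def ofHom {B : Type v} [CStarAlgebra B] (f : R →⋆ₐ[ℂ] B) : CStarSeminorm R where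
  toFun x := ‖f x‖
  map_zero' := by simp
  add_le' x y := by simpa using norm_add_le (f x) (f y)
  neg' x := by simp
  smul' c x := by simp [norm_smul]
  mul_le' x y := by simpa using norm_mul_le (f x) (f y)
  star_mul_self' x := by
    rw [map_mul, map_star, CStarRing.norm_star_mul_self, sq]

end Basic

section Completion

variable {R : Type u} [Ring R] [StarRing R] [Algebra ℂ R]

/-- The algebra `R`, to be equipped with the topology of the seminorm `p`. -/
def Carrier (_p : CStarSeminorm R) : Type u := R

variable (p : CStarSeminorm R)

instance : Ring p.Carrier := inferInstanceAs (Ring R)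
instance : StarRing p.Carrier := inferInstanceAs (StarRing R)
instance : Algebra ℂ p.Carrier := inferInstanceAs (Algebra ℂ R)
instance [StarModule ℂ R] : StarModule ℂ p.Carrier := inferInstanceAs (StarModule ℂ R)

instance : SeminormedRing p.Carrier :=
  { (inferInstance : Ring p.Carrier),
    (AddGroupSeminorm.toSeminormedAddCommGroup p.toSeminorm.toAddGroupSeminorm :
      SeminormedAddCommGroup R) with
    norm_mul_le := p.mul_le }

theorem norm_def (x : p.Carrier) : ‖x‖ = p x := rfl

instance : NormedSpace ℂ p.Carrier where
  norm_smul_le c x := (p.smul_eq c x).le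

instance : NormedAlgebra ℂ p.Carrier where
  norm_smul_le c x := (p.smul_eq c x).le

/-- The enveloping C*-algebra of `(R, p)`: the Hausdorff completion of `R` for the
C*-seminorm `p`. -/
abbrev Completion : Type u := UniformSpace.Completion p.Carrier

theorem norm_star_carrier (x : p.Carrier) : ‖star x‖ = ‖x‖ := p.star_eq x

theorem uniformContinuous_star_carrier :
    UniformContinuous (star : p.Carrier → p.Carrier) := by
  refine uniformContinuous_of_continuousAt_zero (starAddEquiv (R := p.Carrier)).toAddMonoidHom ?_
  have h : Filter.Tendsto (fun x : p.Carrier => star x) (nhds 0) (nhds 0) := by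
    rw [tendsto_zero_iff_norm_tendsto_zero]
    simp only [norm_star_carrier]
    simpa using (continuous_norm (E := p.Carrier)).tendsto 0
  rw [ContinuousAt, map_zero]
  exact h

instance : Star p.Completion := ⟨UniformSpace.Completion.map star⟩

theorem star_coe (x : p.Carrier) : star (x : p.Completion) = ((star x : p.Carrier) : p.Completion) :=
  UniformSpace.Completion.map_coe p.uniformContinuous_star_carrier x

theorem continuous_star_completion : Continuous (star : p.Completion → p.Completion) :=
  UniformSpace.Completion.continuous_map

instance : StarRing p.Completion where
  star_involutive x := by
    induction x using UniformSpace.Completion.induction_on with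
    | hp =>
      exact isClosed_eq
        (p.continuous_star_completion.comp p.continuous_star_completion) continuous_id
    | ih x => simp [star_coe]
  star_mul x y := by
    induction x, y using UniformSpace.Completion.induction_on₂ with
    | hp =>
      have := p.continuous_star_completion
      exact isClosed_eq (by fun_prop) (by fun_prop)
    | ih x y => simp [star_coe, ← UniformSpace.Completion.coe_mul]
  star_add x y := by
    induction x, y using UniformSpace.Completion.induction_on₂ with
    | hp =>
      have := p.continuous_star_completion
      exact isClosed_eq (by fun_prop) (by fun_prop)
    | ih x y => simp [star_coe, ← UniformSpace.Completion.coe_add]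

instance : NormedAlgebra ℂ p.Completion where
  norm_smul_le := norm_smul_le

theorem smul_coe (c : ℂ) (x : p.Carrier) :
    c • (x : p.Completion) = ((c • x : p.Carrier) : p.Completion) :=
  (UniformSpace.Completion.coe_smul c x).symm

instance [StarModule ℂ R] : StarModule ℂ p.Completion where
  star_smul c x := by
    induction x using UniformSpace.Completion.induction_on with
    | hp =>
      exact isClosed_eq (p.continuous_star_completion.comp (continuous_const_smul c))
        (p.continuous_star_completion.const_smul (star c))
    | ih x =>
      rw [smul_coe, star_coe, star_coe, smul_coe, star_smul]

instance : CStarRing p.Completion where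
  norm_mul_self_le x := by
    refine le_of_eq ?_
    induction x using UniformSpace.Completion.induction_on with
    | hp =>
      have := p.continuous_star_completion
      exact isClosed_eq (by fun_prop) (by fun_prop)
    | ih x =>
      rw [star_coe, ← UniformSpace.Completion.coe_mul, UniformSpace.Completion.norm_coe,
        UniformSpace.Completion.norm_coe, norm_def, norm_def, ← sq]
      exact (p.star_mul_self x).symm

instance [StarModule ℂ R] : CStarAlgebra p.Completion where

/-- The canonical `*`-homomorphism of `R` into the completion. -/
def toCompletion : R →⋆ₐ[ℂ] p.Completion where
  toFun x := ((show p.Carrier from x : p.Carrier) : p.Completion)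
  map_one' := rfl
  map_mul' x y := UniformSpace.Completion.coe_mul (α := p.Carrier) x y
  map_zero' := rfl
  map_add' x y := UniformSpace.Completion.coe_add (α := p.Carrier) x y
  commutes' _ := rfl
  map_star' x := (p.star_coe x).symm

theorem norm_toCompletion (x : R) : ‖p.toCompletion x‖ = p x :=
  UniformSpace.Completion.norm_coe (E := p.Carrier) x

theorem denseRange_toCompletion : DenseRange p.toCompletion :=
  UniformSpace.Completion.denseRange_coe (α := p.Carrier)

variable {B : Type v} [CStarAlgebra B]

/-- A `*`-homomorphism on `R` that is bounded by `p`, as a map on the seminormed ring. -/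
def carrierHom (f : R →⋆ₐ[ℂ] B) : p.Carrier →+* B := (f : R →+* B)

theorem continuous_carrierHom (f : R →⋆ₐ[ℂ] B) (hf : ∀ x, ‖f x‖ ≤ p x) :
    Continuous (p.carrierHom f) :=
  AddMonoidHomClass.continuous_of_bound (p.carrierHom f) 1 fun x => by
    rw [one_mul]; exact hf x

/-- Extension to the completion of a `*`-homomorphism bounded by `p`. -/
def lift (f : R →⋆ₐ[ℂ] B) (hf : ∀ x, ‖f x‖ ≤ p x) : p.Completion →⋆ₐ[ℂ] B where
  toRingHom := UniformSpace.Completion.extensionHom (p.carrierHom f) (p.continuous_carrierHom f hf)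
  commutes' c := by
    have := UniformSpace.Completion.extensionHom_coe (p.carrierHom f)
      (p.continuous_carrierHom f hf) (algebraMap ℂ p.Carrier c)
    exact this.trans (AlgHomClass.commutes f c)
  map_star' x := by
    have hc : Continuous (UniformSpace.Completion.extensionHom (p.carrierHom f)
      (p.continuous_carrierHom f hf)) := UniformSpace.Completion.continuous_extension
    change UniformSpace.Completion.extensionHom (p.carrierHom f) _ (star x) =
      star (UniformSpace.Completion.extensionHom (p.carrierHom f) _ x)
    induction x using UniformSpace.Completion.induction_on with
    | hp =>
      exact isClosed_eq (hc.comp p.continuous_star_completion) (continuous_star.comp hc)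
    | ih x =>
      rw [star_coe, UniformSpace.Completion.extensionHom_coe,
        UniformSpace.Completion.extensionHom_coe]
      exact map_star f x

@[simp]
theorem lift_toCompletion (f : R →⋆ₐ[ℂ] B) (hf : ∀ x, ‖f x‖ ≤ p x) (x : R) :
    p.lift f hf (p.toCompletion x) = f x :=
  UniformSpace.Completion.extensionHom_coe (p.carrierHom f) (p.continuous_carrierHom f hf) x

end Completion

end CStarSeminorm

/-! ### The free `*`-algebra -/

/-- The free complex unital `*`-algebra on a set `X`: the free algebra on symbols `x` and `x*`,
with the conjugate-linear anti-multiplicative involution exchanging `x` and `x*`. -/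
def FreeStarAlgebra (X : Type u) : Type u := FreeAlgebra ℂ (X ⊕ X)

namespace FreeStarAlgebra

variable {X : Type u}

instance : Ring (FreeStarAlgebra X) := inferInstanceAs (Ring (FreeAlgebra ℂ (X ⊕ X)))
instance : Algebra ℂ (FreeStarAlgebra X) := inferInstanceAs (Algebra ℂ (FreeAlgebra ℂ (X ⊕ X)))

/-- The symbols: `Sum.inl x` gives `x`, and `Sum.inr x` gives `x*`. -/
def sym (x : X ⊕ X) : FreeStarAlgebra X := FreeAlgebra.ι ℂ x

/-- The generator `x`. -/
def gen (x : X) : FreeStarAlgebra X := sym (Sum.inl x)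

/-- The opposite algebra with complex conjugate scalar multiplication. -/
def ConjOp (X : Type u) : Type u := (FreeStarAlgebra X)ᵐᵒᵖ

instance : Ring (ConjOp X) := inferInstanceAs (Ring (FreeStarAlgebra X)ᵐᵒᵖ)
instance : Algebra ℂ (ConjOp X) :=
  RingHom.toAlgebra' ((algebraMap ℂ (FreeStarAlgebra X)ᵐᵒᵖ).comp (starRingEnd ℂ))
    fun c x => Algebra.commutes (A := (FreeStarAlgebra X)ᵐᵒᵖ) (starRingEnd ℂ c) x

/-- The involution, as a linear and multiplicative map to the conjugate opposite algebra. -/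
def starAux : FreeAlgebra ℂ (X ⊕ X) →ₐ[ℂ] ConjOp X :=
  FreeAlgebra.lift ℂ fun x =>
    (MulOpposite.op (sym x.swap) : (FreeStarAlgebra X)ᵐᵒᵖ)

instance : Star (FreeStarAlgebra X) where
  star x := MulOpposite.unop (starAux x : (FreeStarAlgebra X)ᵐᵒᵖ)

theorem star_sym (x : X ⊕ X) : star (sym x) = sym x.swap :=
  congrArg MulOpposite.unop (FreeAlgebra.lift_ι_apply (R := ℂ) (A := ConjOp X) _ x)

theorem star_algebraMap' (c : ℂ) :
    star (algebraMap ℂ (FreeStarAlgebra X) c) = algebraMap ℂ (FreeStarAlgebra X) (star c) :=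
  congrArg MulOpposite.unop (starAux.commutes c)

theorem star_mul'' (x y : FreeStarAlgebra X) : star (x * y) = star y * star x :=
  congrArg MulOpposite.unop (map_mul starAux x y)

theorem star_add'' (x y : FreeStarAlgebra X) : star (x + y) = star x + star y :=
  congrArg MulOpposite.unop (map_add starAux x y)

theorem induction_on {motive : FreeStarAlgebra X → Prop} (x : FreeStarAlgebra X)
    (scalar : ∀ c : ℂ, motive (algebraMap ℂ (FreeStarAlgebra X) c))
    (sym : ∀ x, motive (sym x))
    (mul : ∀ x y, motive x → motive y → motive (x * y))
    (add : ∀ x y, motive x → motive y → motive (x + y)) : motive x :=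
  FreeAlgebra.induction ℂ (X ⊕ X) (motive := motive) scalar sym mul add x

instance : StarRing (FreeStarAlgebra X) where
  star_involutive x := by
    induction x using induction_on with
    | scalar c => rw [star_algebraMap', star_algebraMap', star_star]
    | sym x => rw [star_sym, star_sym, Sum.swap_swap]
    | mul x y hx hy => rw [star_mul'', star_mul'', hx, hy]
    | add x y hx hy => rw [star_add'', star_add'', hx, hy]
  star_mul := star_mul''
  star_add := star_add''

instance : StarModule ℂ (FreeStarAlgebra X) where
  star_smul c x := by
    rw [Algebra.smul_def, star_mul, star_algebraMap', Algebra.smul_def, Algebra.commutes]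

/-- The `*`-homomorphism sending the generators to a given family of elements. -/
def lift {B : Type v} [Ring B] [StarRing B] [Algebra ℂ B] [StarModule ℂ B] (T : X → B) :
    FreeStarAlgebra X →⋆ₐ[ℂ] B where
  toAlgHom := (FreeAlgebra.lift ℂ (Sum.elim T fun x => star (T x)) :
    FreeAlgebra ℂ (X ⊕ X) →ₐ[ℂ] B)
  map_star' x := by
    let f : FreeStarAlgebra X →ₐ[ℂ] B :=
      (FreeAlgebra.lift ℂ (Sum.elim T fun x => star (T x)) : FreeAlgebra ℂ (X ⊕ X) →ₐ[ℂ] B)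
    change f (star x) = star (f x)
    have hι : ∀ y, f (sym y) = Sum.elim T (fun x => star (T x)) y :=
      fun y => FreeAlgebra.lift_ι_apply (R := ℂ) _ y
    induction x using induction_on with
    | scalar c =>
      rw [star_algebraMap', AlgHom.commutes, AlgHom.commutes, algebraMap_star_comm]
    | sym x =>
      rw [star_sym, hι, hι]
      cases x <;> simp
    | mul x y hx hy => rw [star_mul, map_mul, map_mul, hx, hy, star_mul]
    | add x y hx hy => rw [star_add, map_add, map_add, hx, hy, star_add]

@[simp]
theorem lift_gen {B : Type v} [Ring B] [StarRing B] [Algebra ℂ B] [StarModule ℂ B] (T : X → B)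
    (x : X) : lift T (gen x) = T x :=
  FreeAlgebra.lift_ι_apply (R := ℂ) _ (Sum.inl x)

end FreeStarAlgebra

/-! ### The Cuntz algebra -/

/-- The Cuntz relations `S_i* S_j = δ_{ij}` and `∑ S_j S_j* = 1`. -/
structure IsCuntzFamily {B : Type v} [Ring B] [StarRing B] {d : ℕ} (S : Fin d → B) : Prop where
  star_mul : ∀ i j, star (S i) * S j = if i = j then 1 else 0
  sum_mul_star : ∑ j, S j * star (S j) = 1

/-- A C*-seminorm on the free `*`-algebra on `d` generators that vanishes on the
Cuntz relations. -/
structure IsCuntzSeminorm {d : ℕ} (p : CStarSeminorm (FreeStarAlgebra (Fin d))) : Prop where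
  star_mul : ∀ i j, p (star (FreeStarAlgebra.gen i) * FreeStarAlgebra.gen j -
    if i = j then 1 else 0) = 0
  sum_mul_star : p (∑ j, FreeStarAlgebra.gen j * star (FreeStarAlgebra.gen j) - 1) = 0

theorem IsCuntzSeminorm.bounded {d : ℕ} (x : FreeStarAlgebra (Fin d)) :
    ∃ C : ℝ, ∀ p : {p : CStarSeminorm (FreeStarAlgebra (Fin d)) // IsCuntzSeminorm p},
      p.1 x ≤ C := by
  induction x using FreeStarAlgebra.induction_on with
  | scalar c =>
    refine ⟨‖c‖, fun p => ?_⟩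
    rw [Algebra.algebraMap_eq_smul_one, p.1.smul_eq]
    exact mul_le_of_le_one_right (norm_nonneg c) p.1.one_le_one
  | sym x =>
    refine ⟨1, fun p => ?_⟩
    have h1 : ∀ i, p.1 (FreeStarAlgebra.gen i) ≤ 1 := by
      intro i
      have h := p.2.star_mul i i
      rw [if_pos rfl] at h
      have h2 := p.1.add_le (star (FreeStarAlgebra.gen i) * FreeStarAlgebra.gen i - 1) 1
      rw [sub_add_cancel, h, zero_add, p.1.star_mul_self] at h2
      have h3 := h2.trans p.1.one_le_one
      have h4 := p.1.nonneg (FreeStarAlgebra.gen i)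
      nlinarith
    cases x with
    | inl i => exact h1 i
    | inr i =>
      have h : FreeStarAlgebra.sym (Sum.inr i) = star (FreeStarAlgebra.gen i) :=
        (FreeStarAlgebra.star_sym (Sum.inl i)).symm
      rw [h, p.1.star_eq]
      exact h1 i
  | mul x y hx hy =>
    obtain ⟨C, hC⟩ := hx
    obtain ⟨D, hD⟩ := hy
    refine ⟨|C| * |D|, fun p => (p.1.mul_le x y).trans ?_⟩
    exact mul_le_mul ((hC p).trans (le_abs_self C)) ((hD p).trans (le_abs_self D))
      (p.1.nonneg y) (abs_nonneg C)
  | add x y hx hy =>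
    obtain ⟨C, hC⟩ := hx
    obtain ⟨D, hD⟩ := hy
    exact ⟨C + D, fun p => (p.1.add_le x y).trans (add_le_add (hC p) (hD p))⟩

/-- The largest C*-seminorm on the free `*`-algebra that vanishes on the Cuntz relations. -/
def cuntzSeminorm (d : ℕ) : CStarSeminorm (FreeStarAlgebra (Fin d)) :=
  CStarSeminorm.iSup
    (fun p : {p : CStarSeminorm (FreeStarAlgebra (Fin d)) // IsCuntzSeminorm p} => p.1)
    IsCuntzSeminorm.bounded

theorem cuntzSeminorm_eq_zero {d : ℕ} {x : FreeStarAlgebra (Fin d)}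
    (h : ∀ p, IsCuntzSeminorm p → p x = 0) : cuntzSeminorm d x = 0 :=
  le_antisymm (CStarSeminorm.iSup_le _ _ _ 0 le_rfl fun p => (h p.1 p.2).le)
    (CStarSeminorm.nonneg _ _)

/-- The Cuntz algebra `𝒪_d`: the universal unital C*-algebra generated by elements `S_j`,
`j < d`, subject to the Cuntz relations. -/
def CuntzAlgebra (d : ℕ) : Type := (cuntzSeminorm d).Completion

namespace CuntzAlgebra

variable {d : ℕ}

instance : CStarAlgebra (CuntzAlgebra d) :=
  inferInstanceAs (CStarAlgebra (cuntzSeminorm d).Completion)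

/-- The generator `S_j` of the Cuntz algebra. -/
def S (j : Fin d) : CuntzAlgebra d := (cuntzSeminorm d).toCompletion (FreeStarAlgebra.gen j)

theorem isCuntzFamily_S : IsCuntzFamily (S : Fin d → CuntzAlgebra d) where
  star_mul i j := by
    have h := (cuntzSeminorm d).norm_toCompletion
      (star (FreeStarAlgebra.gen i) * FreeStarAlgebra.gen j - if i = j then 1 else 0)
    rw [cuntzSeminorm_eq_zero fun p hp => hp.star_mul i j, norm_eq_zero, map_sub, map_mul, map_star, sub_eq_zero] at h
    refine h.trans ?_
    split_ifs
    · exact map_one (cuntzSeminorm d).toCompletion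
    · exact map_zero (cuntzSeminorm d).toCompletion
  sum_mul_star := by
    have h := (cuntzSeminorm d).norm_toCompletion
      (∑ j, FreeStarAlgebra.gen j * star (FreeStarAlgebra.gen j) - 1)
    rw [cuntzSeminorm_eq_zero fun p hp => hp.sum_mul_star, norm_eq_zero, map_sub, map_sum, map_one, sub_eq_zero] at h
    simp only [map_mul, map_star] at h
    exact h

theorem norm_lift_le {B : Type v} [CStarAlgebra B] {T : Fin d → B} (hT : IsCuntzFamily T)
    (x : FreeStarAlgebra (Fin d)) : ‖FreeStarAlgebra.lift T x‖ ≤ cuntzSeminorm d x := by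
  have h : IsCuntzSeminorm (CStarSeminorm.ofHom (FreeStarAlgebra.lift T)) := by
    constructor
    · intro i j
      change ‖FreeStarAlgebra.lift T _‖ = 0
      rw [map_sub, map_mul, map_star, FreeStarAlgebra.lift_gen, FreeStarAlgebra.lift_gen,
        hT.star_mul]
      split_ifs <;> simp
    · change ‖FreeStarAlgebra.lift T _‖ = 0
      rw [map_sub, map_sum, map_one]
      simp only [map_mul, map_star, FreeStarAlgebra.lift_gen, hT.sum_mul_star, sub_self, norm_zero]
  exact CStarSeminorm.le_iSup
    (fun p : {p : CStarSeminorm (FreeStarAlgebra (Fin d)) // IsCuntzSeminorm p} => p.1)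
    IsCuntzSeminorm.bounded ⟨_, h⟩ x

/-- The universal property of the Cuntz algebra. -/
def lift {B : Type v} [CStarAlgebra B] {T : Fin d → B} (hT : IsCuntzFamily T) :
    CuntzAlgebra d →⋆ₐ[ℂ] B :=
  (cuntzSeminorm d).lift (FreeStarAlgebra.lift T) (norm_lift_le hT)

@[simp]
theorem lift_S {B : Type v} [CStarAlgebra B] {T : Fin d → B} (hT : IsCuntzFamily T) (j : Fin d) :
    lift hT (S j) = T j :=
  ((cuntzSeminorm d).lift_toCompletion _ _ _).trans (FreeStarAlgebra.lift_gen T j)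

end CuntzAlgebra

/-! ### The minimal (spatial) tensor product -/

/-- A `*`-representation of a C*-algebra on a Hilbert space. -/
structure HilbertRep (A : Type u) [CStarAlgebra A] : Type (u + 1) where
  /-- The Hilbert space. -/
  H : Type u
  [normed : NormedAddCommGroup H]
  [inner : InnerProductSpace ℂ H]
  [complete : CompleteSpace H]
  /-- The `*`-homomorphism into the bounded operators. -/
  π : A →⋆ₐ[ℂ] (H →L[ℂ] H)

namespace HilbertRep

attribute [instance] HilbertRep.normed HilbertRep.inner HilbertRep.complete

/-- Restriction of a representation along a `*`-homomorphism. -/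
def comp {A B : Type u} [CStarAlgebra A] [CStarAlgebra B] (σ : HilbertRep B) (f : A →⋆ₐ[ℂ] B) :
    HilbertRep A where
  H := σ.H
  π := σ.π.comp f

end HilbertRep

/-- The tensor product of two Hilbert spaces (not completed), with the inner product
`⟪x ⊗ y, x' ⊗ y'⟫ = ⟪x, x'⟫ ⟪y, y'⟫`. -/
def PreHilbertTensor (H : Type u) (K : Type v) [NormedAddCommGroup H] [InnerProductSpace ℂ H]
    [NormedAddCommGroup K] [InnerProductSpace ℂ K] : Type (max u v) :=
  H ⊗[ℂ] K

namespace PreHilbertTensor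

variable {H : Type u} {K : Type v} [NormedAddCommGroup H] [InnerProductSpace ℂ H]
  [NormedAddCommGroup K] [InnerProductSpace ℂ K]

instance : NormedAddCommGroup (PreHilbertTensor H K) :=
  inferInstanceAs (NormedAddCommGroup (H ⊗[ℂ] K))

instance : InnerProductSpace ℂ (PreHilbertTensor H K) :=
  inferInstanceAs (InnerProductSpace ℂ (H ⊗[ℂ] K))

/-- The elementary tensor `x ⊗ y`. -/
def tmul (x : H) (y : K) : PreHilbertTensor H K := x ⊗ₜ[ℂ] y

theorem inner_tmul (x x' : H) (y y' : K) :
    inner ℂ (tmul x y) (tmul x' y') = inner ℂ x x' * inner ℂ y y' :=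
  TensorProduct.inner_tmul ..

theorem induction_on {motive : PreHilbertTensor H K → Prop} (v : PreHilbertTensor H K)
    (zero : motive 0) (tmul : ∀ x y, motive (tmul x y))
    (add : ∀ v w, motive v → motive w → motive (v + w)) : motive v :=
  TensorProduct.induction_on (motive := motive) v zero tmul add

/-- The operator `S ⊗ T`. -/
def op (S : H →L[ℂ] H) (T : K →L[ℂ] K) :
    PreHilbertTensor H K →L[ℂ] PreHilbertTensor H K :=
  TensorProduct.mapL S T

theorem op_tmul (S : H →L[ℂ] H) (T : K →L[ℂ] K) (x : H) (y : K) :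
    op S T (tmul x y) = tmul (S x) (T y) := rfl

theorem op_one_one : op (1 : H →L[ℂ] H) (1 : K →L[ℂ] K) = 1 := TensorProduct.mapL_id_id

theorem op_mul (S S' : H →L[ℂ] H) (T T' : K →L[ℂ] K) :
    op (S * S') (T * T') = op S T * op S' T' := TensorProduct.mapL_mul S S' T T'

theorem op_add_left (S S' : H →L[ℂ] H) (T : K →L[ℂ] K) :
    op (S + S') T = op S T + op S' T := TensorProduct.mapL_add_left S S' T

theorem op_add_right (S : H →L[ℂ] H) (T T' : K →L[ℂ] K) :
    op S (T + T') = op S T + op S T' := TensorProduct.mapL_add_right S T T'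

theorem op_smul_left (c : ℂ) (S : H →L[ℂ] H) (T : K →L[ℂ] K) :
    op (c • S) T = c • op S T := TensorProduct.mapL_smul_left c S T

theorem op_smul_right (c : ℂ) (S : H →L[ℂ] H) (T : K →L[ℂ] K) :
    op S (c • T) = c • op S T := TensorProduct.mapL_smul_right c S T

theorem norm_op_le (S : H →L[ℂ] H) (T : K →L[ℂ] K) : ‖op S T‖ ≤ ‖S‖ * ‖T‖ :=
  TensorProduct.norm_mapL_le S T

end PreHilbertTensor

namespace MinTensor

section Spatial

variable {A : Type u} {B : Type v} [CStarAlgebra A] [CStarAlgebra B]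
  {H : Type u} {K : Type v} [NormedAddCommGroup H] [InnerProductSpace ℂ H] [CompleteSpace H]
  [NormedAddCommGroup K] [InnerProductSpace ℂ K] [CompleteSpace K]

open PreHilbertTensor

/-- The algebra homomorphism `π ⊗ σ` with `(π ⊗ σ)(a ⊗ b) = π(a) ⊗ σ(b)`. -/
def spatialHom (π : A →⋆ₐ[ℂ] (H →L[ℂ] H)) (σ : B →⋆ₐ[ℂ] (K →L[ℂ] K)) :
    A ⊗[ℂ] B →ₐ[ℂ] (PreHilbertTensor H K →L[ℂ] PreHilbertTensor H K) :=
  Algebra.TensorProduct.lift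
    (AlgHom.ofLinearMap
      { toFun := fun a => op (π a) (1 : K →L[ℂ] K)
        map_add' := fun a b => by rw [map_add, op_add_left]
        map_smul' := fun c a => by rw [map_smul, op_smul_left, RingHom.id_apply] }
      (by change op (π 1) 1 = 1; rw [map_one, op_one_one])
      (fun a b => by
        change op (π (a * b)) 1 = op (π a) 1 * op (π b) 1
        rw [map_mul, ← op_mul, one_mul]))
    (AlgHom.ofLinearMap
      { toFun := fun b => op (1 : H →L[ℂ] H) (σ b)
        map_add' := fun a b => by rw [map_add, op_add_right]
        map_smul' := fun c a => by rw [map_smul, op_smul_right, RingHom.id_apply] }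
      (by change op 1 (σ 1) = 1; rw [map_one, op_one_one])
      (fun a b => by
        change op 1 (σ (a * b)) = op 1 (σ a) * op 1 (σ b)
        rw [map_mul, ← op_mul, one_mul]))
    fun a b => by
      change op (π a) 1 * op 1 (σ b) = op 1 (σ b) * op (π a) 1
      rw [← op_mul, ← op_mul, one_mul, mul_one, one_mul, mul_one]

theorem spatialHom_tmul (π : A →⋆ₐ[ℂ] (H →L[ℂ] H)) (σ : B →⋆ₐ[ℂ] (K →L[ℂ] K)) (a : A) (b : B) :
    spatialHom π σ (a ⊗ₜ b) = op (π a) (σ b) := by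
  change op (π a) 1 * op 1 (σ b) = _
  rw [← op_mul, one_mul, mul_one]

theorem inner_spatialHom_star (π : A →⋆ₐ[ℂ] (H →L[ℂ] H)) (σ : B →⋆ₐ[ℂ] (K →L[ℂ] K)) (x : A ⊗[ℂ] B)
    (v w : PreHilbertTensor H K) :
    inner ℂ (spatialHom π σ (star x) v) w = inner ℂ v (spatialHom π σ x w) := by
  induction x using TensorProduct.induction_on with
  | zero => simp
  | add x y hx hy => rw [star_add, map_add, map_add, _root_.add_apply, inner_add_left, hx, hy,
      _root_.add_apply, inner_add_right]
  | tmul a b =>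
    rw [TensorProduct.star_tmul, spatialHom_tmul, spatialHom_tmul, map_star, map_star]
    induction v using PreHilbertTensor.induction_on with
    | zero => simp
    | add v v' hv hv' => rw [map_add, inner_add_left, inner_add_left, hv, hv']
    | tmul v v' =>
      induction w using PreHilbertTensor.induction_on with
      | zero => simp
      | add w w' hw hw' => rw [map_add, inner_add_right, inner_add_right, hw, hw']
      | tmul w w' =>
        rw [op_tmul, op_tmul, PreHilbertTensor.inner_tmul, PreHilbertTensor.inner_tmul, ContinuousLinearMap.star_eq_adjoint,
          ContinuousLinearMap.star_eq_adjoint, ContinuousLinearMap.adjoint_inner_left,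
          ContinuousLinearMap.adjoint_inner_left]

theorem norm_spatialHom_sq_le (π : A →⋆ₐ[ℂ] (H →L[ℂ] H)) (σ : B →⋆ₐ[ℂ] (K →L[ℂ] K)) (x : A ⊗[ℂ] B) :
    ‖spatialHom π σ x‖ ^ 2 ≤ ‖spatialHom π σ (star x * x)‖ := by
  have h : ‖spatialHom π σ x‖ ≤ Real.sqrt ‖spatialHom π σ (star x * x)‖ := by
    refine ContinuousLinearMap.opNorm_le_bound _ (Real.sqrt_nonneg _) fun v => ?_
    rw [← Real.sqrt_sq (norm_nonneg v), ← Real.sqrt_mul (norm_nonneg _)]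
    refine Real.le_sqrt_of_sq_le ?_
    have h1 : inner ℂ (spatialHom π σ (star x * x) v) v =
        inner ℂ (spatialHom π σ x v) (spatialHom π σ x v) := by
      rw [map_mul]
      exact inner_spatialHom_star π σ x _ _
    calc ‖spatialHom π σ x v‖ ^ 2
        = ‖inner ℂ (spatialHom π σ x v) (spatialHom π σ x v)‖ := by
          rw [inner_self_eq_norm_sq_to_K]; simp
      _ ≤ ‖spatialHom π σ (star x * x) v‖ * ‖v‖ := by
          rw [← h1]; exact norm_inner_le_norm _ _
      _ ≤ ‖spatialHom π σ (star x * x)‖ * ‖v‖ * ‖v‖ := by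
          gcongr
          exact ContinuousLinearMap.le_opNorm _ _
      _ = _ := by ring
  calc ‖spatialHom π σ x‖ ^ 2 ≤ Real.sqrt ‖spatialHom π σ (star x * x)‖ ^ 2 := by gcongr
    _ = _ := Real.sq_sqrt (norm_nonneg _)

theorem norm_spatialHom_star_le (π : A →⋆ₐ[ℂ] (H →L[ℂ] H)) (σ : B →⋆ₐ[ℂ] (K →L[ℂ] K)) (x : A ⊗[ℂ] B) :
    ‖spatialHom π σ (star x)‖ ≤ ‖spatialHom π σ x‖ := by
  have h := norm_spatialHom_sq_le π σ (star x)
  rw [star_star, map_mul] at h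
  have h2 := h.trans (norm_mul_le _ _)
  by_cases h0 : ‖spatialHom π σ (star x)‖ = 0
  · rw [h0]; exact norm_nonneg _
  · have : 0 < ‖spatialHom π σ (star x)‖ := lt_of_le_of_ne (norm_nonneg _) (Ne.symm h0)
    nlinarith

/-- The operator norm of `(π ⊗ σ)(x)`. -/
def spatialSeminorm (π : A →⋆ₐ[ℂ] (H →L[ℂ] H)) (σ : B →⋆ₐ[ℂ] (K →L[ℂ] K)) : CStarSeminorm (A ⊗[ℂ] B) where
  toFun x := ‖spatialHom π σ x‖
  map_zero' := by simp
  add_le' x y := by rw [map_add]; exact norm_add_le _ _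
  neg' x := by simp
  smul' c x := by simp [norm_smul]
  mul_le' x y := by rw [map_mul]; exact norm_mul_le _ _
  star_mul_self' x := by
    refine le_antisymm ?_ (norm_spatialHom_sq_le π σ x)
    rw [map_mul, sq]
    exact (norm_mul_le _ _).trans
      (mul_le_mul_of_nonneg_right (norm_spatialHom_star_le π σ x) (norm_nonneg _))

theorem spatialSeminorm_bounded (x : A ⊗[ℂ] B) :
    ∃ C : ℝ, ∀ i : HilbertRep A × HilbertRep B, spatialSeminorm i.1.π i.2.π x ≤ C := by
  induction x using TensorProduct.induction_on with
  | zero => exact ⟨0, fun i => (map_zero (spatialSeminorm i.1.π i.2.π).toSeminorm).le⟩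
  | add x y hx hy =>
    obtain ⟨C, hC⟩ := hx
    obtain ⟨D, hD⟩ := hy
    exact ⟨C + D, fun i => (CStarSeminorm.add_le _ x y).trans (add_le_add (hC i) (hD i))⟩
  | tmul a b =>
    refine ⟨‖a‖ * ‖b‖, fun i => ?_⟩
    change ‖spatialHom i.1.π i.2.π (a ⊗ₜ b)‖ ≤ _
    rw [spatialHom_tmul]
    refine (norm_op_le _ _).trans ?_
    gcongr
    · exact NonUnitalStarAlgHom.norm_apply_le _ a
    · exact NonUnitalStarAlgHom.norm_apply_le _ b

end Spatial

/-- The minimal C*-norm `‖x‖ = sup ‖(π ⊗ σ)(x)‖` over all pairs of `*`-representations. -/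
def minSeminorm (A : Type u) (B : Type v) [CStarAlgebra A] [CStarAlgebra B] :
    CStarSeminorm (A ⊗[ℂ] B) :=
  CStarSeminorm.iSup (fun i : HilbertRep A × HilbertRep B => spatialSeminorm i.1.π i.2.π)
    spatialSeminorm_bounded

end MinTensor

/-- The minimal tensor product of two unital C*-algebras. -/
def MinTensor (A : Type u) (B : Type v) [CStarAlgebra A] [CStarAlgebra B] : Type (max u v) :=
  (MinTensor.minSeminorm A B).Completion

infixl:70 " ⊗ᵐ " => MinTensor

namespace MinTensor

section

variable {A : Type u} {B : Type v} [CStarAlgebra A] [CStarAlgebra B]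

instance : CStarAlgebra (A ⊗ᵐ B) := inferInstanceAs (CStarAlgebra (minSeminorm A B).Completion)

/-- The canonical map from the algebraic tensor product. -/
def ofAlg : A ⊗[ℂ] B →⋆ₐ[ℂ] A ⊗ᵐ B := (minSeminorm A B).toCompletion

/-- The elementary tensor `a ⊗ b`. -/
def tmul (a : A) (b : B) : A ⊗ᵐ B := ofAlg (a ⊗ₜ b)

theorem tmul_mul_tmul (a a' : A) (b b' : B) :
    tmul a b * tmul a' b' = tmul (a * a') (b * b') := by
  rw [tmul, tmul, ← map_mul, Algebra.TensorProduct.tmul_mul_tmul, tmul]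

theorem star_tmul (a : A) (b : B) : star (tmul a b) = tmul (star a) (star b) := by
  rw [tmul, ← map_star, TensorProduct.star_tmul, tmul]

theorem one_tmul_one : tmul (1 : A) (1 : B) = 1 := map_one (ofAlg (A := A) (B := B))

/-- The `*`-homomorphism `a ↦ a ⊗ 1`. -/
def inl : A →⋆ₐ[ℂ] A ⊗ᵐ B :=
  ofAlg.comp
    { (Algebra.TensorProduct.includeLeft : A →ₐ[ℂ] A ⊗[ℂ] B) with
      map_star' := fun a => by simp }

theorem inl_apply (a : A) : inl a = tmul a (1 : B) := rfl

end

section Map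

variable {A A' : Type u} {B B' : Type v} [CStarAlgebra A] [CStarAlgebra B] [CStarAlgebra A']
  [CStarAlgebra B']

/-- The algebraic tensor product of two `*`-homomorphisms. -/
def algMap (f : A →⋆ₐ[ℂ] A') (g : B →⋆ₐ[ℂ] B') : A ⊗[ℂ] B →⋆ₐ[ℂ] A' ⊗[ℂ] B' :=
  { Algebra.TensorProduct.map (f : A →ₐ[ℂ] A') (g : B →ₐ[ℂ] B') with
    map_star' := fun x => by
      change Algebra.TensorProduct.map (f : A →ₐ[ℂ] A') (g : B →ₐ[ℂ] B') (star x) =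
        star (Algebra.TensorProduct.map (f : A →ₐ[ℂ] A') (g : B →ₐ[ℂ] B') x)
      induction x using TensorProduct.induction_on with
      | zero => simp
      | tmul a b => simp [map_star]
      | add x y hx hy => rw [star_add, map_add, hx, hy, map_add, star_add] }

theorem algMap_tmul (f : A →⋆ₐ[ℂ] A') (g : B →⋆ₐ[ℂ] B') (a : A) (b : B) :
    algMap f g (a ⊗ₜ b) = f a ⊗ₜ g b := rfl

theorem spatialHom_algMap {H : Type u} {K : Type v} [NormedAddCommGroup H]
    [InnerProductSpace ℂ H] [CompleteSpace H] [NormedAddCommGroup K] [InnerProductSpace ℂ K]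
    [CompleteSpace K] (π : A' →⋆ₐ[ℂ] (H →L[ℂ] H)) (σ : B' →⋆ₐ[ℂ] (K →L[ℂ] K))
    (f : A →⋆ₐ[ℂ] A') (g : B →⋆ₐ[ℂ] B') (x : A ⊗[ℂ] B) :
    spatialHom π σ (algMap f g x) = spatialHom (π.comp f) (σ.comp g) x := by
  induction x using TensorProduct.induction_on with
  | zero => simp
  | tmul a b => rw [algMap_tmul, spatialHom_tmul, spatialHom_tmul]; rfl
  | add x y hx hy => rw [map_add, map_add, hx, hy, map_add]

theorem norm_algMap_le (f : A →⋆ₐ[ℂ] A') (g : B →⋆ₐ[ℂ] B') (x : A ⊗[ℂ] B) :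
    ‖(ofAlg.comp (algMap f g)) x‖ ≤ minSeminorm A B x := by
  refine ((minSeminorm A' B').norm_toCompletion _).trans_le ?_
  refine CStarSeminorm.iSup_le _ _ _ _ (CStarSeminorm.nonneg _ _) fun i => ?_
  change ‖spatialHom i.1.π i.2.π (algMap f g x)‖ ≤ _
  rw [spatialHom_algMap]
  exact CStarSeminorm.le_iSup (fun i : HilbertRep A × HilbertRep B =>
    spatialSeminorm i.1.π i.2.π) spatialSeminorm_bounded (i.1.comp f, i.2.comp g) x

/-- The tensor product `f ⊗ g` of two unital `*`-homomorphisms. -/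
def map (f : A →⋆ₐ[ℂ] A') (g : B →⋆ₐ[ℂ] B') : A ⊗ᵐ B →⋆ₐ[ℂ] A' ⊗ᵐ B' :=
  (minSeminorm A B).lift (ofAlg.comp (algMap f g)) (norm_algMap_le f g)

theorem map_tmul (f : A →⋆ₐ[ℂ] A') (g : B →⋆ₐ[ℂ] B') (a : A) (b : B) :
    map f g (tmul a b) = tmul (f a) (g b) :=
  (minSeminorm A B).lift_toCompletion _ _ _

end Map

end MinTensor

/-! ### Compact quantum groups and their finite-dimensional unitary representations -/

/-- The canonical identification of `(A ⊗ A) ⊗ A` with `A ⊗ (A ⊗ A)`, as a relation: the closure of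
`{(ι z, ι' z)}`, where `z` runs through the algebraic tensor product and `ι`, `ι'` are its
canonical maps to the two completions. -/
def MinTensor.AssocRel {A : Type u} [CStarAlgebra A] (x : (A ⊗ᵐ A) ⊗ᵐ A) (y : A ⊗ᵐ (A ⊗ᵐ A)) :
    Prop :=
  (x, y) ∈ closure (Set.range fun z : (A ⊗[ℂ] A) ⊗[ℂ] A =>
    ((MinTensor.ofAlg (TensorProduct.map (MinTensor.ofAlg : A ⊗[ℂ] A →⋆ₐ[ℂ] A ⊗ᵐ A).toLinearMap
        LinearMap.id z) : (A ⊗ᵐ A) ⊗ᵐ A),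
      (MinTensor.ofAlg (TensorProduct.map LinearMap.id
        (MinTensor.ofAlg : A ⊗[ℂ] A →⋆ₐ[ℂ] A ⊗ᵐ A).toLinearMap
        (TensorProduct.assoc ℂ A A A z)) : A ⊗ᵐ (A ⊗ᵐ A))))

/-- A compact quantum group `𝔾` with `C(𝔾) = A`. -/
structure CompactQuantumGroup (A : Type u) [CStarAlgebra A] where
  nontrivial : Nontrivial A
  separable : TopologicalSpace.SeparableSpace A
  /-- The comultiplication. -/
  Δ : A →⋆ₐ[ℂ] A ⊗ᵐ A
  /-- Coassociativity `(Δ ⊗ id) Δ = (id ⊗ Δ) Δ` in `A ⊗ A ⊗ A`. -/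
  coassoc : ∀ a, MinTensor.AssocRel
    (MinTensor.map Δ (StarAlgHom.id ℂ A) (Δ a)) (MinTensor.map (StarAlgHom.id ℂ A) Δ (Δ a))
  /-- Cancellation: `(A ⊗ 1) Δ(A)` spans a dense subspace. -/
  cancel_left : Dense (Submodule.span ℂ
    {x : A ⊗ᵐ A | ∃ a b, x = MinTensor.tmul a 1 * Δ b} : Set (A ⊗ᵐ A))
  /-- Cancellation: `(1 ⊗ A) Δ(A)` spans a dense subspace. -/
  cancel_right : Dense (Submodule.span ℂ
    {x : A ⊗ᵐ A | ∃ a b, x = MinTensor.tmul 1 a * Δ b} : Set (A ⊗ᵐ A))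

section Representations

variable {A : Type u} [CStarAlgebra A] {m n : Type*} [Fintype m] [Fintype n]

/-- A matrix `α` over `C(𝔾)` is a unitary representation of `𝔾`. -/
structure CompactQuantumGroup.IsUnitaryRep (G : CompactQuantumGroup A) [DecidableEq n]
    (α : Matrix n n A) : Prop where
  star_mul : ∀ i j, ∑ k, star (α k i) * α k j = if i = j then 1 else 0
  mul_star : ∀ i j, ∑ k, α i k * star (α j k) = if i = j then 1 else 0
  comul : ∀ i j, G.Δ (α i j) = ∑ k, MinTensor.tmul (α i k) (α k j)

namespace MatrixRep

/-- The action `δ_α(w) = ∑ i, w i • ∑ j, e j ⊗ α j i`, as a vector with entries in `A`. -/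
def action (α : Matrix n n A) (w : n → ℂ) : n → A := fun k => ∑ i, w i • α k i

/-- The subspace `W` is invariant: `δ_α(W) ⊆ W ⊗ A` inside `ℂⁿ ⊗ A = Aⁿ`. -/
def IsInvariant (α : Matrix n n A) (W : Submodule ℂ (n → ℂ)) : Prop :=
  ∀ w ∈ W, action α w ∈ Submodule.span ℂ {f : n → A | ∃ w' ∈ W, ∃ a : A, f = fun k => w' k • a}

/-- The representation is irreducible: it acts on a nonzero space that has no invariant subspaces
besides `0` and itself. -/
def IsIrreducible (α : Matrix n n A) : Prop :=
  Nonempty n ∧ ∀ W : Submodule ℂ (n → ℂ), IsInvariant α W → W = ⊥ ∨ W = ⊤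

/-- The representation `β` is contained in `α`: there is an isometric intertwiner `V`. -/
def IsContained [DecidableEq m] (β : Matrix m m A) (α : Matrix n n A) : Prop :=
  ∃ V : Matrix n m ℂ, V.conjTranspose * V = 1 ∧
    V.map (algebraMap ℂ A) * β = α * V.map (algebraMap ℂ A)

/-- The tensor product of two representations. -/
def tensor (α : Matrix n n A) (β : Matrix m m A) : Matrix (n × m) (n × m) A :=
  Matrix.of fun i j => α i.1 j.1 * β i.2 j.2

/-- The `ℓ`-th tensor power `α^ℓ`, on `(ℂⁿ)^{⊗ ℓ} = ℂ^{n^ℓ}`. -/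
def tensorPow (α : Matrix n n A) (ℓ : ℕ) : Matrix (Fin ℓ → n) (Fin ℓ → n) A :=
  Matrix.of fun i j => (List.ofFn fun k => α (i k) (j k)).prod

/-- There is a nonzero vector `ξ` with `δ_α(ξ) = ξ ⊗ 1`. -/
def HasInvariantVector (α : Matrix n n A) : Prop :=
  ∃ ξ : n → ℂ, ξ ≠ 0 ∧ action α ξ = fun k => ξ k • (1 : A)

end MatrixRep

namespace CompactQuantumGroup

variable (G : CompactQuantumGroup A)

/-- `β` is an irreducible unitary representation that appears in some tensor power of `α`. -/
def IsIrreducibleIn (α : Matrix n n A) {k : ℕ} (β : Matrix (Fin k) (Fin k) A) : Prop :=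
  G.IsUnitaryRep β ∧ MatrixRep.IsIrreducible β ∧
    ∃ ℓ : ℕ, MatrixRep.IsContained β (MatrixRep.tensorPow α ℓ)

/-- Every irreducible `β` appearing in the tensor powers of `α` has a partner `β'`, also appearing
in the tensor powers of `α`, such that `β ⊗ β'` has a nonzero invariant vector. -/
def HasPartners (α : Matrix n n A) : Prop :=
  ∀ (k : ℕ) (β : Matrix (Fin k) (Fin k) A), G.IsIrreducibleIn α β →
    ∃ (k' : ℕ) (β' : Matrix (Fin k') (Fin k') A), G.IsIrreducibleIn α β' ∧
      MatrixRep.HasInvariantVector (MatrixRep.tensor β β')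

end CompactQuantumGroup

end Representations

/-! ### The action on the Cuntz algebra and its fixed point algebra -/

namespace CompactQuantumGroup

variable {A : Type u} [CStarAlgebra A] {G : CompactQuantumGroup A} {d : ℕ}
  {α : Matrix (Fin d) (Fin d) A}

open MinTensor in
theorem IsUnitaryRep.isCuntzFamily (hα : G.IsUnitaryRep α) :
    IsCuntzFamily fun i : Fin d => ∑ j, tmul (CuntzAlgebra.S j : CuntzAlgebra d) (α j i) where
  star_mul i j := by
    have hS := CuntzAlgebra.isCuntzFamily_S (d := d)
    have h0 : ∀ b : A, tmul (0 : CuntzAlgebra d) b = 0 := fun b => by simp [tmul]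
    have hs : ∑ k, tmul (1 : CuntzAlgebra d) (star (α k i) * α k j) =
        tmul 1 (∑ k, star (α k i) * α k j) := by
      simp only [tmul, TensorProduct.tmul_sum, map_sum]
    simp only [star_sum, star_tmul, Finset.sum_mul_sum, tmul_mul_tmul, hS.star_mul]
    have h1 : ∀ k l, tmul (if k = l then (1 : CuntzAlgebra d) else 0) (star (α k i) * α l j) =
        if k = l then tmul (1 : CuntzAlgebra d) (star (α k i) * α l j) else 0 := by
      intro k l
      split_ifs
      · rfl
      · exact h0 _
    simp only [h1, Finset.sum_ite_eq, Finset.mem_univ, if_true]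
    rw [hs, hα.star_mul]
    split_ifs
    · exact one_tmul_one
    · simp [tmul]
  sum_mul_star := by
    have hS := CuntzAlgebra.isCuntzFamily_S (d := d)
    simp only [star_sum, star_tmul, Finset.sum_mul_sum, tmul_mul_tmul]
    rw [Finset.sum_comm]
    have h1 : ∀ k, ∑ i, ∑ l, tmul (CuntzAlgebra.S k * star (CuntzAlgebra.S l) : CuntzAlgebra d)
        (α k i * star (α l i)) = tmul (CuntzAlgebra.S k * star (CuntzAlgebra.S k)) 1 := by
      intro k
      rw [Finset.sum_comm]
      have h2 : ∀ l, ∑ i, tmul (CuntzAlgebra.S k * star (CuntzAlgebra.S l) : CuntzAlgebra d)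
          (α k i * star (α l i)) =
          if k = l then tmul (CuntzAlgebra.S k * star (CuntzAlgebra.S l)) 1 else 0 := by
        intro l
        have h3 : ∑ i, tmul (CuntzAlgebra.S k * star (CuntzAlgebra.S l) : CuntzAlgebra d)
            (α k i * star (α l i)) =
            tmul (CuntzAlgebra.S k * star (CuntzAlgebra.S l)) (∑ i, α k i * star (α l i)) := by
          simp only [tmul, TensorProduct.tmul_sum, map_sum]
        rw [h3, hα.mul_star]
        split_ifs
        · rfl
        · simp [tmul]
      simp only [h2, Finset.sum_ite_eq, Finset.mem_univ, if_true]
    simp only [h1]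
    have h4 : ∑ k, tmul (CuntzAlgebra.S k * star (CuntzAlgebra.S k) : CuntzAlgebra d) (1 : A) =
        tmul (∑ k, CuntzAlgebra.S k * star (CuntzAlgebra.S k)) 1 := by
      simp only [tmul, TensorProduct.sum_tmul, map_sum]
    rw [h4, hS.sum_mul_star, one_tmul_one]

/-- The action of `𝔾` on the Cuntz algebra, `δ(S_i) = ∑ j, S_j ⊗ α_{ji}`. -/
def IsUnitaryRep.cuntzAction (hα : G.IsUnitaryRep α) :
    CuntzAlgebra d →⋆ₐ[ℂ] CuntzAlgebra d ⊗ᵐ A :=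
  CuntzAlgebra.lift hα.isCuntzFamily

theorem IsUnitaryRep.cuntzAction_S (hα : G.IsUnitaryRep α) (i : Fin d) :
    hα.cuntzAction (CuntzAlgebra.S i) = ∑ j, MinTensor.tmul (CuntzAlgebra.S j) (α j i) :=
  CuntzAlgebra.lift_S _ i

/-- The fixed point algebra `{T | δ(T) = T ⊗ 1}` in the Cuntz algebra. -/
def IsUnitaryRep.fixedPointAlgebra (hα : G.IsUnitaryRep α) : StarSubalgebra ℂ (CuntzAlgebra d) :=
  StarAlgHom.equalizer hα.cuntzAction MinTensor.inl

theorem IsUnitaryRep.mem_fixedPointAlgebra (hα : G.IsUnitaryRep α) (T : CuntzAlgebra d) :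
    T ∈ hα.fixedPointAlgebra ↔ hα.cuntzAction T = MinTensor.tmul T 1 := Iff.rfl

theorem IsUnitaryRep.isClosed_fixedPointAlgebra (hα : G.IsUnitaryRep α) :
    IsClosed (hα.fixedPointAlgebra : Set (CuntzAlgebra d)) :=
  isClosed_eq
    (AddMonoidHomClass.continuous_of_bound hα.cuntzAction 1 fun x => by
      rw [one_mul]; exact NonUnitalStarAlgHom.norm_apply_le _ x)
    (AddMonoidHomClass.continuous_of_bound
      (MinTensor.inl : CuntzAlgebra d →⋆ₐ[ℂ] CuntzAlgebra d ⊗ᵐ A) 1 fun x => by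
        rw [one_mul]; exact NonUnitalStarAlgHom.norm_apply_le _ x)

instance (hα : G.IsUnitaryRep α) : CStarAlgebra hα.fixedPointAlgebra :=
  haveI := hα.isClosed_fixedPointAlgebra
  StarSubalgebra.cstarAlgebra hα.fixedPointAlgebra

end CompactQuantumGroup

/-- A unital C*-algebra `C` is simple and purely infinite: it is simple, is not reduced to the
scalars, and for any nonzero `T` and any `ε > 0` there are `a`, `b` with `‖a T b - 1‖ ≤ ε`. -/
structure IsSimplePurelyInfinite (C : Type u) [CStarAlgebra C] : Prop where
  simple : IsSimpleRing C
  not_scalar : ∃ T : C, ∀ c : ℂ, T ≠ algebraMap ℂ C c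
  approx : ∀ T : C, T ≠ 0 → ∀ ε : ℝ, 0 < ε → ∃ a b : C, ‖a * T * b - 1‖ ≤ ε

end

/-! Write `φ` for the canonical endomorphism `shift`, `x ↦ ∑ S_i x S_i*`, and identify the tensors
of `(ℂᵈ)^{⊗ ℓ}` with combinations of the words `S_μ` of length `ℓ` (`tvec`). Everything reduces to
one compression: if `T` is self-adjoint, fixed, and a finite combination of `S_μ S_ν*` with words of
length at most `k`, then some isometry `R` of the fixed point algebra satisfies `R* T R = c · 1`,
where `|c|` is the norm of the gauge-invariant part `Y` of `T` (`exists_compression`).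

To build `R`, note that `Y` is a self-adjoint matrix on `(ℂᵈ)^{⊗ k}`, so it has an eigenvector `v`
whose eigenvalue `c` has modulus `‖Y‖`. Since `α` is reducible, there is a fixed projection `p`
acting on `ℂᵈ` with vectors `v₁` in its range and `v₂` in its kernel. Let `W` be the space of
tensors `w` of degree `2k+1` with `Y w = c w`, `φ^j(p) w = w` for `k ≤ j < 2k`, and `φ^{2k}(p) w =
0`. It contains `v ⊗ v₁^{⊗ k} ⊗ v₂`, and it is invariant because it is cut out by fixed elements
(`isInvariant_annihilator`). An irreducible `β` inside `W`, paired with its partner `β'`, has an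
invariant vector, which is a multiple of a fixed isometry `R` whose first tensor leg lies in `W`
(`exists_isometry_mem`). So `R` inherits the equations of `W`, and `R* Y R = c`. The terms with `|μ|
≠ |ν|` vanish, because `φ^{N+|μ|}(p) S_μ S_ν* = S_μ S_ν* φ^{N+|ν|}(p)` and `N` can be chosen so that
one of the two projections acts as `1` on `R` and the other as `0`.

For a general nonzero fixed `T`, approximate `T* T` by such finite combinations, using the
conditional expectation `(id ⊗ h) δ` given by a Haar state `h` (`exists_mem_core_near`). The scalar
`c` stays away from zero because the gauge averages of a nonzero positive element are bounded below
uniformly in the number of roots of unity (`exists_le_norm_gaugeMean`).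

The quantum group theory needed is Woronowicz's: the Haar state as a limit of averaged convolution
powers of a faithful state (`exists_haar`), and complements of invariant subspaces
(`commute_of_invariant`), from which irreducible subrepresentations follow. -/

noncomputable section

/-! ### States: positivity, vector states, separation of points, faithfulness. -/

/-- A state of a unital C*-algebra: a unital functional of norm at most one. -/
structure CStarState (B : Type v) [CStarAlgebra B] where
  /-- The underlying functional. -/
  toCLM : B →L[ℂ] ℂ
  map_one' : toCLM 1 = 1
  norm_le' : ‖toCLM‖ ≤ 1

namespace CStarState

variable {B : Type v} [CStarAlgebra B]

instance : CoeFun (CStarState B) (fun _ => B → ℂ) := ⟨fun φ => φ.toCLM⟩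

theorem map_one (φ : CStarState B) : φ 1 = 1 := φ.map_one'

theorem norm_apply_le (φ : CStarState B) (x : B) : ‖φ x‖ ≤ ‖x‖ :=
  (φ.toCLM.le_of_opNorm_le φ.norm_le' x).trans_eq (one_mul _)

/-- Since `‖x + it‖² ≤ ‖x‖² + t²` for all real `t`, a nonzero imaginary part of `φ x` would violate
contractivity for large `t` of the same sign. -/
theorem im_eq_zero (φ : CStarState B) {x : B} (hx : IsSelfAdjoint x) : (φ x).im = 0 := by
  have key : ∀ t : ℝ, ((φ x).im + t) ^ 2 ≤ ‖x‖ ^ 2 + t ^ 2 := by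
    intro t
    have h1 : φ (x + (t * Complex.I : ℂ) • (1 : B)) = φ x + t * Complex.I := by
        rw [map_add, map_smul, φ.map_one', smul_eq_mul, mul_one]
    have h2 := φ.norm_apply_le (x + (t * Complex.I : ℂ) • (1 : B))
    have h3 : ‖x + (t * Complex.I : ℂ) • (1 : B)‖ ^ 2 ≤ ‖x‖ ^ 2 + t ^ 2 := by
      rw [sq, ← CStarRing.norm_star_mul_self]
      have : star (x + (t * Complex.I : ℂ) • (1 : B)) * (x + (t * Complex.I : ℂ) • (1 : B)) =
          x * x + ((t : ℂ) ^ 2) • (1 : B) := by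
        rw [star_add, star_smul, star_one, hx.star_eq]
        simp only [add_mul, mul_add, smul_mul_assoc, one_mul, mul_smul_comm, mul_one, smul_add]
        have h5 : star ((t : ℂ) * Complex.I) = -((t : ℂ) * Complex.I) := by simp
        have h6 : (t : ℂ) * Complex.I * (-((t : ℂ) * Complex.I)) = (t : ℂ) ^ 2 := by
          linear_combination (-(t : ℂ) ^ 2) * Complex.I_mul_I
        rw [h5, neg_smul, neg_smul, smul_neg, smul_smul,
          show (t : ℂ) * Complex.I * (t * Complex.I) =
          -(t : ℂ) ^ 2 by linear_combination -h6, neg_smul]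
        abel
      rw [this]
      refine (norm_add_le _ _).trans ?_
      refine add_le_add ((norm_mul_le _ _).trans_eq (sq _).symm) ?_
      rw [norm_smul, norm_pow, Complex.norm_real, Real.norm_eq_abs, sq_abs]
      have : ‖(1 : B)‖ ≤ 1 := by
        rcases subsingleton_or_nontrivial B with h | h
        · simp [Subsingleton.elim (1 : B) 0]
        · exact CStarRing.norm_one.le
      exact mul_le_of_le_one_right (sq_nonneg t) this
    have h4 : ((φ x).im + t) ^ 2 ≤ ‖φ x + t * Complex.I‖ ^ 2 := by
      have := Complex.abs_im_le_norm (φ x + t * Complex.I)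
      simp only [Complex.add_im, Complex.mul_im, Complex.ofReal_re, Complex.I_im, mul_one,
        Complex.ofReal_im, Complex.I_re, mul_zero, add_zero] at this
      rw [← sq_abs]
      gcongr
    rw [h1] at h2
    exact h4.trans ((pow_le_pow_left₀ (norm_nonneg _) h2 2).trans h3)
  by_contra h
  -- With this `t` the cross term `2 t Im φ(x)` equals `2‖x‖²`, more than the bound allows.
  have h0 := key (‖x‖ ^ 2 / (φ x).im)
  have h1 : (φ x).im * (‖x‖ ^ 2 / (φ x).im) = ‖x‖ ^ 2 := by field_simp
  have h2 : 0 < (φ x).im ^ 2 := by positivity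
  nlinarith [sq_nonneg ‖x‖]

attribute [local instance] CStarAlgebra.spectralOrder CStarAlgebra.spectralOrderedRing

open scoped ComplexOrder

/-- For `x ≥ 0` the element `‖x‖ - x` has norm at most `‖x‖`, so `‖x‖ - Re φ(x) ≤ ‖x‖`. -/
theorem nonneg_of_nonneg (φ : CStarState B) {x : B} (hx : 0 ≤ x) : 0 ≤ φ x := by
  have him := φ.im_eq_zero (IsSelfAdjoint.of_nonneg hx)
  rw [Complex.nonneg_iff]
  refine ⟨?_, him.symm⟩
  have h1 : ‖algebraMap ℝ B ‖x‖ - x‖ ≤ ‖x‖ := by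
    have h0 : 0 ≤ algebraMap ℝ B ‖x‖ - x :=
      sub_nonneg.2 (IsSelfAdjoint.le_algebraMap_norm_self (IsSelfAdjoint.of_nonneg hx))
    have h2 : algebraMap ℝ B ‖x‖ - x ≤ algebraMap ℝ B ‖x‖ := sub_le_self _ hx
    refine (CStarAlgebra.norm_le_norm_of_nonneg_of_le h0 h2).trans ?_
    rw [Algebra.algebraMap_eq_smul_one, norm_smul, norm_norm]
    have : ‖(1 : B)‖ ≤ 1 := by
      rcases subsingleton_or_nontrivial B with h | h
      · simp [Subsingleton.elim (1 : B) 0]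
      · exact CStarRing.norm_one.le
    exact mul_le_of_le_one_right (norm_nonneg x) this
  have h2 := (φ.norm_apply_le _).trans h1
  have h3 : φ (algebraMap ℝ B ‖x‖ - x) = ‖x‖ - φ x := by
    rw [map_sub, Algebra.algebraMap_eq_smul_one, ← Complex.coe_smul, map_smul, φ.map_one']
    simp
  rw [h3] at h2
  have h4 := (Complex.re_le_norm _).trans h2
  simp at h4
  exact h4

/-- A state as a positive functional. -/
def toPositive (φ : CStarState B) : B →ₚ[ℂ] ℂ :=
  PositiveLinearMap.mk₀ φ.toCLM.toLinearMap fun _ hx => φ.nonneg_of_nonneg hx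

/-- Every state is a vector state. -/
theorem exists_rep (φ : CStarState B) : ∃ (π : HilbertRep B) (ξ : π.H), ‖ξ‖ = 1 ∧
    ∀ x, φ x = inner ℂ ξ (π.π x ξ) := by
  let f := φ.toPositive
  let π : HilbertRep B := { H := f.GNS, π := f.gnsStarAlgHom }
  let e : f.PreGNS := f.toPreGNS 1
  have h : ∀ x, φ x = inner ℂ ((e : f.GNS)) (f.gnsStarAlgHom x (e : f.GNS)) := by
    intro x
    have h1 : f.gnsStarAlgHom x (e : f.GNS) = ((f.leftMulMapPreGNS x e : f.PreGNS) : f.GNS) :=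
      f.gnsNonUnitalStarAlgHom_apply_coe
    rw [h1, UniformSpace.Completion.inner_coe, PositiveLinearMap.preGNS_inner_def]
    simp only [e, PositiveLinearMap.leftMulMapPreGNS_apply, PositiveLinearMap.ofPreGNS_toPreGNS,
      star_one, one_mul]
    rw [mul_one]; rfl
  refine ⟨π, (e : f.GNS), ?_, h⟩
  have h1 := h 1
  rw [φ.map_one, _root_.map_one] at h1
  rw [one_apply_eq_self, inner_self_eq_norm_sq_to_K] at h1
  have h2 : ‖(e : f.GNS)‖ ^ 2 = 1 := by
    have := congrArg Complex.re h1.symm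
    rwa [← RCLike.ofReal_pow, RCLike.ofReal_eq_complex_ofReal, Complex.ofReal_re,
      Complex.one_re] at this
  nlinarith [norm_nonneg (e : f.GNS)]

theorem apply_star_mul {π : HilbertRep B} {ξ : π.H} {φ : CStarState B}
    (h : ∀ x, φ x = inner ℂ ξ (π.π x ξ)) (x y : B) :
    φ (star x * y) = inner ℂ (π.π x ξ) (π.π y ξ) := by
  rw [h, map_mul, map_star, ContinuousLinearMap.star_eq_adjoint, mul_apply_eq_comp,
    ContinuousLinearMap.adjoint_inner_right]

theorem nonneg (φ : CStarState B) (x : B) : 0 ≤ φ (star x * x) :=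
  φ.nonneg_of_nonneg (star_mul_self_nonneg x)

theorem map_star (φ : CStarState B) (x : B) : φ (star x) = star (φ x) := by
  obtain ⟨π, ξ, -, h⟩ := φ.exists_rep
  have h1 := apply_star_mul h x 1
  have h2 := apply_star_mul h 1 x
  rw [mul_one] at h1
  rw [star_one, one_mul] at h2
  rw [h1, h2]
  exact (inner_conj_symm _ _).symm

/-- In the GNS representation the hypothesis says that `x` kills the cyclic vector. -/
theorem mul_eq_zero (φ : CStarState B) {x : B} (hx : φ (star x * x) = 0) (y : B) :
    φ (y * x) = 0 := by
  obtain ⟨π, ξ, -, h⟩ := φ.exists_rep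
  rw [apply_star_mul h, inner_self_eq_zero] at hx
  have := apply_star_mul h (star y) x
  rwa [star_star, hx, inner_zero_right] at this

/-- Every point of the spectrum of a normal element is the value of a state. -/
theorem exists_apply_eq_of_mem_spectrum {b : B} (hb : IsStarNormal b) {z : ℂ}
    (hz : z ∈ spectrum ℂ b) : ∃ φ : CStarState B, φ b = z := by
  let E := StarAlgebra.elemental ℂ b
  let b' : E := ⟨b, StarAlgebra.elemental.self_mem ℂ b⟩
  have : Nontrivial B := by
    by_contra h
    rw [not_nontrivial_iff_subsingleton] at h
    rw [spectrum.of_subsingleton] at hz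
    exact hz
  have hE : IsClosed (E : Set B) := StarAlgebra.elemental.isClosed ℂ b
  rw [show b = (b' : B) from rfl, ← StarSubalgebra.spectrum_eq (S := E)] at hz
  -- By Gelfand duality `z` is the value of a character on the commutative algebra generated by `b`;
  -- the Hahn–Banach theorem extends the character without increasing its norm.
  obtain ⟨χ, hχ⟩ := WeakDual.CharacterSpace.mem_spectrum_iff_exists.1 hz
  have hle : ∀ x : E, ‖χ x‖ ≤ ‖x‖ := fun x => AlgHom.norm_apply_le_self χ x
  let χ' : E.toSubalgebra.toSubmodule →L[ℂ] ℂ :=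
    LinearMap.mkContinuous
      { toFun := fun x => χ (x : E)
        map_add' := fun x y => map_add χ (x : E) (y : E)
        map_smul' := fun c x => map_smul χ c (x : E) } 1 fun x => by
      rw [one_mul]
      exact hle x
  have hn : ‖χ'‖ ≤ 1 := LinearMap.mkContinuous_norm_le _ zero_le_one _
  obtain ⟨g, hg, hgn⟩ := exists_extension_norm_eq E.toSubalgebra.toSubmodule χ'
  refine ⟨⟨g, ?_, hgn.trans_le hn⟩, ?_⟩
  · exact (hg (1 : E)).trans (_root_.map_one χ)
  · exact (hg b').trans hχ

/-- Every positive element is normed by a state. -/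
theorem exists_apply_eq_norm [Nontrivial B] {b : B} (hb : 0 ≤ b) :
    ∃ φ : CStarState B, φ b = ‖b‖ := by
  refine exists_apply_eq_of_mem_spectrum (IsSelfAdjoint.of_nonneg hb).isStarNormal ?_
  have := CStarAlgebra.norm_mem_spectrum_of_nonneg (a := b)
  simpa using spectrum.algebraMap_mem ℂ this

theorem exists_apply_star_mul_self [Nontrivial B] (b : B) :
    ∃ φ : CStarState B, φ (star b * b) = (‖b‖ : ℂ) ^ 2 := by
  obtain ⟨φ, hφ⟩ := exists_apply_eq_norm (star_mul_self_nonneg b)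
  refine ⟨φ, hφ.trans ?_⟩
  rw [CStarRing.norm_star_mul_self]
  push_cast
  ring

/-- States separate points. -/
theorem eq_zero_of_forall [Nontrivial B] {b : B} (h : ∀ φ : CStarState B, φ b = 0) : b = 0 := by
  have key : ∀ x : B, IsSelfAdjoint x → (∀ φ : CStarState B, φ x = 0) → x = 0 := by
    intro x hx h
    obtain ⟨z, hz, hzn⟩ := spectrum.exists_nnnorm_eq_spectralRadius_of_nonempty (𝕜 := ℂ)
      (spectrum.nonempty x)
    obtain ⟨φ, hφ⟩ := exists_apply_eq_of_mem_spectrum hx.isStarNormal hz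
    rw [h φ] at hφ
    rw [hx.spectralRadius_eq_nnnorm, ← hφ] at hzn
    simpa using hzn.symm
  have h1 := key (b + star b) (IsSelfAdjoint.add_star_self b) fun φ => by
    rw [map_add, φ.map_star, h φ]; simp
  have h2 := key (Complex.I • (b - star b)) (by
    rw [IsSelfAdjoint, star_smul, star_sub, star_star, Complex.star_def, Complex.conj_I, neg_smul,
      ← smul_neg, neg_sub]) fun φ => by
    rw [map_smul, map_sub, φ.map_star, h φ]; simp
  rw [smul_eq_zero_iff_right Complex.I_ne_zero, sub_eq_zero] at h2
  rw [← h2, ← two_smul ℂ b, smul_eq_zero_iff_right two_ne_zero] at h1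
  exact h1

/-- A separable C*-algebra has a faithful state. -/
theorem exists_faithful [Nontrivial B] [TopologicalSpace.SeparableSpace B] :
    ∃ φ : CStarState B, ∀ x, φ (star x * x) = 0 → x = 0 := by
  let b := TopologicalSpace.denseSeq B
  choose f hf using fun n => exists_apply_star_mul_self (b n)
  -- The faithful state is a convex series of states norming `b_n* b_n` along a dense sequence.
  let c : ℕ → ℝ := fun n => 1 / 2 / 2 ^ n
  have hc : HasSum c 1 := by
    exact hasSum_geometric_two' 1
  have hs : Summable fun n => (c n : ℂ) • (f n).toCLM := by
    refine Summable.of_norm_bounded hc.summable fun n => ?_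
    rw [norm_smul, Complex.norm_real, Real.norm_of_nonneg (by positivity)]
    exact mul_le_of_le_one_right (by positivity) (f n).norm_le'
  have happ : ∀ x, HasSum (fun n => (c n : ℂ) * f n x) ((∑' n, (c n : ℂ) • (f n).toCLM) x) :=
    fun x => hs.hasSum.mapL (ContinuousLinearMap.apply ℂ ℂ x)
  refine ⟨⟨∑' n, (c n : ℂ) • (f n).toCLM, ?_, ?_⟩, ?_⟩
  · refine (happ 1).unique ?_
    simp only [map_one, mul_one]
    simpa using Complex.hasSum_ofReal.2 hc
  · refine ContinuousLinearMap.opNorm_le_bound _ zero_le_one fun x => ?_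
    rw [← (happ x).tsum_eq]
    refine (tsum_of_norm_bounded (hc.mul_right ‖x‖) fun n => ?_)
    rw [norm_mul, Complex.norm_real, Real.norm_of_nonneg (by positivity)]
    gcongr
    exact (f n).norm_apply_le x
  · intro x hx
    have h0 := happ (star x * x)
    rw [hx] at h0
    have h1 : ∀ n, f n (star x * x) = 0 := by
      intro n
      have h2 : ∀ n, 0 ≤ (c n : ℂ) * f n (star x * x) := fun n =>
        mul_nonneg (by simp only [Complex.zero_le_real]; positivity) ((f n).nonneg x)
      have h3 := (hasSum_zero_iff_of_nonneg h2).1 h0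
      have h4 := congrFun h3 n
      have h5 : (c n : ℂ) ≠ 0 := by
        have : c n ≠ 0 := by positivity
        exact_mod_cast this
      simpa [h5] using h4
    -- The inequality passes to all elements by density, and at `x` itself it forces `x = 0`.
    have h2 : ∀ n, ‖b n‖ ^ 2 ≤ ‖star (b n) * b n - star x * x‖ := by
      intro n
      have := (f n).norm_apply_le (star (b n) * b n - star x * x)
      rw [map_sub, h1, hf, sub_zero] at this
      simpa using this
    have h3 : ∀ y : B, ‖y‖ ^ 2 ≤ ‖star y * y - star x * x‖ := by
      intro y
      refine DenseRange.induction_on (e := b) (TopologicalSpace.denseRange_denseSeq B) y ?_ h2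
      exact isClosed_le (by fun_prop) (by fun_prop)
    have := h3 x
    rw [sub_self, norm_zero] at this
    exact norm_eq_zero.1 (by nlinarith [norm_nonneg x])

end CStarState
end

/-! ### Slice maps and product states on the minimal tensor product. -/

noncomputable section

namespace CStarSeminorm

variable {R : Type u} [Ring R] [StarRing R] [Algebra ℂ R]

/-- A linear map bounded by a C*-seminorm extends to the completion. -/
theorem exists_extension (p : CStarSeminorm R) {Z : Type v} [NormedAddCommGroup Z]
    [NormedSpace ℂ Z] [CompleteSpace Z] (f : R →ₗ[ℂ] Z) (hf : ∀ x, ‖f x‖ ≤ p x) :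
    ∃ g : p.Completion →L[ℂ] Z, (∀ x, g (p.toCompletion x) = f x) ∧ ∀ z, ‖g z‖ ≤ ‖z‖ := by
  let f' : p.Carrier →L[ℂ] Z := LinearMap.mkContinuous (show p.Carrier →ₗ[ℂ] Z from f) 1
    fun x => by rw [one_mul]; exact hf x
  let g : p.Completion →L[ℂ] Z := f'.extend (UniformSpace.Completion.toComplL (𝕜 := ℂ))
  have hg : ∀ x, g (p.toCompletion x) = f x := fun x =>
    ContinuousLinearMap.extend_eq f' (UniformSpace.Completion.denseRange_coe)
      (UniformSpace.Completion.isUniformInducing_coe _) x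
  refine ⟨g, hg, fun z => ?_⟩
  refine DenseRange.induction_on p.denseRange_toCompletion z
    (isClosed_le (by fun_prop) (by fun_prop)) fun x => ?_
  rw [hg, p.norm_toCompletion]
  exact hf x

end CStarSeminorm

namespace MinTensor

variable {X : Type u} {Y : Type v} [CStarAlgebra X] [CStarAlgebra Y]

theorem denseRange_ofAlg : DenseRange (ofAlg : X ⊗[ℂ] Y →⋆ₐ[ℂ] X ⊗ᵐ Y) :=
  (minSeminorm X Y).denseRange_toCompletion

/-- Two continuous linear maps that agree on elementary tensors are equal. -/
theorem clm_ext {Z : Type*} [NormedAddCommGroup Z] [NormedSpace ℂ Z] {f g : X ⊗ᵐ Y →L[ℂ] Z}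
    (h : ∀ x y, f (tmul x y) = g (tmul x y)) : f = g := by
  ext z
  refine DenseRange.induction_on denseRange_ofAlg z
    (isClosed_eq f.continuous g.continuous) fun t => ?_
  induction t using TensorProduct.induction_on with
  | zero => simp
  | tmul x y => exact h x y
  | add s t hs ht => rw [map_add, map_add, map_add, hs, ht]

theorem norm_spatialHom_le (π : HilbertRep X) (σ : HilbertRep Y) (t : X ⊗[ℂ] Y) :
    ‖spatialHom π.π σ.π t‖ ≤ minSeminorm X Y t :=
  CStarSeminorm.le_iSup (fun i : HilbertRep X × HilbertRep Y => spatialSeminorm i.1.π i.2.π)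
    spatialSeminorm_bounded (π, σ) t

theorem norm_inner_spatialHom_le (π : HilbertRep X) (σ : HilbertRep Y) (t : X ⊗[ℂ] Y)
    (ξ ξ' : π.H) (η η' : σ.H) :
    ‖inner ℂ (PreHilbertTensor.tmul ξ η) (spatialHom π.π σ.π t (PreHilbertTensor.tmul ξ' η'))‖ ≤
      minSeminorm X Y t * (‖ξ‖ * ‖η‖ * (‖ξ'‖ * ‖η'‖)) := by
  have hn : ∀ (ξ : π.H) (η : σ.H), ‖PreHilbertTensor.tmul ξ η‖ = ‖ξ‖ * ‖η‖ := fun ξ η =>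
    TensorProduct.norm_tmul ξ η
  refine (norm_inner_le_norm _ _).trans ?_
  refine (mul_le_mul_of_nonneg_left (ContinuousLinearMap.le_of_opNorm_le _
    (norm_spatialHom_le π σ t) _) (norm_nonneg _)).trans_eq ?_
  rw [hn, hn]
  ring

/-- Represent `φ` by a unit vector `η`. The coefficients of `f t` in a representation `π` are those
of `(π ⊗ σ)(t)` at vectors `· ⊗ η`. With `ξ` norming `(f t)* (f t)` this gives `‖f t‖² ≤ ‖t‖ ‖π(f t)
ξ‖ ≤ ‖t‖ ‖f t‖`, so the slice is contractive for the minimal norm. -/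
theorem exists_slice [Nontrivial X] (φ : CStarState Y) :
    ∃ s : X ⊗ᵐ Y →L[ℂ] X, (∀ x y, s (tmul x y) = φ y • x) ∧ ∀ z, ‖s z‖ ≤ ‖z‖ := by
  let f : X ⊗[ℂ] Y →ₗ[ℂ] X :=
    TensorProduct.lift (LinearMap.flip (LinearMap.toSpanSingleton ℂ (X →ₗ[ℂ] X) LinearMap.id ∘ₗ
      φ.toCLM.toLinearMap))
  have hf : ∀ x y, f (x ⊗ₜ y) = φ y • x := fun x y => by simp [f]
  obtain ⟨σ, η, hη, hσ⟩ := φ.exists_rep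
  have hb : ∀ t, ‖f t‖ ≤ minSeminorm X Y t := by
    intro t
    obtain ⟨θ, hθ⟩ := CStarState.exists_apply_star_mul_self (f t)
    obtain ⟨π, ξ, hξ, hπ⟩ := θ.exists_rep
    have h1 : ∀ (ξ' : π.H) (s : X ⊗[ℂ] Y), inner ℂ ξ' (π.π (f s) ξ) =
        inner ℂ (PreHilbertTensor.tmul ξ' η)
          (spatialHom π.π σ.π s (PreHilbertTensor.tmul ξ η)) := by
      intro ξ' s
      induction s using TensorProduct.induction_on with
      | zero => simp
      | tmul x y =>
        rw [hf, spatialHom_tmul, PreHilbertTensor.op_tmul, PreHilbertTensor.inner_tmul, ← hσ,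
          map_smul, _root_.smul_apply, inner_smul_right, mul_comm]
      | add s t hs ht =>
        rw [map_add, map_add, map_add, _root_.add_apply, _root_.add_apply, inner_add_right,
          inner_add_right, hs, ht]
    have h2 := norm_inner_spatialHom_le π σ t (π.π (f t) ξ) ξ η η
    rw [← h1, hη, hξ, mul_one, mul_one, mul_one] at h2
    have h3 := CStarState.apply_star_mul hπ (f t) (f t)
    rw [hθ] at h3
    rw [← h3] at h2
    have h4 : ‖π.π (f t) ξ‖ ≤ ‖f t‖ := by
      refine (ContinuousLinearMap.le_opNorm _ _).trans ?_
      rw [hξ, mul_one]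
      exact NonUnitalStarAlgHom.norm_apply_le _ _
    rw [norm_pow, Complex.norm_real, norm_norm] at h2
    have h5 := h2.trans (mul_le_mul_of_nonneg_left h4 ((minSeminorm X Y).nonneg t))
    by_contra! h
    nlinarith [norm_nonneg (f t), (minSeminorm X Y).nonneg t]
  obtain ⟨s, hs, hsn⟩ := (minSeminorm X Y).exists_extension f hb
  exact ⟨s, fun x y => (hs _).trans (hf x y), hsn⟩

theorem exists_sliceLeft [Nontrivial Y] (φ : CStarState X) :
    ∃ s : X ⊗ᵐ Y →L[ℂ] Y, ∀ x y, s (tmul x y) = φ x • y := by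
  let f : X ⊗[ℂ] Y →ₗ[ℂ] Y :=
    TensorProduct.lift (LinearMap.toSpanSingleton ℂ (Y →ₗ[ℂ] Y) LinearMap.id ∘ₗ
      φ.toCLM.toLinearMap)
  have hf : ∀ x y, f (x ⊗ₜ y) = φ x • y := fun x y => by simp [f]
  obtain ⟨σ, η, hη, hσ⟩ := φ.exists_rep
  have hb : ∀ t, ‖f t‖ ≤ minSeminorm X Y t := by
    intro t
    obtain ⟨θ, hθ⟩ := CStarState.exists_apply_star_mul_self (f t)
    obtain ⟨π, ξ, hξ, hπ⟩ := θ.exists_rep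
    have h1 : ∀ (ξ' : π.H) (s : X ⊗[ℂ] Y), inner ℂ ξ' (π.π (f s) ξ) =
        inner ℂ (PreHilbertTensor.tmul η ξ')
          (spatialHom σ.π π.π s (PreHilbertTensor.tmul η ξ)) := by
      intro ξ' s
      induction s using TensorProduct.induction_on with
      | zero => simp
      | tmul x y =>
        rw [hf, spatialHom_tmul, PreHilbertTensor.op_tmul, PreHilbertTensor.inner_tmul, ← hσ,
          map_smul, _root_.smul_apply, inner_smul_right]
      | add s t hs ht =>
        rw [map_add, map_add, map_add, _root_.add_apply, _root_.add_apply, inner_add_right,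
          inner_add_right, hs, ht]
    have h2 := norm_inner_spatialHom_le σ π t η η (π.π (f t) ξ) ξ
    rw [← h1, hη, hξ, one_mul, mul_one, mul_one] at h2
    have h3 := CStarState.apply_star_mul hπ (f t) (f t)
    rw [hθ] at h3
    rw [← h3] at h2
    have h4 : ‖π.π (f t) ξ‖ ≤ ‖f t‖ := by
      refine (ContinuousLinearMap.le_opNorm _ _).trans ?_
      rw [hξ, mul_one]
      exact NonUnitalStarAlgHom.norm_apply_le _ _
    rw [norm_pow, Complex.norm_real, norm_norm] at h2
    have h5 := h2.trans (mul_le_mul_of_nonneg_left h4 ((minSeminorm X Y).nonneg t))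
    by_contra! h
    nlinarith [norm_nonneg (f t), (minSeminorm X Y).nonneg t]
  obtain ⟨s, hs, -⟩ := (minSeminorm X Y).exists_extension f hb
  exact ⟨s, fun x y => (hs _).trans (hf x y)⟩

/-- A `*`-homomorphism of C*-algebras as a continuous linear map. -/
def _root_.StarAlgHom.toCLM' (f : X →⋆ₐ[ℂ] Y) : X →L[ℂ] Y :=
  LinearMap.mkContinuous (f : X →ₐ[ℂ] Y).toLinearMap 1 fun x => by
    rw [one_mul]; exact NonUnitalStarAlgHom.norm_apply_le f x

@[simp]
theorem _root_.StarAlgHom.toCLM'_apply (f : X →⋆ₐ[ℂ] Y) (x : X) : f.toCLM' x = f x := rfl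

/-- The slice map `φ ⊗ id`. -/
def sliceLeft [Nontrivial Y] (φ : CStarState X) : X ⊗ᵐ Y →L[ℂ] Y := (exists_sliceLeft φ).choose

theorem sliceLeft_tmul [Nontrivial Y] (φ : CStarState X) (x : X) (y : Y) :
    sliceLeft φ (tmul x y) = φ x • y :=
  (exists_sliceLeft φ).choose_spec x y

section Slice

variable [Nontrivial X]

/-- The slice map `id ⊗ φ`. -/
def slice (φ : CStarState Y) : X ⊗ᵐ Y →L[ℂ] X := (exists_slice φ).choose

theorem slice_tmul (φ : CStarState Y) (x : X) (y : Y) : slice φ (tmul x y) = φ y • x :=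
  (exists_slice φ).choose_spec.1 x y

theorem norm_slice_le (φ : CStarState Y) (z : X ⊗ᵐ Y) : ‖slice φ z‖ ≤ ‖z‖ :=
  (exists_slice φ).choose_spec.2 z

theorem slice_one (φ : CStarState Y) : slice φ (1 : X ⊗ᵐ Y) = 1 := by
  rw [← one_tmul_one, slice_tmul, φ.map_one, one_smul]

/-- The slice map is a map of left modules. -/
theorem slice_tmul_one_mul (φ : CStarState Y) (x : X) (z : X ⊗ᵐ Y) :
    slice φ (tmul x 1 * z) = x * slice φ z := by
  have := clm_ext (f := (slice φ).comp (ContinuousLinearMap.mul ℂ _ (tmul x (1 : Y))))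
    (g := (ContinuousLinearMap.mul ℂ X x).comp (slice φ)) fun x' y => by
      simp [tmul_mul_tmul, slice_tmul]
  exact congrArg (fun f => f z) this

/-- The slice map is a map of right modules. -/
theorem slice_mul_tmul_one (φ : CStarState Y) (x : X) (z : X ⊗ᵐ Y) :
    slice φ (z * tmul x 1) = slice φ z * x := by
  have := clm_ext (f := (slice φ).comp ((ContinuousLinearMap.mul ℂ _).flip (tmul x (1 : Y))))
    (g := ((ContinuousLinearMap.mul ℂ X).flip x).comp (slice φ)) fun x' y => by
      simp [tmul_mul_tmul, slice_tmul]
  exact congrArg (fun f => f z) this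

theorem slice_map {X' : Type u} [CStarAlgebra X'] [Nontrivial X'] {Y : Type v} [CStarAlgebra Y]
    (φ : CStarState Y) (f : X' →⋆ₐ[ℂ] X) (z : X' ⊗ᵐ Y) :
    slice φ (map f (StarAlgHom.id ℂ Y) z) = f (slice φ z) := by
  have := clm_ext (f := (slice φ).comp (map f (StarAlgHom.id ℂ Y)).toCLM')
    (g := f.toCLM'.comp (slice φ)) fun x' y => by
      simp [map_tmul, slice_tmul]
  exact congrArg (fun f => f z) this

theorem slice_star (φ : CStarState Y) (z : X ⊗ᵐ Y) : slice φ (star z) = star (slice φ z) := by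
  refine DenseRange.induction_on denseRange_ofAlg z
    (isClosed_eq (by fun_prop) (by fun_prop)) fun t => ?_
  induction t using TensorProduct.induction_on with
  | zero => simp
  | tmul x y =>
    change slice φ (star (tmul x y)) = star (slice φ (tmul x y))
    rw [star_tmul, slice_tmul, slice_tmul, star_smul, φ.map_star]
  | add s t hs ht => rw [map_add, star_add, map_add, map_add, star_add, hs, ht]

/-- Exchanging the slices lets a weak limit of states be evaluated at one fixed element. -/
theorem apply_sliceLeft [Nontrivial Y] (θ : CStarState X) (φ : CStarState Y) (z : X ⊗ᵐ Y) :
    φ (sliceLeft θ z) = θ (slice φ z) := by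
  have := clm_ext (f := φ.toCLM.comp (sliceLeft θ))
    (g := θ.toCLM.comp (slice φ)) fun x' y => by
      simp [sliceLeft_tmul, slice_tmul, mul_comm]
  exact congrArg (fun f => f z) this

/-- The product state `θ ⊗ φ`. -/
def prodState (θ : CStarState X) (φ : CStarState Y) : CStarState (X ⊗ᵐ Y) where
  toCLM := θ.toCLM.comp (slice φ)
  map_one' := by
    rw [ContinuousLinearMap.comp_apply, slice_one, θ.map_one]
  norm_le' := ContinuousLinearMap.opNorm_le_bound _ zero_le_one fun z => by
    rw [one_mul]
    exact (θ.norm_apply_le _).trans (norm_slice_le φ z)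

theorem prodState_apply (θ : CStarState X) (φ : CStarState Y) (z : X ⊗ᵐ Y) :
    prodState θ φ z = θ (slice φ z) := rfl

instance [Nontrivial Y] : Nontrivial (X ⊗ᵐ Y) := by
  obtain ⟨φ, -⟩ := CStarState.exists_apply_star_mul_self (0 : Y)
  refine ⟨0, 1, fun h => zero_ne_one (α := X) ?_⟩
  rw [← slice_one (X := X) φ, ← h, map_zero]

end Slice

end MinTensor
end

/-! ### Convolution of states and the Haar state. -/

noncomputable section

namespace CStarState

variable {B : Type v} [CStarAlgebra B]

theorem ext {φ ψ : CStarState B} (h : ∀ x, φ x = ψ x) : φ = ψ := by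
  cases φ; cases ψ
  congr
  exact ContinuousLinearMap.ext h

/-- Precomposition of a state with a unital contraction. -/
def precomp {C : Type*} [CStarAlgebra C] (φ : CStarState B) (R : C →L[ℂ] B) (h1 : R 1 = 1)
    (hR : ∀ x, ‖R x‖ ≤ ‖x‖) : CStarState C where
  toCLM := φ.toCLM.comp R
  map_one' := by rw [ContinuousLinearMap.comp_apply, h1, φ.map_one]
  norm_le' := ContinuousLinearMap.opNorm_le_bound _ zero_le_one fun x => by
    rw [one_mul]
    exact (φ.norm_apply_le _).trans (hR x)

/-- The averages of a sequence of states. -/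
def average (f : ℕ → CStarState B) (n : ℕ) : CStarState B where
  toCLM := ((n + 1 : ℕ) : ℂ)⁻¹ • ∑ k ∈ Finset.range (n + 1), (f k).toCLM
  map_one' := by
    simp only [_root_.smul_apply, _root_.sum_apply, map_one, Finset.sum_const, Finset.card_range,
      nsmul_eq_mul, mul_one, smul_eq_mul]
    exact inv_mul_cancel₀ (by exact_mod_cast n.succ_ne_zero)
  norm_le' := by
    rw [norm_smul, norm_inv, Complex.norm_natCast]
    have : ‖∑ k ∈ Finset.range (n + 1), (f k).toCLM‖ ≤ ((n + 1 : ℕ) : ℝ) := by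
      refine (norm_sum_le _ _).trans ((Finset.sum_le_sum fun k _ => (f k).norm_le').trans_eq ?_)
      simp
    exact inv_mul_le_one_of_le₀ this (by positivity)

theorem average_apply (f : ℕ → CStarState B) (n : ℕ) (x : B) :
    (average f n).toCLM x = (((n + 1 : ℕ) : ℂ)⁻¹ : ℂ) * ∑ k ∈ Finset.range (n + 1), (f k) x := by
  simp [average]

/-- Sequences of states converge weakly along ultrafilters. -/
theorem exists_tendsto (f : ℕ → CStarState B) (U : Ultrafilter ℕ) :
    ∃ h : CStarState B, ∀ x, Filter.Tendsto (fun n => f n x) U (nhds (h x)) := by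
  have key : ∀ x, ∃ y : ℂ, Filter.Tendsto (fun n => f n x) U (nhds y) := by
    intro x
    have hc : IsCompact (Metric.closedBall (0 : ℂ) ‖x‖) := isCompact_closedBall _ _
    obtain ⟨y, -, hy⟩ := hc.ultrafilter_le_nhds (U.map fun n => f n x) (by
      rw [Filter.le_principal_iff]
      refine Filter.mem_map.2 (Filter.univ_mem' fun n => ?_)
      simpa using (f n).norm_apply_le x)
    exact ⟨y, hy⟩
  choose g hg using key
  let l : B →ₗ[ℂ] ℂ :=
    { toFun := g
      map_add' := fun x y => tendsto_nhds_unique (hg (x + y)) (by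
        simpa using (hg x).add (hg y))
      map_smul' := fun c x => tendsto_nhds_unique (hg (c • x)) (by
        simpa using (hg x).const_mul c) }
  have hb : ∀ x, ‖l x‖ ≤ 1 * ‖x‖ := fun x => by
    rw [one_mul]
    exact le_of_tendsto (hg x).norm (Filter.Eventually.of_forall fun n => (f n).norm_apply_le x)
  exact ⟨⟨l.mkContinuous 1 hb, tendsto_nhds_unique (hg 1) (by simp [map_one]),
    LinearMap.mkContinuous_norm_le _ zero_le_one _⟩, hg⟩

/-- A limit of averages does not distinguish a sequence from its shift. -/
theorem eq_of_tendsto_average {f : ℕ → CStarState B} {h : CStarState B} {U : Ultrafilter ℕ}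
    (hU : (U : Filter ℕ) ≤ Filter.atTop)
    (hh : ∀ x, Filter.Tendsto (fun n => average f n x) U (nhds (h x))) {x y : B}
    (hxy : ∀ k, f k y = f (k + 1) x) : h y = h x := by
  have h1 := (hh y).sub (hh x)
  have h2 : Filter.Tendsto (fun n => average f n y - average f n x) U (nhds 0) := by
    -- The difference of the two averages telescopes to its two end terms.
    have h3 : ∀ n, ‖average f n y - average f n x‖ ≤ 2 * ‖x‖ * (1 / ((n : ℝ) + 1)) := by
      intro n
      rw [average_apply, average_apply, ← mul_sub, ← Finset.sum_sub_distrib]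
      simp only [hxy]
      rw [Finset.sum_range_sub (fun k => f k x), norm_mul, norm_inv, Complex.norm_natCast]
      have := (norm_sub_le (f (n + 1) x) (f 0 x)).trans
        (add_le_add ((f (n + 1)).norm_apply_le x) ((f 0).norm_apply_le x))
      have h4 : ((n + 1 : ℕ) : ℝ)⁻¹ = 1 / ((n : ℝ) + 1) := by push_cast; rw [one_div]
      rw [h4, mul_comm]
      gcongr
      linarith
    refine squeeze_zero_norm h3 ?_
    have := (tendsto_one_div_add_atTop_nhds_zero_nat (𝕜 := ℝ)).const_mul (2 * ‖x‖)
    rw [mul_zero] at this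
    exact this.mono_left hU
  exact sub_eq_zero.1 (tendsto_nhds_unique h1 h2)

end CStarState

namespace CompactQuantumGroup

open MinTensor

variable {A : Type u} [CStarAlgebra A] [Nontrivial A] (G : CompactQuantumGroup A)

/-- Right convolution `(id ⊗ φ) Δ` with a state. -/
def conv (φ : CStarState A) : A →L[ℂ] A := (slice φ).comp G.Δ.toCLM'

theorem conv_apply (φ : CStarState A) (a : A) : G.conv φ a = slice φ (G.Δ a) := rfl

theorem conv_one (φ : CStarState A) : G.conv φ 1 = 1 := by
  rw [conv_apply, map_one, slice_one]

theorem conv_star (φ : CStarState A) (a : A) : G.conv φ (star a) = star (G.conv φ a) := by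
  rw [conv_apply, map_star, slice_star, conv_apply]

theorem norm_conv_le (φ : CStarState A) (a : A) : ‖G.conv φ a‖ ≤ ‖a‖ :=
  (norm_slice_le φ _).trans (NonUnitalStarAlgHom.norm_apply_le G.Δ a)

/-- The convolution of two states. -/
def convState (θ φ : CStarState A) : CStarState A :=
  θ.precomp (G.conv φ) (G.conv_one φ) (G.norm_conv_le φ)

theorem convState_apply (θ φ : CStarState A) (a : A) :
    G.convState θ φ a = θ (G.conv φ a) := rfl

/-- The map `(id ⊗ φ(d ·) ⊗ ψ) (id ⊗ Δ)`. -/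
def sliceTwo (φ ψ : CStarState A) (d : A) : A ⊗ᵐ A →L[ℂ] A :=
  (slice (prodState φ ψ)).comp ((ContinuousLinearMap.mul ℂ _ (tmul 1 (tmul d 1))).comp
    (map (StarAlgHom.id ℂ A) G.Δ).toCLM')

theorem sliceTwo_tmul (φ ψ : CStarState A) (d p q : A) :
    G.sliceTwo φ ψ d (tmul p q) = φ (d * G.conv ψ q) • p := by
  simp [sliceTwo, map_tmul, tmul_mul_tmul, slice_tmul, prodState_apply, slice_tmul_one_mul,
    conv_apply]

theorem sliceTwo_tmul_one_mul (φ ψ : CStarState A) (d c : A) (z : A ⊗ᵐ A) :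
    G.sliceTwo φ ψ d (tmul c 1 * z) = c * G.sliceTwo φ ψ d z := by
  have := clm_ext (f := (G.sliceTwo φ ψ d).comp (ContinuousLinearMap.mul ℂ _ (tmul c (1 : A))))
    (g := (ContinuousLinearMap.mul ℂ A c).comp (G.sliceTwo φ ψ d)) fun x' y => by
      simp [tmul_mul_tmul, sliceTwo_tmul]
  exact congrArg (fun f => f z) this

theorem slice_slice_ofAlg (φ ψ : CStarState A) (d : A) (z : (A ⊗[ℂ] A) ⊗[ℂ] A) :
    slice φ (tmul 1 d * slice ψ (ofAlg (TensorProduct.map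
      (ofAlg : A ⊗[ℂ] A →⋆ₐ[ℂ] A ⊗ᵐ A).toLinearMap LinearMap.id z) : (A ⊗ᵐ A) ⊗ᵐ A)) =
    slice (prodState φ ψ) (tmul 1 (tmul d 1) * (ofAlg (TensorProduct.map LinearMap.id
        (ofAlg : A ⊗[ℂ] A →⋆ₐ[ℂ] A ⊗ᵐ A).toLinearMap
        (TensorProduct.assoc ℂ A A A z)) : A ⊗ᵐ (A ⊗ᵐ A))) := by
  induction z using TensorProduct.induction_on with
  | zero => simp
  | add s t hs ht => simp only [map_add, mul_add, hs, ht]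
  | tmul s c =>
    induction s using TensorProduct.induction_on with
    | zero => simp
    | add s t hs ht => simp only [TensorProduct.add_tmul, map_add, mul_add, hs, ht]
    | tmul a b =>
      rw [TensorProduct.map_tmul, TensorProduct.assoc_tmul, TensorProduct.map_tmul]
      have h1 : slice ψ (tmul (tmul a b) c) = ψ c • tmul a b := slice_tmul _ _ _
      have h2 : slice φ (tmul 1 d * ψ c • tmul a b) =
          slice (prodState φ ψ) (tmul 1 (tmul d 1) * tmul a (tmul b c)) := by
        simp only [slice_tmul, tmul_mul_tmul, mul_smul_comm, map_smul, prodState_apply, one_mul,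
          smul_smul, smul_eq_mul]
      exact (congrArg (fun w => slice φ (tmul 1 d * w)) h1).trans h2

/-- `AssocRel` is a closure of pairs coming from algebraic tensors, so an identity between
continuous maps that holds on those pairs holds on all related pairs. -/
theorem slice_slice_of_assocRel (φ ψ : CStarState A) (d : A) {x : (A ⊗ᵐ A) ⊗ᵐ A}
    {y : A ⊗ᵐ (A ⊗ᵐ A)} (h : AssocRel x y) :
    slice φ (tmul 1 d * slice ψ x) = slice (prodState φ ψ) (tmul 1 (tmul d 1) * y) := by
  let f : (A ⊗ᵐ A) ⊗ᵐ A →L[ℂ] A :=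
    (slice φ).comp ((ContinuousLinearMap.mul ℂ _ (tmul 1 d)).comp (slice ψ))
  let g : A ⊗ᵐ (A ⊗ᵐ A) →L[ℂ] A :=
    (slice (prodState φ ψ)).comp (ContinuousLinearMap.mul ℂ _ (tmul 1 (tmul d 1)))
  have hS : IsClosed {p : ((A ⊗ᵐ A) ⊗ᵐ A) × (A ⊗ᵐ (A ⊗ᵐ A)) | f p.1 = g p.2} :=
    isClosed_eq (f.continuous.comp continuous_fst) (g.continuous.comp continuous_snd)
  refine closure_minimal ?_ hS h
  rintro _ ⟨z, rfl⟩
  exact slice_slice_ofAlg φ ψ d z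

/-- Coassociativity in usable form: convolving by `ψ` before `Δ` amounts to convolving the second
leg after `Δ`. -/
theorem slice_comul_conv (φ ψ : CStarState A) (d a : A) :
    slice φ (tmul 1 d * G.Δ (G.conv ψ a)) = G.sliceTwo φ ψ d (G.Δ a) := by
  rw [conv_apply, ← slice_map, slice_slice_of_assocRel φ ψ d (G.coassoc a)]
  rfl

theorem conv_conv (φ ψ : CStarState A) (a : A) :
    G.conv φ (G.conv ψ a) = G.conv (G.convState φ ψ) a := by
  have h := G.slice_comul_conv φ ψ 1 a
  rw [one_tmul_one, one_mul] at h
  rw [conv_apply, h]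
  have := clm_ext (f := G.sliceTwo φ ψ 1) (g := slice (G.convState φ ψ)) fun p q => by
    rw [sliceTwo_tmul, slice_tmul, one_mul, convState_apply]
  rw [this, conv_apply]

/-- Convolution with `h` is constant if `h` absorbs a faithful state on both sides. -/
theorem conv_eq_of_absorb {φ h : CStarState A} (hφ : ∀ x, φ (star x * x) = 0 → x = 0)
    (h1 : ∀ a, h (G.conv φ a) = h a) (h2 : ∀ a, φ (G.conv h a) = h a) (q : A) :
    G.conv h q = h q • 1 := by
  have hfix : ∀ a, G.conv φ (G.conv h a) = G.conv h a := by
    intro a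
    rw [conv_conv, CStarState.ext (φ := G.convState φ h) (ψ := h) h2]
  -- For `b = conv h a` and `z = Δ(b) - b ⊗ 1`, all four terms of `(h ⊗ φ)(z* z)` equal `h(b* b)` up
  -- to sign, by `hfix` and `h1`. The Cauchy–Schwarz inequality then kills `(h ⊗ φ)(Y z)` for every
  -- `Y`.
  have hzero : ∀ a Y, h (slice φ (Y * (G.Δ (G.conv h a) - tmul (G.conv h a) 1))) = 0 := by
    intro a Y
    set b := G.conv h a with hb
    refine (prodState h φ).mul_eq_zero ?_ Y
    rw [prodState_apply, star_sub, sub_mul, mul_sub, mul_sub, ← map_star, ← map_mul, star_tmul,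
      star_one, tmul_mul_tmul, one_mul, map_sub (slice φ), map_sub (slice φ), map_sub (slice φ),
      slice_mul_tmul_one,
      slice_tmul_one_mul, ← conv_apply, ← conv_apply, ← conv_apply, conv_star, hfix, ← hb,
      slice_tmul, φ.map_one, one_smul]
    simp only [map_sub, h1]
    ring
  -- Taking `Y = c ⊗ d` shows that `f` and `g` agree on `(c ⊗ 1) Δ(a)`. These span a dense subspace,
  -- so they also agree at `1 ⊗ q`.
  have hd : ∀ d, φ (d * G.conv h q) = φ d * h q := by
    intro d
    let f : A ⊗ᵐ A →L[ℂ] ℂ := h.toCLM.comp (G.sliceTwo φ h d)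
    let g : A ⊗ᵐ A →L[ℂ] ℂ := φ d • h.toCLM.comp (slice h)
    have hfg : ∀ z, f z = g z := by
      intro z
      refine DenseRange.induction_on (e := Subtype.val) G.cancel_left.denseRange_val z
        (isClosed_eq f.continuous g.continuous) fun z => ?_
      refine Submodule.span_induction (p := fun z _ => f z = g z) ?_ (by simp)
        (fun x y _ _ hx hy => by rw [map_add, map_add, hx, hy])
        (fun c x _ hx => by rw [map_smul, map_smul, hx]) z.2
      rintro _ ⟨c, a, rfl⟩
      have h3 := hzero a (tmul c d)
      rw [mul_sub, map_sub, map_sub, tmul_mul_tmul, mul_one, slice_tmul, sub_eq_zero,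
        show tmul c d = tmul c 1 * tmul 1 d by rw [tmul_mul_tmul, mul_one, one_mul], mul_assoc,
        slice_tmul_one_mul, slice_comul_conv] at h3
      change h (G.sliceTwo φ h d (tmul c 1 * G.Δ a)) = φ d • h (slice h (tmul c 1 * G.Δ a))
      rw [sliceTwo_tmul_one_mul, slice_tmul_one_mul, h3, map_smul]
      rfl
    have h3 := hfg (tmul 1 q)
    change h (G.sliceTwo φ h d (tmul 1 q)) = φ d • h (slice h (tmul 1 q)) at h3
    rw [sliceTwo_tmul, slice_tmul, map_smul, map_smul, h.map_one] at h3
    simpa using h3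
  rw [← sub_eq_zero]
  -- By `hd` with `d = (conv h q - h(q))*`, the faithful state vanishes on the square of `conv h q -
  -- h(q)`.
  refine hφ _ ?_
  rw [mul_sub, mul_smul_comm, mul_one, map_sub, map_smul, hd, smul_eq_mul]
  ring

/-- The existence of an invariant state. -/
theorem exists_haar : ∃ h : CStarState A, ∀ a, slice h (G.Δ a) = h a • 1 := by
  have := G.separable
  obtain ⟨φ, hφ⟩ := CStarState.exists_faithful (B := A)
  -- `f n` is the convolution power of `φ` with exponent `n + 1`. A weak limit of its averages
  -- absorbs `φ` on both sides.
  let f : ℕ → CStarState A := fun n => Nat.rec φ (fun _ χ => G.convState χ φ) n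
  have hf : ∀ n a, f n (G.conv φ a) = f (n + 1) a := fun n a => rfl
  have hf2 : ∀ n a, φ (G.conv (f n) a) = f (n + 1) a := by
    intro n
    induction n with
    | zero => exact fun a => rfl
    | succ n ih =>
      intro a
      change φ (G.conv (G.convState (f n) φ) a) = _
      rw [← conv_conv, ih]
      rfl
  let U : Ultrafilter ℕ := Filter.hyperfilter ℕ
  have hU : (U : Filter ℕ) ≤ Filter.atTop := by
    rw [← Nat.cofinite_eq_atTop]
    exact Filter.hyperfilter_le_cofinite
  obtain ⟨h, hh⟩ := CStarState.exists_tendsto (CStarState.average f) U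
  refine ⟨h, G.conv_eq_of_absorb hφ
    (fun a => CStarState.eq_of_tendsto_average hU hh fun k => hf k a)
    fun a => ?_⟩
  rw [conv_apply, ← apply_sliceLeft]
  refine CStarState.eq_of_tendsto_average hU hh fun k => ?_
  rw [apply_sliceLeft, ← hf2, conv_apply]

end CompactQuantumGroup
end

/-! ### Scalar matrices, invariant subspaces and intertwining projections. -/

noncomputable section

namespace Matrix

variable {A : Type u} [Ring A] [Algebra ℂ A] {l m n : Type*}

/-- A scalar matrix, as a matrix over a complex algebra. -/
abbrev scal (A : Type u) [Ring A] [Algebra ℂ A] (P : Matrix m n ℂ) : Matrix m n A :=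
  P.map (algebraMap ℂ A)

theorem scal_one [DecidableEq m] : scal A (1 : Matrix m m ℂ) = 1 :=
  Matrix.map_one _ (map_zero _) (map_one _)

variable [Fintype m]

theorem scal_mul_apply (P : Matrix l m ℂ) (X : Matrix m n A) (i : l) (j : n) :
    (scal A P * X) i j = ∑ k, P i k • X k j := by
  simp [mul_apply, Algebra.smul_def]

theorem mul_scal_apply (X : Matrix l m A) (P : Matrix m n ℂ) (i : l) (j : n) :
    (X * scal A P) i j = ∑ k, P k j • X i k := by
  simp [mul_apply, Algebra.smul_def, Algebra.commutes]

theorem map_scal_mul (f : A →ₗ[ℂ] ℂ) (P : Matrix l m ℂ) (X : Matrix m n A) :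
    (scal A P * X).map f = P * X.map f := by
  ext i j
  rw [map_apply, scal_mul_apply]
  simp [mul_apply]

theorem map_mul_scal (f : A →ₗ[ℂ] ℂ) (X : Matrix l m A) (P : Matrix m n ℂ) :
    (X * scal A P).map f = X.map f * P := by
  ext i j
  rw [map_apply, mul_scal_apply]
  simp [mul_apply, mul_comm]

theorem scal_mul (P : Matrix l m ℂ) (Q : Matrix m n ℂ) : scal A (P * Q) = scal A P * scal A Q :=
  Matrix.map_mul

end Matrix

open Matrix MinTensor

namespace MatrixRep

variable {A : Type u} [CStarAlgebra A] {n : Type*} [Fintype n]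

theorem ext_states [Nontrivial A] {m n : Type*} {X Y : Matrix m n A}
    (h : ∀ ψ : CStarState A, X.map ψ.toCLM = Y.map ψ.toCLM) : X = Y := by
  ext i j
  rw [← sub_eq_zero]
  refine CStarState.eq_zero_of_forall fun ψ => ?_
  rw [map_sub, sub_eq_zero]
  exact congrFun (congrFun (h ψ) i) j

theorem map_action (α : Matrix n n A) (w : n → ℂ) (f : A →L[ℂ] ℂ) :
    (fun k => f (action α w k)) = α.map f *ᵥ w := by
  ext k
  simp [action, mulVec, dotProduct, mul_comm]

/-- Slicing by states turns invariance into a condition on complex matrices. Conversely, a linear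
projection onto `W` fixes every slice of `action α w`; states separate points, so it fixes the
vector itself and writes it with coefficients in `A` on elements of `W`. -/
theorem isInvariant_iff [Nontrivial A] {α : Matrix n n A} {W : Submodule ℂ (n → ℂ)} :
    IsInvariant α W ↔ ∀ w ∈ W, ∀ ψ : CStarState A, α.map ψ.toCLM *ᵥ w ∈ W := by
  classical
  constructor
  · intro h w hw ψ
    rw [← map_action]
    refine Submodule.span_induction (p := fun f _ => (fun k => ψ (f k)) ∈ W) ?_ ?_ ?_ ?_ (h w hw)
    · rintro _ ⟨w', hw', a, rfl⟩
      have : (fun k => ψ (w' k • a)) = ψ a • w' := by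
        ext k
        simp [mul_comm]
      rw [this]
      exact W.smul_mem _ hw'
    · simp only [Pi.zero_apply, map_zero]
      exact W.zero_mem
    · intro x y _ _ hx hy
      simp only [Pi.add_apply, map_add]
      exact W.add_mem hx hy
    · intro c x _ hx
      simp only [Pi.smul_apply, map_smul]
      exact W.smul_mem c hx
  · intro h w hw
    obtain ⟨g, hg⟩ := LinearMap.exists_leftInverse_of_injective W.subtype W.ker_subtype
    let p : (n → ℂ) →ₗ[ℂ] (n → ℂ) := W.subtype ∘ₗ g
    have hp : ∀ w ∈ W, p w = w := fun w hw =>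
      congrArg Subtype.val (congrArg (fun f => f (⟨w, hw⟩ : W)) hg)
    have hpW : ∀ w, p w ∈ W := fun w => (g w).2
    have key : action α w = ∑ j, fun k => p (fun l => if j = l then 1 else 0) k • action α w j := by
      ext k
      rw [Finset.sum_apply, ← sub_eq_zero]
      refine CStarState.eq_zero_of_forall fun ψ => ?_
      have h1 := congrFun (hp _ (h w hw ψ)) k
      rw [← map_action] at h1
      rw [map_sub, map_sum, sub_eq_zero]
      simp only [map_smul, smul_eq_mul]
      rw [show ψ.toCLM (action α w k) = p (fun k => ψ.toCLM (action α w k)) k from h1.symm,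
        LinearMap.pi_apply_eq_sum_univ p, Finset.sum_apply]
      exact Finset.sum_congr rfl fun j _ => mul_comm _ _
    rw [key]
    exact Submodule.sum_mem _ fun j _ => Submodule.subset_span ⟨_, hpW _, _, rfl⟩

end MatrixRep

namespace CompactQuantumGroup

variable {A : Type u} [CStarAlgebra A] {G : CompactQuantumGroup A}
  {n : Type*} [Fintype n] [DecidableEq n] {u : Matrix n n A}

theorem eq_of_tmul_one_mul_comul (G : CompactQuantumGroup A) {Z : Type*} [NormedAddCommGroup Z]
    [NormedSpace ℂ Z] {f g : A ⊗ᵐ A →L[ℂ] Z}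
    (h : ∀ c a, f (tmul c 1 * G.Δ a) = g (tmul c 1 * G.Δ a)) : f = g := by
  ext z
  refine DenseRange.induction_on (e := Subtype.val) G.cancel_left.denseRange_val z
    (isClosed_eq f.continuous g.continuous) fun z => ?_
  refine Submodule.span_induction (p := fun z _ => f z = g z) ?_ (by simp)
    (fun x y _ _ hx hy => by rw [map_add, map_add, hx, hy])
    (fun c x _ hx => by rw [map_smul, map_smul, hx]) z.2
  rintro _ ⟨c, a, rfl⟩
  exact h c a

/-- The functional `a ↦ h (· a)`. -/
def rightMulFunctional (h : CStarState A) (a : A) : A →L[ℂ] ℂ :=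
  h.toCLM.comp ((ContinuousLinearMap.mul ℂ A).flip a)

variable [Nontrivial A]

/-- `u* (id ⊗ h)(u (1 ⊗ a)) = (id ⊗ h)((1 ⊗ u) Δ(a))`. -/
theorem IsUnitaryRep.sum_star_mul (hu : G.IsUnitaryRep u) {h : CStarState A}
    (hh : ∀ a, slice h (G.Δ a) = h a • 1) (a : A) (i j : n) :
    ∑ k, h (u k j * a) • star (u k i) = slice h (tmul 1 (u i j) * G.Δ a) := by
  have h1 : ∀ k, h (u k j * a) • star (u k i) =
      slice h (∑ l, tmul (star (u k i) * u k l) (u l j) * G.Δ a) := by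
    intro k
    -- The scalar `h(u_kj a) · 1` is about to be replaced by `(id ⊗ h) Δ(u_kj a)`, after which
    -- unitarity collapses the first leg.
    have : h (u k j * a) • star (u k i) = star (u k i) * (h (u k j * a) • 1) := by
      rw [mul_smul_comm, mul_one]
    rw [this, ← hh, ← slice_tmul_one_mul, map_mul G.Δ, hu.comul, Finset.sum_mul, Finset.mul_sum]
    simp only [← mul_assoc, tmul_mul_tmul, one_mul]
  simp only [h1]
  rw [← map_sum, Finset.sum_comm]
  congr 1
  simp only [← Finset.sum_mul]
  congr 1
  have h2 : ∀ l, ∑ k, tmul (star (u k i) * u k l) (u l j) =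
      if i = l then (tmul 1 (u l j) : A ⊗ᵐ A) else 0 := by
    intro l
    have : ∑ k, tmul (star (u k i) * u k l) (u l j) =
        tmul (∑ k, star (u k i) * u k l) (u l j) := by
      simp only [tmul, TensorProduct.sum_tmul, map_sum]
    rw [this, hu.star_mul]
    split_ifs
    · rfl
    · simp [tmul]
  simp only [h2, Finset.sum_ite_eq, Finset.mem_univ, if_true]

/-- The invariant complement of an invariant subspace: the orthogonal projection onto an invariant
subspace is an intertwiner. -/
theorem IsUnitaryRep.commute_of_invariant (hu : G.IsUnitaryRep u) {P : Matrix n n ℂ}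
    (hP : P.IsHermitian) (hPu : u * scal A P = scal A P * (u * scal A P)) :
    u * scal A P = scal A P * u := by
  obtain ⟨h, hh⟩ := G.exists_haar
  -- The matrices `K a` are block triangular for `P`. They will be block diagonal because their span
  -- is, up to density, the self-adjoint span of the products `(K b)ᴴ K a`; the functionals `M` pass
  -- between the two descriptions.
  let K : A → Matrix n n ℂ := fun a => u.map (rightMulFunctional h a).toLinearMap
  have hK : ∀ a i j, K a i j = h (u i j * a) := fun a i j => rfl
  have hK1 : ∀ a, K a * P = P * (K a * P) := by
    intro a
    rw [← map_mul_scal, ← map_scal_mul, ← hPu]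
  let M : n → n → (A ⊗ᵐ A →L[ℂ] ℂ) := fun i j =>
    (prodState h h).toCLM.comp (ContinuousLinearMap.mul ℂ _ (tmul 1 (u i j)))
  have hM : ∀ i j p q, M i j (tmul p q) = h p * K q i j := by
    intro i j p q
    simp [M, tmul_mul_tmul, prodState_apply, slice_tmul, hK, mul_comm]
  have hMK : ∀ a b i j, M i j (tmul (star b) 1 * G.Δ a) = ((K b)ᴴ * K a) i j := by
    intro a b i j
    have h1 := congrArg (fun x => h (star b * x)) (hu.sum_star_mul hh a i j)
    simp only [← slice_tmul_one_mul, Finset.mul_sum, map_sum, mul_smul_comm, map_smul] at h1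
    rw [← mul_assoc, tmul_mul_tmul, mul_one, one_mul] at h1
    change h (slice h (tmul 1 (u i j) * (tmul (star b) 1 * G.Δ a))) = _
    rw [← mul_assoc, tmul_mul_tmul, mul_one, one_mul, ← h1, mul_apply]
    refine Finset.sum_congr rfl fun k _ => ?_
    rw [conjTranspose_apply, hK, hK, smul_eq_mul, mul_comm, ← h.map_star, StarMul.star_mul]
  have hM1 : ∀ i j, ∑ l, P l j • M i l = ∑ k, P i k • ∑ l, P l j • M k l := by
    intro i j
    refine clm_ext fun p q => ?_
    have := congrFun (congrFun (hK1 q) i) j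
    simp only [mul_apply] at this
    simp only [_root_.sum_apply, _root_.smul_apply, hM, smul_eq_mul]
    calc _ = h p * ∑ l, K q i l * P l j := by
          rw [Finset.mul_sum]; exact Finset.sum_congr rfl fun _ _ => by ring
      _ = _ := by
          rw [this, Finset.mul_sum]
          refine Finset.sum_congr rfl fun _ _ => ?_
          rw [Finset.mul_sum, Finset.mul_sum, Finset.mul_sum]
          exact Finset.sum_congr rfl fun _ _ => by ring
  have hKK1 : ∀ a b, (K b)ᴴ * K a * P = P * ((K b)ᴴ * K a * P) := by
    intro a b
    ext i j
    have := congrArg (fun f => f (tmul (star b) 1 * G.Δ a)) (hM1 i j)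
    simp only [_root_.sum_apply, _root_.smul_apply, hMK, smul_eq_mul] at this
    rw [mul_apply, mul_apply]
    simp only [mul_apply (M := (K b)ᴴ * K a), mul_comm _ (P _ j)]
    exact this
  -- The adjoint of `(K b)ᴴ K a` is `(K a)ᴴ K b`, of the same form, so triangularity holds on the
  -- other side too.
  have hKK2 : ∀ a b, P * ((K b)ᴴ * K a) = P * ((K b)ᴴ * K a) * P := by
    intro a b
    have := congrArg conjTranspose (hKK1 b a)
    simp only [conjTranspose_mul, conjTranspose_conjTranspose, hP.eq] at this
    simpa only [Matrix.mul_assoc] using this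
  -- Density of the span of `(c ⊗ 1) Δ(a)` carries this from the products back to `M`, hence to `K
  -- a` by evaluating at `1 ⊗ a`.
  have hM2 : ∀ i j, ∑ k, P i k • M k j = ∑ l, P l j • ∑ k, P i k • M k l := by
    intro i j
    refine eq_of_tmul_one_mul_comul G fun c a => ?_
    have := congrFun (congrFun (hKK2 a (star c)) i) j
    rw [mul_apply, mul_apply] at this
    simp only [mul_apply (M := P) (N := (K (star c))ᴴ * K a), mul_comm _ (P _ j)] at this
    simp only [_root_.sum_apply, _root_.smul_apply, smul_eq_mul]
    simpa only [← hMK, star_star] using this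
  have hK2 : ∀ a, P * K a = P * K a * P := by
    intro a
    ext i j
    have := congrArg (fun f => f (tmul 1 a)) (hM2 i j)
    simp only [_root_.sum_apply, _root_.smul_apply, smul_eq_mul, hM, h.map_one, one_mul] at this
    rw [mul_apply, mul_apply]
    simp only [mul_apply (M := P) (N := K a), mul_comm _ (P _ j)]
    exact this
  have hcomm : ∀ a, K a * P = P * K a := fun a => by
    rw [hK1, hK2, Matrix.mul_assoc]
  let V : n → n → (A ⊗ᵐ A →L[ℂ] A) := fun i j =>
    (slice h).comp (ContinuousLinearMap.mul ℂ _ (tmul 1 (u i j)))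
  have hV : ∀ i j p q, V i j (tmul p q) = K q i j • p := by
    intro i j p q
    simp [V, tmul_mul_tmul, slice_tmul, hK]
  have hVP : ∀ i j, ∑ k, P k j • V i k = ∑ k, P i k • V k j := by
    intro i j
    refine clm_ext fun p q => ?_
    have := congrFun (congrFun (hcomm q) i) j
    simp only [mul_apply] at this
    simp only [_root_.sum_apply, _root_.smul_apply, hV, smul_smul, ← Finset.sum_smul]
    rw [← this]
    simp only [mul_comm]
  have hVK : ∀ a, uᴴ * scal A (K a) = of fun i j => V i j (G.Δ a) := by
    intro a
    ext i j
    rw [mul_scal_apply]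
    exact hu.sum_star_mul hh a i j
  -- Both `K a` and `uᴴ K a = V(Δ a)` commute with `P`.
  have hy : ∀ a, (scal A P * uᴴ - uᴴ * scal A P) * scal A (K a) = 0 := by
    intro a
    rw [sub_mul, Matrix.mul_assoc, Matrix.mul_assoc, ← scal_mul, ← hcomm, scal_mul,
      ← Matrix.mul_assoc uᴴ, hVK, sub_eq_zero]
    ext i j
    have := congrArg (fun f => f (G.Δ a)) (hVP i j)
    simp only [_root_.sum_apply, _root_.smul_apply] at this
    rw [scal_mul_apply, mul_scal_apply]
    exact this.symm
  have hzero : scal A P * uᴴ - uᴴ * scal A P = 0 := by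
    set y := scal A P * uᴴ - uᴴ * scal A P
    ext i l
    -- The sum is `h((u uᴴ)_kl)`; it recovers each entry of `y` from the vanishing products `y K a`.
    have h1 : ∀ k, ∑ j, K (star (u l j)) k j = if k = l then 1 else 0 := by
      intro k
      simp only [hK, ← map_sum, hu.mul_star]
      split_ifs
      · exact h.map_one
      · exact map_zero _
    have h2 : ∑ j, (y * scal A (K (star (u l j)))) i j = 0 := by
      simp only [y, hy, Matrix.zero_apply, Finset.sum_const_zero]
    simp only [mul_scal_apply] at h2
    rw [Finset.sum_comm] at h2
    simpa [← Finset.sum_smul, h1] using h2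
  have h3 := congrArg conjTranspose (sub_eq_zero.1 hzero)
  have h4 : (scal A P)ᴴ = scal A P := by
    ext i j
    have := congrFun (congrFun hP.eq i) j
    rw [conjTranspose_apply] at this
    change star (algebraMap ℂ A (P j i)) = algebraMap ℂ A (P i j)
    rw [← this, algebraMap_star_comm]
  simpa only [conjTranspose_mul, conjTranspose_conjTranspose, h4] using h3

end CompactQuantumGroup
end

/-! ### Subrepresentations, irreducible constituents and tensor powers. -/

noncomputable section

open Matrix MinTensor

/-- Sums over words of length `ℓ + 1`. -/
theorem Fin.sum_word {n M : Type*} [Fintype n] [AddCommMonoid M] {ℓ : ℕ}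
    (F : (Fin (ℓ + 1) → n) → M) :
    ∑ μ, F μ = ∑ i, ∑ μ : Fin ℓ → n, F (Fin.cons i μ) := by
  rw [← (Fin.consEquiv fun _ : Fin (ℓ + 1) => n).sum_comp F, Fintype.sum_prod_type]
  rfl

namespace MinTensor

variable {X : Type u} {Y : Type v} [CStarAlgebra X] [CStarAlgebra Y]

/-- The `*`-homomorphism `b ↦ 1 ⊗ b`. -/
def inr : Y →⋆ₐ[ℂ] X ⊗ᵐ Y :=
  ofAlg.comp
    { (Algebra.TensorProduct.includeRight : Y →ₐ[ℂ] X ⊗[ℂ] Y) with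
      map_star' := fun a => by simp }

theorem inr_apply (y : Y) : inr y = tmul (1 : X) y := rfl

theorem inl_mul_inr (x : X) (y : Y) : inl x * inr y = tmul x y := by
  rw [inl_apply, inr_apply, tmul_mul_tmul, mul_one, one_mul]

theorem sum_tmul {ι : Type*} (s : Finset ι) (f : ι → X) (y : Y) :
    tmul (∑ i ∈ s, f i) y = ∑ i ∈ s, tmul (f i) y := by
  simp only [tmul, TensorProduct.sum_tmul, map_sum]

theorem tmul_sum {ι : Type*} (s : Finset ι) (x : X) (f : ι → Y) :
    tmul x (∑ i ∈ s, f i) = ∑ i ∈ s, tmul x (f i) := by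
  simp only [tmul, TensorProduct.tmul_sum, map_sum]

theorem smul_tmul (c : ℂ) (x : X) (y : Y) : tmul (c • x) y = c • tmul x y := by
  rw [tmul, ← TensorProduct.smul_tmul', map_smul, tmul]

theorem tmul_smul (c : ℂ) (x : X) (y : Y) : tmul x (c • y) = c • tmul x y := by
  rw [tmul, TensorProduct.tmul_smul, map_smul, tmul]

@[simp]
theorem tmul_zero (x : X) : tmul x (0 : Y) = 0 := by simp [tmul]

end MinTensor

namespace Matrix

theorem map_scal {A : Type u} {B : Type v} [Ring A] [Algebra ℂ A] [Ring B] [Algebra ℂ B]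
    {m n F : Type*} [FunLike F A B] [AlgHomClass F ℂ A B] (f : F) (P : Matrix m n ℂ) :
    (scal A P).map f = scal B P := by
  ext i j
  exact AlgHomClass.commutes f (P i j)

theorem conjTranspose_scal {A : Type u} [Ring A] [StarRing A] [Algebra ℂ A] [StarModule ℂ A]
    {m n : Type*} (P : Matrix m n ℂ) : (scal A P)ᴴ = scal A Pᴴ := by
  ext i j
  exact (algebraMap_star_comm _).symm

/-- Every subspace is the range of an isometric matrix. -/
theorem exists_isometry {n : Type*} [Fintype n] (W : Submodule ℂ (n → ℂ)) :
    ∃ (m : ℕ) (V : Matrix n (Fin m) ℂ), Vᴴ * V = 1 ∧ (∀ x, V *ᵥ x ∈ W) ∧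
      ∀ w ∈ W, V *ᵥ (Vᴴ *ᵥ w) = w := by
  let e := (WithLp.linearEquiv 2 ℂ (n → ℂ))
  let W' : Submodule ℂ (EuclideanSpace ℂ n) := W.comap e.toLinearMap
  let b := stdOrthonormalBasis ℂ W'
  let V : Matrix n (Fin (Module.finrank ℂ W')) ℂ := of fun i a => (b a : EuclideanSpace ℂ n) i
  have hinner : ∀ (x : EuclideanSpace ℂ n) a, (Vᴴ *ᵥ (e x)) a =
      inner ℂ (b a : EuclideanSpace ℂ n) x := by
    intro x a
    rw [PiLp.inner_apply, mulVec, dotProduct]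
    refine Finset.sum_congr rfl fun i _ => ?_
    rw [conjTranspose_apply, RCLike.inner_apply, mul_comm]
    rfl
  have hV : ∀ x, V *ᵥ x = e (∑ a, x a • (b a : EuclideanSpace ℂ n)) := by
    intro x
    ext i
    rw [map_sum, Finset.sum_apply, mulVec, dotProduct]
    refine Finset.sum_congr rfl fun a _ => ?_
    rw [mul_comm]
    rfl
  refine ⟨_, V, ?_, ?_, ?_⟩
  · ext a a'
    have h1 := hinner (b a' : EuclideanSpace ℂ n) a
    have h2 := orthonormal_iff_ite.1 b.orthonormal a a'
    rw [Submodule.coe_inner] at h2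
    rw [h2] at h1
    rw [one_apply, ← h1]
    rfl
  · intro x
    rw [hV]
    exact Submodule.sum_mem W' fun a _ => W'.smul_mem _ (b a).2
  · intro w hw
    let w' : W' := ⟨e.symm w, by simpa [W'] using hw⟩
    rw [hV]
    have h1 : ∀ a, (Vᴴ *ᵥ w) a = inner ℂ (b a) w' := by
      intro a
      rw [Submodule.coe_inner, ← hinner]
      simp [w']
    simp only [h1]
    have h2 := congrArg Subtype.val (b.sum_repr' w')
    rw [Submodule.coe_sum] at h2
    refine (congrArg e h2).trans ?_
    simp [w']

end Matrix

namespace MatrixRep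

variable {A : Type u} [CStarAlgebra A] {n : Type*}

theorem tensorPow_zero (α : Matrix n n A) (μ ν : Fin 0 → n) : tensorPow α 0 μ ν = 1 := rfl

theorem tensorPow_cons (α : Matrix n n A) {ℓ : ℕ} (i j : n) (μ ν : Fin ℓ → n) :
    tensorPow α (ℓ + 1) (Fin.cons i μ) (Fin.cons j ν) = α i j * tensorPow α ℓ μ ν := by
  simp [tensorPow, List.ofFn_succ]

theorem isInvariant_eq [Nontrivial A] [Fintype n] {α : Matrix n n A} {W : Submodule ℂ (n → ℂ)}
    (hW : IsInvariant α W) {P : Matrix n n ℂ} (hP1 : ∀ x, P *ᵥ x ∈ W) (hP2 : ∀ w ∈ W, P *ᵥ w = w) :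
    α * scal A P = scal A P * (α * scal A P) := by
  rw [isInvariant_iff] at hW
  refine ext_states fun ψ => ?_
  have h1 : (α * scal A P).map ψ.toCLM = α.map ψ.toCLM * P := map_mul_scal ψ.toCLM.toLinearMap α P
  have h2 : (scal A P * (α * scal A P)).map ψ.toCLM = P * (α * scal A P).map ψ.toCLM :=
    map_scal_mul ψ.toCLM.toLinearMap P _
  rw [h2, h1]
  refine mulVec_injective (funext fun x => ?_)
  rw [← mulVec_mulVec, ← mulVec_mulVec, ← mulVec_mulVec]
  exact (hP2 _ (hW _ (hP1 x) ψ)).symm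

end MatrixRep

namespace CompactQuantumGroup

open MatrixRep

variable {A : Type u} [CStarAlgebra A] {G : CompactQuantumGroup A}
  {n : Type*} [Fintype n] [DecidableEq n] {u : Matrix n n A}

theorem isUnitaryRep_iff : G.IsUnitaryRep u ↔
    uᴴ * u = 1 ∧ u * uᴴ = 1 ∧ u.map G.Δ = u.map inl * u.map inr := by
  constructor
  · intro h
    refine ⟨?_, ?_, ?_⟩
    · ext i j
      simpa [mul_apply, one_apply] using h.star_mul i j
    · ext i j
      simpa [mul_apply, one_apply] using h.mul_star i j
    · ext i j
      simpa [mul_apply, inl_mul_inr] using h.comul i j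
  · rintro ⟨h1, h2, h3⟩
    refine ⟨fun i j => ?_, fun i j => ?_, fun i j => ?_⟩
    · simpa [mul_apply, one_apply] using congrFun (congrFun h1 i) j
    · simpa [mul_apply, one_apply] using congrFun (congrFun h2 i) j
    · simpa [mul_apply, inl_mul_inr] using congrFun (congrFun h3 i) j

/-- The restriction of a unitary representation to the range of an intertwining projection. -/
theorem IsUnitaryRep.restrict (hu : G.IsUnitaryRep u) {m : Type*} [Fintype m] [DecidableEq m]
    {V : Matrix n m ℂ} (hV : Vᴴ * V = 1) (hc : u * scal A (V * Vᴴ) = scal A (V * Vᴴ) * u) :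
    G.IsUnitaryRep (scal A Vᴴ * u * scal A V) := by
  obtain ⟨h1, h2, h3⟩ := isUnitaryRep_iff.1 hu
  have hc' : uᴴ * scal A (V * Vᴴ) = scal A (V * Vᴴ) * uᴴ := by
    have := congrArg conjTranspose hc
    simp only [conjTranspose_mul, conjTranspose_scal, conjTranspose_conjTranspose] at this
    exact this.symm
  have hVV : scal A Vᴴ * scal A V = 1 := by rw [← scal_mul, hV, scal_one]
  rw [isUnitaryRep_iff]
  have hstar : (scal A Vᴴ * u * scal A V)ᴴ = scal A Vᴴ * uᴴ * scal A V := by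
    simp only [conjTranspose_mul, conjTranspose_scal, conjTranspose_conjTranspose,
      Matrix.mul_assoc]
  have hmid : ∀ X Y : Matrix n n A, X * scal A (V * Vᴴ) = scal A (V * Vᴴ) * X → X * Y = 1 →
      (scal A Vᴴ * X * scal A V) * (scal A Vᴴ * Y * scal A V) = 1 := by
    intro X Y hX hXY
    calc _ = scal A Vᴴ * (X * scal A (V * Vᴴ)) * (Y * scal A V) := by
          rw [scal_mul]; simp only [Matrix.mul_assoc]
      _ = (scal A Vᴴ * scal A V) * scal A Vᴴ * (X * Y) * scal A V := by
          rw [hX, scal_mul]; simp only [Matrix.mul_assoc]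
      _ = 1 := by rw [hVV, hXY, Matrix.one_mul, Matrix.mul_one, hVV]
  refine ⟨?_, ?_, ?_⟩
  · rw [hstar]
    exact hmid _ _ hc' h1
  · rw [hstar]
    exact hmid _ _ hc h2
  · have e : ∀ f : A →⋆ₐ[ℂ] A ⊗ᵐ A, (scal A Vᴴ * u * scal A V).map f =
        scal (A ⊗ᵐ A) Vᴴ * u.map f * scal (A ⊗ᵐ A) V := by
      intro f
      rw [Matrix.map_mul, Matrix.map_mul, map_scal f, map_scal f]
    have hc2 : u.map (inr : A →⋆ₐ[ℂ] A ⊗ᵐ A) * scal (A ⊗ᵐ A) (V * Vᴴ) =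
        scal (A ⊗ᵐ A) (V * Vᴴ) * u.map (inr : A →⋆ₐ[ℂ] A ⊗ᵐ A) := by
      rw [← map_scal (inr : A →⋆ₐ[ℂ] A ⊗ᵐ A), ← Matrix.map_mul, ← Matrix.map_mul, hc]
    rw [e, e, e, h3]
    simp only [Matrix.mul_assoc]
    rw [← Matrix.mul_assoc (scal (A ⊗ᵐ A) V) (scal (A ⊗ᵐ A) Vᴴ), ← scal_mul,
      ← Matrix.mul_assoc (scal (A ⊗ᵐ A) (V * Vᴴ)), ← hc2, Matrix.mul_assoc (u.map inr), ← scal_mul,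
      Matrix.mul_assoc V, hV, Matrix.mul_one]

/-- Every nonzero invariant subspace contains an irreducible unitary representation. -/
theorem IsUnitaryRep.exists_irreducible [Nontrivial A] (hu : G.IsUnitaryRep u)
    {W : Submodule ℂ (n → ℂ)} (hW : IsInvariant u W) (hW0 : W ≠ ⊥) :
    ∃ (m : ℕ) (β : Matrix (Fin m) (Fin m) A) (V : Matrix n (Fin m) ℂ), G.IsUnitaryRep β ∧
      IsIrreducible β ∧ Vᴴ * V = 1 ∧ scal A V * β = u * scal A V ∧ ∀ x, V *ᵥ x ∈ W := by
  -- A minimal nonzero invariant subspace carries an irreducible representation: an invariant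
  -- subspace of the compression maps by `V` to an invariant subspace of `W₁`.
  obtain ⟨W₁, ⟨hinv, hne, hle⟩, hmin⟩ := wellFounded_lt.has_min
    {U : Submodule ℂ (n → ℂ) | IsInvariant u U ∧ U ≠ ⊥ ∧ U ≤ W} ⟨W, hW, hW0, le_rfl⟩
  obtain ⟨m, V, hV, hVW, hVV⟩ := exists_isometry W₁
  have hP1 : ∀ x, (V * Vᴴ) *ᵥ x ∈ W₁ := fun x => by rw [← mulVec_mulVec]; exact hVW _
  have hP2 : ∀ w ∈ W₁, (V * Vᴴ) *ᵥ w = w := fun w hw => by rw [← mulVec_mulVec]; exact hVV w hw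
  have hc := hu.commute_of_invariant (P := V * Vᴴ)
    (by rw [IsHermitian, conjTranspose_mul, conjTranspose_conjTranspose])
    (isInvariant_eq hinv hP1 hP2)
  have hβ : scal A V * (scal A Vᴴ * u * scal A V) = u * scal A V := by
    rw [← Matrix.mul_assoc, ← Matrix.mul_assoc, ← scal_mul, ← hc, Matrix.mul_assoc, ← scal_mul,
      Matrix.mul_assoc, hV, Matrix.mul_one]
  have hinj : ∀ x y, V *ᵥ x = V *ᵥ y → x = y := fun x y h => by
    have := congrArg (fun z => Vᴴ *ᵥ z) h
    simpa only [mulVec_mulVec, hV, one_mulVec] using this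
  refine ⟨m, _, V, hu.restrict hV hc, ⟨?_, fun U hU => ?_⟩, hV, hβ, fun x => hle (hVW x)⟩
  · by_contra h
    rw [not_nonempty_iff] at h
    refine hne ((Submodule.eq_bot_iff _).2 fun w hw => ?_)
    rw [← hVV w hw]
    ext i
    simp [mulVec, dotProduct]
  · let U' : Submodule ℂ (n → ℂ) := U.map V.mulVecLin
    have hU' : IsInvariant u U' := by
      rw [isInvariant_iff] at hU ⊢
      rintro _ ⟨x, hx, rfl⟩ ψ
      refine ⟨_, hU x hx ψ, ?_⟩
      have h1 : V * (scal A Vᴴ * u * scal A V).map ψ.toCLM = u.map ψ.toCLM * V :=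
        (map_scal_mul ψ.toCLM.toLinearMap V _).symm.trans
          ((congrArg (fun X => X.map ψ.toCLM) hβ).trans (map_mul_scal ψ.toCLM.toLinearMap u V))
      rw [mulVecLin_apply, mulVecLin_apply, mulVec_mulVec, mulVec_mulVec, h1]
    have hU'W : U' ≤ W₁ := by
      rintro _ ⟨x, -, rfl⟩
      exact hVW x
    by_cases h0 : U' = ⊥
    · left
      refine (Submodule.eq_bot_iff _).2 fun x hx => hinj _ _ ?_
      have : V.mulVecLin x ∈ U' := ⟨x, hx, rfl⟩
      rw [h0, Submodule.mem_bot] at this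
      rw [mulVec_zero]
      exact this
    · right
      have h1 : U' = W₁ := by
        by_contra hne'
        exact hmin U' ⟨hU', h0, hU'W.trans hle⟩ (lt_of_le_of_ne hU'W hne')
      refine (Submodule.eq_top_iff').2 fun x => ?_
      have : V *ᵥ x ∈ U' := h1 ▸ hVW x
      obtain ⟨y, hy, hxy⟩ := this
      rw [← hinj _ _ hxy]
      exact hy

theorem IsUnitaryRep.tensorPow (hu : G.IsUnitaryRep u) (ℓ : ℕ) :
    G.IsUnitaryRep (MatrixRep.tensorPow u ℓ) := by
  induction ℓ with
  | zero =>
    refine ⟨fun i j => ?_, fun i j => ?_, fun i j => ?_⟩ <;>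
      simp [tensorPow_zero, Subsingleton.elim i j, one_tmul_one]
  | succ ℓ ih =>
    refine ⟨fun i j => ?_, fun i j => ?_, fun i j => ?_⟩ <;>
      induction i using Fin.consCases with | cons i μ => ?_ <;>
      induction j using Fin.consCases with | cons j ν => ?_ <;>
      simp only [Fin.sum_word, tensorPow_cons, StarMul.star_mul, Fin.cons_inj]
    · rw [Finset.sum_comm]
      have h1 : ∀ κ, ∑ k, star (MatrixRep.tensorPow u ℓ κ μ) * star (u k i) *
          (u k j * MatrixRep.tensorPow u ℓ κ ν) = star (MatrixRep.tensorPow u ℓ κ μ) *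
            (∑ k, star (u k i) * u k j) * MatrixRep.tensorPow u ℓ κ ν := fun κ => by
        simp only [Finset.mul_sum, Finset.sum_mul, mul_assoc]
      simp only [h1, hu.star_mul]
      by_cases hij : i = j
      · simp [hij, ih.star_mul]
      · simp [hij]
    · have h1 : ∀ k, ∑ κ, u i k * MatrixRep.tensorPow u ℓ μ κ *
          (star (MatrixRep.tensorPow u ℓ ν κ) * star (u j k)) = u i k *
            (∑ κ, MatrixRep.tensorPow u ℓ μ κ * star (MatrixRep.tensorPow u ℓ ν κ)) *
              star (u j k) := fun κ => by
        simp only [Finset.mul_sum, Finset.sum_mul, mul_assoc]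
      simp only [h1, ih.mul_star]
      by_cases hij : μ = ν
      · simp [hij, hu.mul_star]
      · simp [hij]
    · rw [map_mul, hu.comul, ih.comul, Finset.sum_mul_sum]
      simp only [tmul_mul_tmul]

end CompactQuantumGroup
end

/-! ### Words, the dense core and the canonical endomorphism of the Cuntz algebra. -/

noncomputable section

open Matrix MinTensor

namespace CuntzAlgebra

variable {d : ℕ}

theorem star_S_mul_S (i j : Fin d) :
    star (S i : CuntzAlgebra d) * S j = if i = j then 1 else 0 := isCuntzFamily_S.star_mul i j

theorem sum_S_mul_star : ∑ j, (S j : CuntzAlgebra d) * star (S j) = 1 :=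
  isCuntzFamily_S.sum_mul_star

/-- The product `S_{μ 0} S_{μ 1} ⋯`. -/
def word {ℓ : ℕ} (μ : Fin ℓ → Fin d) : CuntzAlgebra d := (List.ofFn fun k => S (μ k)).prod

@[simp]
theorem word_zero (μ : Fin 0 → Fin d) : word μ = 1 := rfl

theorem word_cons {ℓ : ℕ} (i : Fin d) (μ : Fin ℓ → Fin d) :
    word (Fin.cons i μ : Fin (ℓ + 1) → Fin d) = S i * word μ := by
  simp [word, List.ofFn_succ]

theorem word_append {k ℓ : ℕ} (μ : Fin k → Fin d) (ν : Fin ℓ → Fin d) :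
    word (Fin.append μ ν) = word μ * word ν := by
  rw [word, word, word, ← List.prod_append, ← List.ofFn_fin_append]
  congr 2
  ext x
  induction x using Fin.addCases <;> simp

theorem star_word_mul_word {ℓ : ℕ} (μ ν : Fin ℓ → Fin d) :
    star (word μ) * word ν = if μ = ν then 1 else 0 := by
  induction ℓ with
  | zero => simp [Subsingleton.elim μ ν]
  | succ ℓ ih =>
    induction μ using Fin.consCases with | cons i μ => ?_
    induction ν using Fin.consCases with | cons j ν => ?_
    rw [word_cons, word_cons, star_mul, mul_assoc, ← mul_assoc (star (S i)), star_S_mul_S]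
    by_cases hij : i = j
    · simp [hij, ih, Fin.cons_inj]
    · simp [hij, Fin.cons_inj]

theorem sum_word_mul_star (ℓ : ℕ) :
    ∑ μ : Fin ℓ → Fin d, word μ * star (word μ) = 1 := by
  induction ℓ with
  | zero => simp
  | succ ℓ ih =>
    rw [Fin.sum_word]
    have h1 : ∀ i, ∑ μ : Fin ℓ → Fin d, word (Fin.cons i μ : Fin (ℓ + 1) → Fin d) *
        star (word (Fin.cons i μ : Fin (ℓ + 1) → Fin d)) =
        S i * (∑ μ : Fin ℓ → Fin d, word μ * star (word μ)) * star (S i) := by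
      intro i
      simp only [word_cons, star_mul, Finset.mul_sum, Finset.sum_mul, mul_assoc]
    simp only [h1, ih, mul_one, sum_S_mul_star]

/-- The element `∑ w_μ S_μ` for a tensor `w ∈ (ℂᵈ)^{⊗ ℓ}`. -/
def tvec (ℓ : ℕ) : ((Fin ℓ → Fin d) → ℂ) →ₗ[ℂ] CuntzAlgebra d :=
  Fintype.linearCombination ℂ word

theorem tvec_apply {ℓ : ℕ} (w : (Fin ℓ → Fin d) → ℂ) : tvec ℓ w = ∑ μ, w μ • word μ := rfl

theorem star_tvec_mul_tvec {ℓ : ℕ} (v w : (Fin ℓ → Fin d) → ℂ) :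
    star (tvec ℓ v) * tvec ℓ w = (star v ⬝ᵥ w) • (1 : CuntzAlgebra d) := by
  simp only [tvec_apply, star_sum, star_smul, Finset.sum_mul_sum, smul_mul_smul_comm,
    star_word_mul_word, smul_ite, smul_zero, Finset.sum_ite_eq, Finset.mem_univ, if_true,
    dotProduct, Finset.sum_smul, Pi.star_apply]

/-- The span of the `S_μ S_ν*` with words of length at most `k`. -/
def core (d k : ℕ) : Submodule ℂ (CuntzAlgebra d) :=
  Submodule.span ℂ {x | ∃ (a b : ℕ) (μ : Fin a → Fin d) (ν : Fin b → Fin d), a ≤ k ∧ b ≤ k ∧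
    x = word μ * star (word ν)}

theorem core_mono {k l : ℕ} (h : k ≤ l) : core d k ≤ core d l :=
  Submodule.span_mono fun _ ⟨a, b, μ, ν, ha, hb, hx⟩ =>
    ⟨a, b, μ, ν, ha.trans h, hb.trans h, hx⟩

theorem word_mul_star_word_mem {a b k : ℕ} (ha : a ≤ k) (hb : b ≤ k) (μ : Fin a → Fin d)
    (ν : Fin b → Fin d) : word μ * star (word ν) ∈ core d k :=
  Submodule.subset_span ⟨a, b, μ, ν, ha, hb, rfl⟩

theorem one_mem_core : (1 : CuntzAlgebra d) ∈ core d 0 := by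
  have := word_mul_star_word_mem (d := d) (k := 0) le_rfl le_rfl Fin.elim0 Fin.elim0
  simpa using this

theorem star_mem_core {k : ℕ} {x : CuntzAlgebra d} (hx : x ∈ core d k) : star x ∈ core d k := by
  refine Submodule.span_induction (p := fun x _ => star x ∈ core d k) ?_ (by simp)
    (fun x y _ _ hx hy => by rw [star_add]; exact add_mem hx hy)
    (fun c x _ hx => by rw [star_smul]; exact Submodule.smul_mem _ _ hx) hx
  rintro _ ⟨a, b, μ, ν, ha, hb, rfl⟩
  rw [star_mul, star_star]
  exact word_mul_star_word_mem hb ha ν μ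

theorem S_mul_mem_core {k : ℕ} {x : CuntzAlgebra d} (hx : x ∈ core d k) (i : Fin d) :
    S i * x ∈ core d (k + 1) := by
  refine Submodule.span_induction (p := fun x _ => S i * x ∈ core d (k + 1)) ?_ (by simp)
    (fun x y _ _ hx hy => by rw [mul_add]; exact add_mem hx hy)
    (fun c x _ hx => by rw [mul_smul_comm]; exact Submodule.smul_mem _ _ hx) hx
  rintro _ ⟨a, b, μ, ν, ha, hb, rfl⟩
  rw [← mul_assoc, ← word_cons]
  exact word_mul_star_word_mem (by omega) (by omega) _ _

theorem star_S_mul_mem_core {k : ℕ} {x : CuntzAlgebra d} (hx : x ∈ core d k) (i : Fin d) :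
    star (S i) * x ∈ core d (k + 1) := by
  refine Submodule.span_induction (p := fun x _ => star (S i) * x ∈ core d (k + 1)) ?_ (by simp)
    (fun x y _ _ hx hy => by rw [mul_add]; exact add_mem hx hy)
    (fun c x _ hx => by rw [mul_smul_comm]; exact Submodule.smul_mem _ _ hx) hx
  rintro _ ⟨a, b, μ, ν, ha, hb, rfl⟩
  cases a with
  | zero =>
    have h1 : S i = word (fun _ : Fin 1 => i) := by simp [word]
    rw [word_zero, one_mul, ← star_mul, h1, ← word_append, ← one_mul (star _), ← word_zero μ]
    exact word_mul_star_word_mem (by omega) (by omega) _ _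
  | succ a =>
    induction μ using Fin.consCases with | cons j μ => ?_
    rw [word_cons, ← mul_assoc, ← mul_assoc, star_S_mul_S]
    split_ifs
    · rw [one_mul]
      exact word_mul_star_word_mem (by omega) (by omega) _ _
    · rw [zero_mul, zero_mul]
      exact zero_mem _

/-- The canonical map of the free `*`-algebra. -/
def ofFree : FreeStarAlgebra (Fin d) →⋆ₐ[ℂ] CuntzAlgebra d := (cuntzSeminorm d).toCompletion

theorem denseRange_ofFree : DenseRange (ofFree : FreeStarAlgebra (Fin d) →⋆ₐ[ℂ] CuntzAlgebra d) :=
  (cuntzSeminorm d).denseRange_toCompletion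

/-- Left multiplication by a generator or its adjoint raises the word length by at most one. Applied
to `1`, this places the image of the free algebra in the union of the spans `core d l`. -/
theorem free_mul_mem_core (f : FreeStarAlgebra (Fin d)) : ∀ k, ∀ x ∈ core d k, ∃ l,
    ofFree f * x ∈ core d l := by
  induction f using FreeStarAlgebra.induction_on with
  | scalar c =>
    intro k x hx
    refine ⟨k, ?_⟩
    rw [AlgHomClass.commutes, ← Algebra.smul_def]
    exact Submodule.smul_mem _ _ hx
  | sym y =>
    intro k x hx
    refine ⟨k + 1, ?_⟩
    cases y with
    | inl i => exact S_mul_mem_core hx i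
    | inr i =>
      have h : (ofFree (FreeStarAlgebra.sym (Sum.inr i)) : CuntzAlgebra d) = star (S i) := by
        rw [show FreeStarAlgebra.sym (Sum.inr i) = star (FreeStarAlgebra.gen i) from
          (FreeStarAlgebra.star_sym (Sum.inl i)).symm, map_star]
        rfl
      rw [h]
      exact star_S_mul_mem_core hx i
  | mul f g hf hg =>
    intro k x hx
    obtain ⟨l, hl⟩ := hg k x hx
    obtain ⟨m, hm⟩ := hf l _ hl
    refine ⟨m, ?_⟩
    rwa [map_mul, mul_assoc]
  | add f g hf hg =>
    intro k x hx
    obtain ⟨l, hl⟩ := hf k x hx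
    obtain ⟨m, hm⟩ := hg k x hx
    refine ⟨max l m, ?_⟩
    rw [map_add, add_mul]
    exact add_mem (core_mono (le_max_left l m) hl) (core_mono (le_max_right l m) hm)

/-- The elements `∑ c_{μν} S_μ S_ν*` are dense. -/
theorem exists_core_near (x : CuntzAlgebra d) {ε : ℝ} (hε : 0 < ε) :
    ∃ k, ∃ y ∈ core d k, ‖x - y‖ < ε := by
  obtain ⟨f, hf⟩ := denseRange_ofFree.exists_dist_lt x hε
  obtain ⟨k, hk⟩ := free_mul_mem_core f 0 1 one_mem_core
  rw [mul_one] at hk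
  exact ⟨k, _, hk, by rwa [dist_eq_norm] at hf⟩

theorem norm_hom_le {B : Type v} [CStarAlgebra B] (f : CuntzAlgebra d →⋆ₐ[ℂ] B)
    (x : CuntzAlgebra d) : ‖f x‖ ≤ ‖x‖ := NonUnitalStarAlgHom.norm_apply_le f x

theorem continuous_hom {B : Type v} [CStarAlgebra B] (f : CuntzAlgebra d →⋆ₐ[ℂ] B) :
    Continuous f := f.toCLM'.continuous

theorem map_word {B : Type v} [CStarAlgebra B] (f : CuntzAlgebra d →⋆ₐ[ℂ] B) {ℓ : ℕ}
    (μ : Fin ℓ → Fin d) : f (word μ) = (List.ofFn fun k => f (S (μ k))).prod := by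
  rw [word, map_list_prod, List.map_ofFn]
  rfl

/-- `*`-homomorphisms that agree on the generators are equal. -/
theorem hom_ext {B : Type v} [CStarAlgebra B] {f g : CuntzAlgebra d →⋆ₐ[ℂ] B}
    (h : ∀ i, f (S i) = g (S i)) (x : CuntzAlgebra d) : f x = g x := by
  have hcore : ∀ k, ∀ x ∈ core d k, f x = g x := by
    intro k x hx
    refine Submodule.span_induction (p := fun x _ => f x = g x) ?_ (by simp)
      (fun x y _ _ hx hy => by rw [map_add, map_add, hx, hy])
      (fun c x _ hx => by rw [map_smul, map_smul, hx]) hx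
    rintro _ ⟨a, b, μ, ν, -, -, rfl⟩
    simp only [map_mul, map_star, map_word, h]
  have hd : Dense {x : CuntzAlgebra d | f x = g x} := by
    rw [Metric.dense_iff]
    intro x r hr
    obtain ⟨k, y, hy, hxy⟩ := exists_core_near x hr
    exact ⟨y, by rwa [Metric.mem_ball, dist_comm, dist_eq_norm], hcore k y hy⟩
  have := (isClosed_eq (continuous_hom f) (continuous_hom g)).closure_eq
  have hx := hd x
  rw [this] at hx
  exact hx

/-- The canonical endomorphism `x ↦ ∑ S_i x S_i*`. -/
def shift (d : ℕ) : CuntzAlgebra d →⋆ₐ[ℂ] CuntzAlgebra d where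
  toFun x := ∑ i, S i * x * star (S i)
  map_one' := by simp only [mul_one, sum_S_mul_star]
  map_zero' := by simp
  map_mul' x y := by
    have : ∀ i j, S i * x * star (S i) * (S j * y * star (S j)) =
        if i = j then S i * (x * y) * star (S j) else 0 := by
      intro i j
      rw [show S i * x * star (S i) * (S j * y * star (S j)) =
        S i * x * (star (S i) * S j) * y * star (S j) by simp only [mul_assoc], star_S_mul_S]
      split_ifs <;> simp [mul_assoc]
    simp only [Finset.sum_mul_sum, this, Finset.sum_ite_eq, Finset.mem_univ, if_true]
  map_add' x y := by simp only [mul_add, add_mul, Finset.sum_add_distrib]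
  commutes' c := by
    simp only [Algebra.algebraMap_eq_smul_one, mul_smul_comm, mul_one, smul_mul_assoc,
      ← Finset.smul_sum, sum_S_mul_star]
  map_star' x := by simp only [star_sum, star_mul, star_star, mul_assoc]

theorem shift_apply (x : CuntzAlgebra d) : shift d x = ∑ i, S i * x * star (S i) := rfl

/-- Hence `φ^j(x)`, for `x` a matrix on `ℂᵈ`, acts on the tensor leg of index `j`, counted from
zero. -/
theorem shift_mul_S (x : CuntzAlgebra d) (i : Fin d) : shift d x * S i = S i * x := by
  have : ∀ j, S j * x * star (S j) * S i = if j = i then S j * x else 0 := by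
    intro j
    rw [mul_assoc, star_S_mul_S]
    split_ifs <;> simp
  simp only [shift_apply, Finset.sum_mul, this, Finset.sum_ite_eq', Finset.mem_univ, if_true]

theorem shift_iterate_mul_word {a : ℕ} (N : ℕ) (x : CuntzAlgebra d) (μ : Fin a → Fin d) :
    (shift d)^[N + a] x * word μ = word μ * (shift d)^[N] x := by
  induction a with
  | zero => simp
  | succ a ih =>
    induction μ using Fin.consCases with | cons j μ => ?_
    rw [← add_assoc, Function.iterate_succ_apply', word_cons, ← mul_assoc, shift_mul_S, mul_assoc,
      ih, mul_assoc]

theorem shift_iterate_mul_tvec {a : ℕ} (N : ℕ) (x : CuntzAlgebra d) (w : (Fin a → Fin d) → ℂ) :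
    (shift d)^[N + a] x * tvec a w = tvec a w * (shift d)^[N] x := by
  simp only [tvec_apply, Finset.mul_sum, Finset.sum_mul, mul_smul_comm, smul_mul_assoc,
    shift_iterate_mul_word]

theorem shift_iterate_star (N : ℕ) (x : CuntzAlgebra d) :
    (shift d)^[N] (star x) = star ((shift d)^[N] x) := by
  induction N with
  | zero => rfl
  | succ N ih => rw [Function.iterate_succ_apply', ih, map_star, Function.iterate_succ_apply']

/-- Products of tensors. -/
theorem exists_tvec_mul {k ℓ : ℕ} (v : (Fin k → Fin d) → ℂ) (w : (Fin ℓ → Fin d) → ℂ) :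
    ∃ x, tvec (k + ℓ) x = tvec k v * tvec ℓ w := by
  have : tvec k v * tvec ℓ w ∈ LinearMap.range (tvec (d := d) (k + ℓ)) := by
    rw [tvec_apply, tvec_apply, Finset.sum_mul_sum]
    refine Submodule.sum_mem _ fun μ _ => Submodule.sum_mem _ fun ν _ => ?_
    rw [smul_mul_smul_comm, ← word_append]
    refine Submodule.smul_mem _ _ ⟨Pi.single (Fin.append μ ν) 1, ?_⟩
    simp [tvec]
  exact this

/-- Matrices act on tensors. -/
def matrixHom (d k : ℕ) : Matrix (Fin k → Fin d) (Fin k → Fin d) ℂ →ₐ[ℂ] CuntzAlgebra d :=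
  AlgHom.ofLinearMap
    { toFun := fun M => ∑ μ, ∑ ν, M μ ν • (word μ * star (word ν))
      map_add' := fun M N => by
        simp only [Matrix.add_apply, add_smul, Finset.sum_add_distrib]
      map_smul' := fun c M => by
        simp only [Matrix.smul_apply, smul_assoc, Finset.smul_sum, RingHom.id_apply] }
    (by
      simp only [LinearMap.coe_mk, AddHom.coe_mk, one_apply, ite_smul, one_smul, zero_smul,
        Finset.sum_ite_eq, Finset.mem_univ, if_true, sum_word_mul_star])
    (fun M N => by
      simp only [LinearMap.coe_mk, AddHom.coe_mk, Finset.sum_mul, Finset.mul_sum]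
      have h : ∀ μ ν κ τ : Fin k → Fin d, M μ ν • (word μ * star (word ν)) *
          N κ τ • (word κ * star (word τ)) =
          if ν = κ then (M μ ν * N κ τ) • (word μ * star (word τ)) else 0 := by
        intro μ ν κ τ
        rw [smul_mul_smul_comm, show word μ * star (word ν) * (word κ * star (word τ)) =
          word μ * (star (word ν) * word κ) * star (word τ) by simp only [mul_assoc],
          star_word_mul_word]
        split_ifs <;> simp
      simp only [h, Finset.sum_ite_eq', Finset.mem_univ, if_true, mul_apply, Finset.sum_smul]
      refine Finset.sum_comm.trans (Eq.trans ?_ Finset.sum_comm)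
      exact Finset.sum_congr rfl fun τ _ => Finset.sum_comm)

theorem matrixHom_apply {k : ℕ} (M : Matrix (Fin k → Fin d) (Fin k → Fin d) ℂ) :
    matrixHom d k M = ∑ μ, ∑ ν, M μ ν • (word μ * star (word ν)) := rfl

theorem matrixHom_mul_tvec {k : ℕ} (M : Matrix (Fin k → Fin d) (Fin k → Fin d) ℂ)
    (w : (Fin k → Fin d) → ℂ) : matrixHom d k M * tvec k w = tvec k (M *ᵥ w) := by
  have h : ∀ μ ν κ : Fin k → Fin d, M μ ν • (word μ * star (word ν)) * w κ • word κ =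
      if ν = κ then (M μ ν * w κ) • word μ else 0 := by
    intro μ ν κ
    rw [smul_mul_smul_comm, mul_assoc, star_word_mul_word]
    split_ifs <;> simp
  simp only [matrixHom_apply, tvec_apply, Finset.sum_mul, Finset.mul_sum, h, Finset.sum_ite_eq',
    Finset.mem_univ, if_true, mulVec, dotProduct, Finset.sum_smul]
  exact Finset.sum_comm

end CuntzAlgebra
end

/-! ### The Cuntz algebra is nonzero. -/

noncomputable section

open Matrix MinTensor

namespace CuntzAlgebra

/-- The Cuntz algebras are nonzero. -/
theorem nontrivial_of_pos {d : ℕ} (hd : 0 < d) : Nontrivial (CuntzAlgebra d) := by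
  let H := lp (fun _ : ℕ => ℂ) 2
  let e : HilbertBasis ℕ ℂ H := HilbertBasis.ofRepr (LinearIsometryEquiv.refl ℂ H)
  -- The Cuntz relations are realised on `ℓ²(ℕ)` by `e_n ↦ e_{dn+i}`; division with remainder by `d`
  -- shows that the ranges are orthogonal and sum to the whole space.
  have hon : ∀ i : Fin d, Orthonormal ℂ fun n : ℕ => e (d * n + i) := fun i =>
    e.orthonormal.comp _ fun m n h => by
      have : d * m = d * n := by omega
      exact Nat.eq_of_mul_eq_mul_left hd this
  let V : Fin d → H →ₗᵢ[ℂ] H := fun i => (hon i).orthogonalFamily.linearIsometry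
  have he : ∀ n, e n = lp.single 2 n (1 : ℂ) := fun n => e.repr_self n
  have hV : ∀ i n, V i (e n) = e (d * n + i) := by
    intro i n
    have := (hon i).orthogonalFamily.linearIsometry_apply_single (i := n) (1 : ℂ)
    rw [← he n] at this
    refine this.trans ?_
    simp
  let T : Fin d → H →L[ℂ] H := fun i => (V i).toContinuousLinearMap
  have hadj : ∀ i m n, inner ℂ (e m) ((star (T i)) (e n)) =
      if n = d * m + i then (1 : ℂ) else 0 := by
    intro i m n
    rw [ContinuousLinearMap.star_eq_adjoint, ContinuousLinearMap.adjoint_inner_right]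
    change inner ℂ (V i (e m)) (e n) = _
    rw [hV, orthonormal_iff_ite.1 e.orthonormal]
    simp only [eq_comm]
  have hext : ∀ X Y : H →L[ℂ] H, (∀ n, X (e n) = Y (e n)) → X = Y := by
    intro X Y h
    refine ContinuousLinearMap.ext_on (s := Set.range e) ?_ ?_
    · have := e.dense_span
      rw [← Submodule.dense_iff_topologicalClosure_eq_top] at this
      exact this
    · rintro _ ⟨n, rfl⟩
      exact h n
  have hext2 : ∀ x y : H, (∀ n, inner ℂ (e n) x = inner ℂ (e n) y) → x = y := by
    intro x y h
    refine e.repr.injective (lp.ext (funext fun n => ?_))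
    rw [e.repr_apply_apply, e.repr_apply_apply, h]
  have hadj' : ∀ (i j : Fin d) n, star (T i) (e (d * n + j)) = if i = j then e n else 0 := by
    intro i j n
    refine hext2 _ _ fun m => ?_
    rw [hadj]
    have h1 : d * n + j = d * m + i ↔ m = n ∧ i = j := by
      constructor
      · intro h
        have h2 := congrArg (· / d) h
        have h3 := congrArg (· % d) h
        simp only [Nat.mul_add_div hd, Nat.div_eq_of_lt j.2, Nat.div_eq_of_lt i.2, add_zero] at h2
        simp only [Nat.mul_add_mod, Nat.mod_eq_of_lt j.2, Nat.mod_eq_of_lt i.2] at h3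
        exact ⟨h2.symm, Fin.ext h3.symm⟩
      · rintro ⟨rfl, rfl⟩
        rfl
    simp only [h1]
    by_cases hij : i = j
    · simp only [hij, and_true, if_true]
      rw [orthonormal_iff_ite.1 e.orthonormal]
    · simp [hij]
  have hT : IsCuntzFamily T := by
    constructor
    · intro i j
      refine hext _ _ fun n => ?_
      change star (T i) (V j (e n)) = _
      rw [hV, hadj']
      split_ifs <;> simp
    · refine hext _ _ fun n => ?_
      rw [_root_.sum_apply]
      obtain ⟨k, j, rfl⟩ : ∃ k, ∃ j : Fin d, n = d * k + j :=
        ⟨n / d, ⟨n % d, Nat.mod_lt _ hd⟩, (Nat.div_add_mod n d).symm⟩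
      simp only [mul_apply_eq_comp, hadj']
      rw [Finset.sum_eq_single j]
      · rw [if_pos rfl]
        exact hV _ _
      · intro i _ hi
        rw [if_neg hi, map_zero]
      · simp
  have hH : Nontrivial H := ⟨e 0, 0, fun h => by
    have := e.orthonormal.1 0
    rw [h, norm_zero] at this
    exact zero_ne_one this⟩
  refine ⟨0, 1, fun h => zero_ne_one (α := H →L[ℂ] H) ?_⟩
  rw [← map_zero (lift hT), h, map_one]

end CuntzAlgebra
end

/-! ### The fixed point algebra: conditional expectation, invariant tensors and isometries. -/

noncomputable section

open Matrix MinTensor CuntzAlgebra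

/-- Interchange of two double sums. -/
theorem Fintype.sum_sum_comm {ι κ ι' κ' M : Type*} [Fintype ι] [Fintype κ] [Fintype ι']
    [Fintype κ'] [AddCommMonoid M] (f : ι → κ → ι' → κ' → M) :
    ∑ i, ∑ j, ∑ i', ∑ j', f i j i' j' = ∑ i', ∑ j', ∑ i, ∑ j, f i j i' j' := by
  have h : ∀ (g : ι → κ → M), ∑ i, ∑ j, g i j = ∑ p : ι × κ, g p.1 p.2 := fun g => by
    rw [Fintype.sum_prod_type]
  have h' : ∀ (g : ι' → κ' → M), ∑ i, ∑ j, g i j = ∑ p : ι' × κ', g p.1 p.2 := fun g => by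
    rw [Fintype.sum_prod_type]
  simp only [h, h']
  exact Finset.sum_comm

namespace CompactQuantumGroup

open MatrixRep

variable {A : Type u} [CStarAlgebra A] {G : CompactQuantumGroup A} {d : ℕ}
  {α : Matrix (Fin d) (Fin d) A}

namespace IsUnitaryRep

theorem cuntzAction_word (hα : G.IsUnitaryRep α) {ℓ : ℕ} (μ : Fin ℓ → Fin d) :
    hα.cuntzAction (word μ) = ∑ ν, tmul (word ν) (MatrixRep.tensorPow α ℓ ν μ) := by
  induction ℓ with
  | zero => simp [tensorPow_zero, one_tmul_one]
  | succ ℓ ih =>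
    induction μ using Fin.consCases with | cons i μ => ?_
    rw [word_cons, map_mul, ih, cuntzAction_S, Finset.sum_mul_sum, Fin.sum_word]
    simp only [tmul_mul_tmul, word_cons, tensorPow_cons]

theorem cuntzAction_word_mul_star (hα : G.IsUnitaryRep α) {a b : ℕ} (μ : Fin a → Fin d)
    (ν : Fin b → Fin d) : hα.cuntzAction (word μ * star (word ν)) =
      ∑ μ', ∑ ν', tmul (word μ' * star (word ν')) (MatrixRep.tensorPow α a μ' μ *
        star (MatrixRep.tensorPow α b ν' ν)) := by
  rw [map_mul, map_star, cuntzAction_word, cuntzAction_word, star_sum, Finset.sum_mul_sum]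
  simp only [star_tmul, tmul_mul_tmul]

/-- The coefficients in `∑ S_j x S_l* ⊗ α_ji α_li*` sum over `i` to `δ_jl`, by unitarity of `α`. -/
theorem shift_mem (hα : G.IsUnitaryRep α) {x : CuntzAlgebra d} (hx : x ∈ hα.fixedPointAlgebra) :
    shift d x ∈ hα.fixedPointAlgebra := by
  rw [mem_fixedPointAlgebra] at hx ⊢
  have h1 : ∀ i, hα.cuntzAction (S i * x * star (S i)) =
      ∑ j, ∑ l, tmul (S j * x * star (S l)) (α j i * star (α l i)) := by
    intro i
    rw [map_mul, map_mul, map_star, hx, cuntzAction_S, star_sum, Finset.sum_mul, Finset.sum_mul_sum]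
    simp only [star_tmul, tmul_mul_tmul, mul_one]
  rw [shift_apply, map_sum]
  simp only [h1]
  rw [Finset.sum_comm, sum_tmul]
  refine Finset.sum_congr rfl fun j _ => ?_
  rw [Finset.sum_comm]
  simp only [← tmul_sum, hα.mul_star]
  rw [Finset.sum_eq_single j]
  · rw [if_pos rfl]
  · intro l _ hl
    rw [if_neg (Ne.symm hl), tmul_zero]
  · simp

theorem shift_iterate_mem (hα : G.IsUnitaryRep α) {x : CuntzAlgebra d}
    (hx : x ∈ hα.fixedPointAlgebra) (N : ℕ) : (shift d)^[N] x ∈ hα.fixedPointAlgebra := by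
  induction N with
  | zero => exact hx
  | succ N ih =>
    rw [Function.iterate_succ_apply']
    exact hα.shift_mem ih

/-- The fixed elements in the spans `core d k` are dense in the fixed point algebra. -/
theorem exists_mem_core_near [Nontrivial A] [Nontrivial (CuntzAlgebra d)]
    (hα : G.IsUnitaryRep α) {T : CuntzAlgebra d} (hT : T ∈ hα.fixedPointAlgebra) {ε : ℝ}
    (hε : 0 < ε) : ∃ k, ∃ y ∈ core d k, y ∈ hα.fixedPointAlgebra ∧ ‖T - y‖ < ε := by
  obtain ⟨h, hh⟩ := G.exists_haar
  -- `E` is a contraction onto the fixed elements that preserves each `core d k`, so it moves an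
  -- approximant in the core into the fixed point algebra.
  let E : CuntzAlgebra d →L[ℂ] CuntzAlgebra d := (slice h).comp hα.cuntzAction.toCLM'
  have hE : ∀ {a b : ℕ} (μ : Fin a → Fin d) (ν : Fin b → Fin d), E (word μ * star (word ν)) =
      ∑ μ', ∑ ν', h (MatrixRep.tensorPow α a μ' μ * star (MatrixRep.tensorPow α b ν' ν)) •
        (word μ' * star (word ν')) := by
    intro a b μ ν
    change slice h (hα.cuntzAction _) = _
    simp only [cuntzAction_word_mul_star, map_sum, slice_tmul]
  have hcore : ∀ k, ∀ x ∈ core d k, E x ∈ core d k ∧ E x ∈ hα.fixedPointAlgebra := by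
    intro k x hx
    refine Submodule.span_induction
      (p := fun x _ => E x ∈ core d k ∧ E x ∈ hα.fixedPointAlgebra) ?_
      (by rw [map_zero]; exact ⟨zero_mem _, zero_mem _⟩)
      (fun x y _ _ hx hy => by rw [map_add]; exact ⟨add_mem hx.1 hy.1, add_mem hx.2 hy.2⟩)
      (fun c x _ hx => by
        rw [map_smul]
        exact ⟨Submodule.smul_mem _ _ hx.1, (hα.fixedPointAlgebra).smul_mem hx.2 c⟩) hx
    rintro _ ⟨a, b, μ, ν, ha, hb, rfl⟩
    rw [hE]
    refine ⟨Submodule.sum_mem _ fun μ' _ => Submodule.sum_mem _ fun ν' _ =>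
      Submodule.smul_mem _ _ (word_mul_star_word_mem ha hb _ _), ?_⟩
    rw [mem_fixedPointAlgebra]
    set β := MatrixRep.tensorPow α a with hβ
    set γ := MatrixRep.tensorPow α b with hγ
    -- This is the invariance of `h` applied to the coefficient `β_{μ''μ} γ_{ν''ν}*`.
    have h1 : ∀ μ'' ν'', ∑ μ', ∑ ν', h (β μ' μ * star (γ ν' ν)) • (β μ'' μ' * star (γ ν'' ν')) =
        h (β μ'' μ * star (γ ν'' ν)) • 1 := by
      intro μ'' ν''
      rw [← hh, map_mul, map_star, (hα.tensorPow a).comul, (hα.tensorPow b).comul, star_sum,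
        Finset.sum_mul_sum]
      simp only [star_tmul, tmul_mul_tmul, map_sum, slice_tmul]
      rfl
    have h2 : ∀ μ' ν', hα.cuntzAction (word μ' * star (word ν')) =
        ∑ μ'', ∑ ν'', tmul (word μ'' * star (word ν'')) (β μ'' μ' * star (γ ν'' ν')) :=
      fun μ' ν' => hα.cuntzAction_word_mul_star μ' ν'
    simp only [map_sum, map_smul, h2, Finset.smul_sum, ← tmul_smul, sum_tmul, smul_tmul]
    calc _ = ∑ μ'', ∑ ν'', tmul (word μ'' * star (word ν'')) (∑ μ', ∑ ν',
          h (β μ' μ * star (γ ν' ν)) • (β μ'' μ' * star (γ ν'' ν'))) := by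
          simp only [tmul_sum]
          rw [Fintype.sum_sum_comm]
      _ = _ := by
          simp only [h1, tmul_smul]
  have hET : E T = T := by
    change slice h (hα.cuntzAction T) = T
    rw [(hα.mem_fixedPointAlgebra T).1 hT, slice_tmul, h.map_one, one_smul]
  obtain ⟨k, y, hy, hTy⟩ := exists_core_near T hε
  refine ⟨k, E y, (hcore k y hy).1, (hcore k y hy).2, ?_⟩
  rw [← hET, ← map_sub]
  refine ((norm_slice_le h _).trans ?_).trans_lt hTy
  exact norm_hom_le hα.cuntzAction _

/-- The action on tensors, sliced by a state. -/
theorem slice_cuntzAction_tvec [Nontrivial (CuntzAlgebra d)] (hα : G.IsUnitaryRep α)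
    (ψ : CStarState A) {ℓ : ℕ} (w : (Fin ℓ → Fin d) → ℂ) :
    slice ψ (hα.cuntzAction (tvec ℓ w)) = tvec ℓ ((MatrixRep.tensorPow α ℓ).map ψ.toCLM *ᵥ w) := by
  simp only [tvec_apply, map_sum, map_smul, cuntzAction_word, slice_tmul, Finset.smul_sum, mulVec,
    dotProduct, Finset.sum_smul, map_apply, smul_smul]
  rw [Finset.sum_comm]
  simp only [mul_comm]

/-- Annihilators of sets of fixed elements are invariant subspaces. -/
theorem isInvariant_annihilator [Nontrivial A] [Nontrivial (CuntzAlgebra d)]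
    (hα : G.IsUnitaryRep α) {ℓ : ℕ} {W : Submodule ℂ ((Fin ℓ → Fin d) → ℂ)}
    {𝒟 : Set (CuntzAlgebra d)} (h𝒟 : ∀ D ∈ 𝒟, D ∈ hα.fixedPointAlgebra)
    (hW : ∀ w, w ∈ W ↔ ∀ D ∈ 𝒟, D * tvec ℓ w = 0) :
    IsInvariant (MatrixRep.tensorPow α ℓ) W := by
  rw [isInvariant_iff]
  intro w hw ψ
  rw [hW] at hw ⊢
  intro D hD
  -- As `D ⊗ 1 = δ(D)`, multiplying the sliced tensor by `D` gives the slice of `δ(D w) = 0`.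
  rw [← slice_cuntzAction_tvec hα, ← slice_tmul_one_mul, ← (hα.mem_fixedPointAlgebra D).1 (h𝒟 D hD),
    ← map_mul, hw D hD, map_zero, map_zero]

/-- The action on the range of an intertwiner. -/
theorem cuntzAction_tvec (hα : G.IsUnitaryRep α) {ℓ m : ℕ} {V : Matrix (Fin ℓ → Fin d) (Fin m) ℂ}
    {β : Matrix (Fin m) (Fin m) A} (hV : scal A V * β = MatrixRep.tensorPow α ℓ * scal A V)
    (a : Fin m) : hα.cuntzAction (tvec ℓ fun μ => V μ a) =
      ∑ b, tmul (tvec ℓ fun μ => V μ b) (β b a) := by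
  have h1 : ∀ ν, ∑ μ, V μ a • MatrixRep.tensorPow α ℓ ν μ = ∑ b, V ν b • β b a := by
    intro ν
    rw [← mul_scal_apply, ← hV, scal_mul_apply]
  simp only [tvec_apply, map_sum, map_smul, cuntzAction_word, sum_tmul, smul_tmul, Finset.smul_sum]
  simp only [← tmul_smul]
  rw [Finset.sum_comm]
  simp only [← tmul_sum, h1]
  simp only [tmul_sum]
  rw [Finset.sum_comm]

/-- A nonzero invariant subspace of a tensor power contains the first leg of an isometry in the
fixed point algebra. -/
theorem exists_isometry_mem [Nontrivial A] (hα : G.IsUnitaryRep α) (hC : G.HasPartners α) {ℓ : ℕ}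
    {W : Submodule ℂ ((Fin ℓ → Fin d) → ℂ)} (hW : IsInvariant (MatrixRep.tensorPow α ℓ) W)
    (hW0 : W ≠ ⊥) : ∃ R ∈ hα.fixedPointAlgebra, star R * R = 1 ∧
      ∀ D, (∀ w ∈ W, D * tvec ℓ w = 0) → D * R = 0 := by
  obtain ⟨m, β, V, hβ, hβi, hV, hVβ, hVW⟩ := (hα.tensorPow ℓ).exists_irreducible hW hW0
  obtain ⟨m', β', ⟨hβ', -, ℓ', V', hV', hVβ'⟩, ξ, hξ0, hξ⟩ := hC m β ⟨hβ, hβi, ℓ, V, hV, hVβ⟩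
  -- The invariant vector `ξ` of `β ⊗ β'`, embedded in tensors by `V` and `V'`, is a fixed element.
  -- The columns of `V` and `V'` are orthonormal, so `R* R = ‖ξ‖²`.
  let R : CuntzAlgebra d := ∑ i, ∑ j, ξ (i, j) • (tvec ℓ (fun μ => V μ i) * tvec ℓ' fun μ => V' μ j)
  have hξ' : ∀ i' j', ∑ i, ∑ j, ξ (i, j) • (β i' i * β' j' j) = ξ (i', j') • (1 : A) := by
    intro i' j'
    have := congrFun hξ (i', j')
    rw [action, Fintype.sum_prod_type] at this
    exact this
  have hR : R ∈ hα.fixedPointAlgebra := by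
    rw [mem_fixedPointAlgebra]
    have h1 : ∀ i j, hα.cuntzAction (tvec ℓ (fun μ => V μ i) * tvec ℓ' fun μ => V' μ j) =
        ∑ i', ∑ j', tmul (tvec ℓ (fun μ => V μ i') * tvec ℓ' fun μ => V' μ j')
          (β i' i * β' j' j) := by
      intro i j
      rw [map_mul, cuntzAction_tvec hα hVβ, cuntzAction_tvec hα hVβ', Finset.sum_mul_sum]
      simp only [tmul_mul_tmul]
    simp only [R, map_sum, map_smul, h1, Finset.smul_sum, ← tmul_smul, sum_tmul, smul_tmul]
    calc _ = ∑ i', ∑ j', tmul (tvec ℓ (fun μ => V μ i') * tvec ℓ' fun μ => V' μ j')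
          (∑ i, ∑ j, ξ (i, j) • (β i' i * β' j' j)) := by
          simp only [tmul_sum]
          rw [Fintype.sum_sum_comm]
      _ = _ := by
          simp only [hξ', tmul_smul]
  have hcol : ∀ {N k : ℕ} {U : Matrix (Fin N → Fin d) (Fin k) ℂ}, Uᴴ * U = 1 → ∀ i i',
      star (tvec N fun μ => U μ i) * (tvec N fun μ => U μ i') = if i = i' then 1 else 0 := by
    intro N k U hU i i'
    have h1 := congrFun (congrFun hU i) i'
    rw [one_apply] at h1
    rw [star_tvec_mul_tvec,
      show (star fun μ => U μ i) ⬝ᵥ (fun μ => U μ i') = (Uᴴ * U) i i' from rfl,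
      h1]
    split_ifs <;> simp
  have hRR : star R * R = ((∑ k, ‖ξ k‖ ^ 2 : ℝ) : ℂ) • 1 := by
    have hRk : R = ∑ k, ξ k • (tvec ℓ (fun μ => V μ k.1) * tvec ℓ' fun μ => V' μ k.2) := by
      rw [Fintype.sum_prod_type]
    have h1 : ∀ k k', star (ξ k • (tvec ℓ (fun μ => V μ k.1) * tvec ℓ' fun μ => V' μ k.2)) *
        (ξ k' • (tvec ℓ (fun μ => V μ k'.1) * tvec ℓ' fun μ => V' μ k'.2)) =
        if k = k' then (star (ξ k) * ξ k') • 1 else 0 := by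
      intro k k'
      rw [star_smul, smul_mul_smul_comm, StarMul.star_mul, mul_assoc,
        ← mul_assoc (star (tvec ℓ fun μ => V μ k.1)), hcol hV]
      by_cases h : k.1 = k'.1
      · rw [if_pos h, one_mul, hcol hV']
        by_cases h' : k.2 = k'.2
        · rw [if_pos h', if_pos (Prod.ext h h')]
        · rw [if_neg h', if_neg fun e => h' (congrArg Prod.snd e), smul_zero]
      · rw [if_neg h, if_neg fun e => h (congrArg Prod.fst e), zero_mul, mul_zero, smul_zero]
    rw [hRk, star_sum, Finset.sum_mul_sum]
    simp only [h1, Finset.sum_ite_eq, Finset.mem_univ, if_true, ← Finset.sum_smul]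
    congr 1
    push_cast
    refine Finset.sum_congr rfl fun k _ => ?_
    rw [Complex.star_def, Complex.conj_mul']
  have hpos : 0 < ∑ k, ‖ξ k‖ ^ 2 := by
    obtain ⟨k, hk⟩ := Function.ne_iff.1 hξ0
    refine Finset.sum_pos' (fun _ _ => by positivity) ⟨k, Finset.mem_univ _, ?_⟩
    have : 0 < ‖ξ k‖ := norm_pos_iff.2 hk
    positivity
  set s : ℝ := ∑ k, ‖ξ k‖ ^ 2
  refine ⟨(((√s)⁻¹ : ℝ) : ℂ) • R, hα.fixedPointAlgebra.smul_mem hR _, ?_, ?_⟩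
  · rw [star_smul, smul_mul_smul_comm, hRR, smul_smul]
    have : star (((√s)⁻¹ : ℝ) : ℂ) * (((√s)⁻¹ : ℝ) : ℂ) * (s : ℂ) = 1 := by
      rw [Complex.star_def, Complex.conj_ofReal]
      norm_cast
      rw [← mul_inv, Real.mul_self_sqrt hpos.le, inv_mul_cancel₀ hpos.ne']
    rw [this, one_smul]
  · intro D hD
    -- The columns of `V` lie in `W`, and they are the left factors of `R`.
    have h1 : ∀ i, D * tvec ℓ (fun μ => V μ i) = 0 := by
      intro i
      have := hVW (Pi.single i 1)
      rw [mulVec_single_one] at this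
      exact hD _ this
    simp only [R, mul_smul_comm, Finset.mul_sum, ← mul_assoc, h1, zero_mul, smul_zero,
      Finset.sum_const_zero]

end IsUnitaryRep

end CompactQuantumGroup
end

/-! ### The gauge action and its averages over roots of unity. -/

noncomputable section

open Matrix MinTensor CuntzAlgebra

namespace CuntzAlgebra

variable {d : ℕ}

theorem isCuntzFamily_smul (z : Circle) :
    IsCuntzFamily fun i : Fin d => (z : ℂ) • (S i : CuntzAlgebra d) where
  star_mul i j := by
    rw [star_smul, smul_mul_smul_comm, Complex.star_def, ← Circle.coe_inv_eq_conj,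
      ← Circle.coe_mul, inv_mul_cancel, Circle.coe_one, one_smul, star_S_mul_S]
  sum_mul_star := by
    have h (i : Fin d) : (z : ℂ) • (S i : CuntzAlgebra d) * star ((z : ℂ) • S i) =
        S i * star (S i) := by
      rw [star_smul, smul_mul_smul_comm, Complex.star_def, ← Circle.coe_inv_eq_conj,
        ← Circle.coe_mul, mul_inv_cancel, Circle.coe_one, one_smul]
    simp only [h, sum_S_mul_star]

/-- The gauge action of the circle, `S_i ↦ z S_i`. -/
def gauge (z : Circle) : CuntzAlgebra d →⋆ₐ[ℂ] CuntzAlgebra d := lift (isCuntzFamily_smul z)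

theorem gauge_S (z : Circle) (i : Fin d) : gauge z (S i) = (z : ℂ) • S i :=
  lift_S (isCuntzFamily_smul z) i

theorem gauge_word (z : Circle) {a : ℕ} (μ : Fin a → Fin d) :
    gauge z (word μ) = (z : ℂ) ^ a • word μ := by
  induction a with
  | zero => simp
  | succ a ih =>
    induction μ using Fin.consCases with | cons j μ => ?_
    rw [word_cons, map_mul, ih, gauge_S, smul_mul_smul_comm, pow_succ']

theorem gauge_word_mul_star (z : Circle) {a b : ℕ} (μ : Fin a → Fin d) (ν : Fin b → Fin d) :
    gauge z (word μ * star (word ν)) =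
      ((z : ℂ) ^ a * ((z⁻¹ : Circle) : ℂ) ^ b) • (word μ * star (word ν)) := by
  rw [map_mul, map_star, gauge_word, gauge_word, star_smul, smul_mul_smul_comm, star_pow,
    Complex.star_def, ← Circle.coe_inv_eq_conj]

theorem gauge_one (x : CuntzAlgebra d) : gauge 1 x = x :=
  hom_ext (f := gauge 1) (g := StarAlgHom.id ℂ _)
    (fun i => by rw [gauge_S, Circle.coe_one, one_smul]; rfl) x

theorem continuous_gauge (x : CuntzAlgebra d) : Continuous fun z => gauge z x := by
  have hcore : ∀ k, ∀ x ∈ core d k, Continuous fun z => gauge z x := by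
    intro k x hx
    refine Submodule.span_induction (p := fun x _ => Continuous fun z => gauge z x) ?_
      (by simpa using continuous_const)
      (fun x y _ _ hx hy => by simp only [map_add]; exact hx.add hy)
      (fun c x _ hx => by simp only [map_smul]; exact hx.const_smul c) hx
    rintro _ ⟨a, b, μ, ν, -, -, rfl⟩
    simp only [gauge_word_mul_star]
    fun_prop
  refine continuous_of_uniform_approx_of_continuous fun s hs => ?_
  obtain ⟨ε, hε, hs⟩ := Metric.mem_uniformity_dist.1 hs
  obtain ⟨k, y, hy, hxy⟩ := exists_core_near x hε
  refine ⟨_, hcore k y hy, fun z => hs ?_⟩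
  rw [dist_eq_norm, ← map_sub]
  exact (norm_hom_le _ _).trans_lt hxy

/-- The average over the `N`-th roots of unity of the gauge action. -/
def gaugeMean (d N : ℕ) : CuntzAlgebra d →ₗ[ℂ] CuntzAlgebra d :=
  (N : ℂ)⁻¹ • ∑ k ∈ Finset.range N,
    (gauge (Circle.exp (2 * Real.pi * (k / N)))).toAlgHom.toLinearMap

theorem gaugeMean_apply (N : ℕ) (x : CuntzAlgebra d) : gaugeMean d N x =
    (N : ℂ)⁻¹ • ∑ k ∈ Finset.range N, gauge (Circle.exp (2 * Real.pi * (k / N))) x := by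
  rw [gaugeMean, LinearMap.smul_apply, LinearMap.sum_apply]
  rfl

theorem norm_gaugeMean_le {N : ℕ} (hN : 0 < N) (x : CuntzAlgebra d) :
    ‖gaugeMean d N x‖ ≤ ‖x‖ := by
  have hN' : (0 : ℝ) < N := by exact_mod_cast hN
  rw [gaugeMean_apply, norm_smul, norm_inv, Complex.norm_natCast, inv_mul_le_iff₀ hN']
  refine (norm_sum_le_of_le _ fun k _ => norm_hom_le _ x).trans ?_
  simp

theorem gaugeMean_star (N : ℕ) (x : CuntzAlgebra d) :
    gaugeMean d N (star x) = star (gaugeMean d N x) := by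
  simp [gaugeMean_apply, map_star]

/-- A root `ζ^k` multiplies `S_μ S_ν*` by `ζ^{k(a-b)}`. As `a, b < N`, the geometric sum vanishes
unless `a = b`, so a finite average does the work of an integral over the circle. -/
theorem gaugeMean_word_mul_star {N a b : ℕ} (ha : a < N) (hb : b < N) (μ : Fin a → Fin d)
    (ν : Fin b → Fin d) : gaugeMean d N (word μ * star (word ν)) =
      if a = b then word μ * star (word ν) else 0 := by
  have hN : N ≠ 0 := by omega
  set ζ : ℂ := Complex.exp (2 * Real.pi * Complex.I / N) with hζ
  have hp : IsPrimitiveRoot ζ N := Complex.isPrimitiveRoot_exp N hN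
  have hζ0 : ζ ≠ 0 := hp.ne_zero hN
  have hz (k : ℕ) : ((Circle.exp (2 * Real.pi * (k / N)) : Circle) : ℂ) = ζ ^ k := by
    rw [Circle.coe_exp, hζ, ← Complex.exp_nat_mul]
    congr 1
    push_cast
    ring
  have hk (k : ℕ) : gauge (Circle.exp (2 * Real.pi * (k / N))) (word μ * star (word ν)) =
      ((ζ ^ a * ζ⁻¹ ^ b) ^ k) • (word μ * star (word ν)) := by
    rw [gauge_word_mul_star, Circle.coe_inv, hz, mul_pow, inv_pow, inv_pow, inv_pow]
    congr 2
    · ring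
    · congr 1
      ring
  rw [gaugeMean_apply]
  simp only [hk, ← Finset.sum_smul, smul_smul]
  split_ifs with hab
  · subst hab
    rw [← mul_pow, mul_inv_cancel₀ hζ0]
    simp [hN]
  · have hw : ζ ^ a * ζ⁻¹ ^ b ≠ 1 := by
      intro h
      rw [inv_pow, mul_inv_eq_one₀ (pow_ne_zero _ hζ0)] at h
      exact hab (hp.pow_inj ha hb h)
    have hwN : (ζ ^ a * ζ⁻¹ ^ b) ^ N = 1 := by
      rw [mul_pow, ← pow_mul, ← pow_mul, mul_comm a, mul_comm b, pow_mul, pow_mul, inv_pow,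
        hp.pow_eq_one]
      simp
    rw [geom_sum_eq hw, hwN]
    simp

/-- Inserting `1 = ∑ S_κ S_κ*` over words of length `k - a` lengthens both words to `k`. -/
theorem word_mul_star_word_mem_range {a k : ℕ} (ha : a ≤ k) (μ ν : Fin a → Fin d) :
    word μ * star (word ν) ∈ LinearMap.range (matrixHom d k).toLinearMap := by
  obtain ⟨c, rfl⟩ := Nat.exists_eq_add_of_le ha
  rw [← mul_one (word μ), ← sum_word_mul_star c, Finset.mul_sum, Finset.sum_mul]
  refine Submodule.sum_mem _ fun κ _ =>
    ⟨Matrix.single (Fin.append μ κ) (Fin.append ν κ) 1, ?_⟩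
  rw [AlgHom.toLinearMap_apply, matrixHom_apply, Finset.sum_eq_single (Fin.append μ κ),
    Finset.sum_eq_single (Fin.append ν κ)]
  · rw [Matrix.single_apply_same, one_smul, word_append, word_append, star_mul]
    simp only [mul_assoc]
  · intro τ _ hτ
    rw [Matrix.single_apply_of_col_ne _ _ (Ne.symm hτ), zero_smul]
  · simp
  · intro τ _ hτ
    refine Finset.sum_eq_zero fun σ _ => ?_
    rw [Matrix.single_apply_of_row_ne (Ne.symm hτ), zero_smul]
  · simp

theorem gaugeMean_mem_range {k N : ℕ} (hN : k < N) {x : CuntzAlgebra d} (hx : x ∈ core d k) :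
    ∃ M, matrixHom d k M = gaugeMean d N x := by
  change _ ∈ LinearMap.range (matrixHom d k).toLinearMap
  refine Submodule.span_induction
    (p := fun x _ => gaugeMean d N x ∈ LinearMap.range (matrixHom d k).toLinearMap) ?_
    (by rw [map_zero]; exact zero_mem _)
    (fun x y _ _ hx hy => by rw [map_add]; exact add_mem hx hy)
    (fun c x _ hx => by rw [map_smul]; exact Submodule.smul_mem _ _ hx) hx
  rintro _ ⟨a, b, μ, ν, ha, hb, rfl⟩
  rw [gaugeMean_word_mul_star (by omega) (by omega)]
  split_ifs with hab
  · subst hab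
    exact word_mul_star_word_mem_range ha μ ν
  · exact zero_mem _

/-- The averages of a nonzero positive element are uniformly bounded away from zero. -/
theorem exists_le_norm_gaugeMean [Nontrivial (CuntzAlgebra d)] {x : CuntzAlgebra d} (hx : x ≠ 0) :
    ∃ c : ℝ, 0 < c ∧ ∀ N : ℕ, 0 < N → c ≤ ‖gaugeMean d N (star x * x)‖ := by
  obtain ⟨θ, hθ⟩ := CStarState.exists_apply_star_mul_self x
  -- `f` is continuous, nonnegative and equal to `‖x‖²` at `0`, so it exceeds `‖x‖² / 2` near `0`.
  let f : ℝ → ℝ := fun t => (θ (gauge (Circle.exp (2 * Real.pi * t)) (star x * x))).re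
  have hf : Continuous f := by
    have := (continuous_gauge (star x * x)).comp
      (Circle.exp.continuous.comp (continuous_const.mul continuous_id : Continuous
        fun t : ℝ => 2 * Real.pi * t))
    exact Complex.continuous_re.comp (θ.toCLM.continuous.comp this)
  have hf0 : f 0 = ‖x‖ ^ 2 := by
    simp only [f, mul_zero, Circle.exp_zero, gauge_one, hθ]
    norm_cast
  have hfn (t : ℝ) : 0 ≤ f t := by
    have := θ.nonneg (gauge (Circle.exp (2 * Real.pi * t)) x)
    rw [← map_star, ← map_mul] at this
    exact (Complex.le_def.1 this).1
  have hx2 : 0 < ‖x‖ ^ 2 := by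
    have := norm_pos_iff.2 hx
    positivity
  obtain ⟨η, hη, hfη⟩ : ∃ η > 0, ∀ t, |t| < η → ‖x‖ ^ 2 / 2 < f t := by
    have h1 : ∀ᶠ t in nhds (0 : ℝ), ‖x‖ ^ 2 / 2 < f t :=
      hf.continuousAt.eventually_const_lt (by rw [hf0]; linarith)
    obtain ⟨η, hη, h⟩ := Metric.eventually_nhds_iff.1 h1
    exact ⟨η, hη, fun t ht => h (by simpa [Real.dist_eq] using ht)⟩
  set δ := min η 1 with hδ
  have hδ0 : 0 < δ := lt_min hη one_pos
  refine ⟨δ * (‖x‖ ^ 2 / 2), by positivity, fun N hN => ?_⟩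
  have hN' : (0 : ℝ) < N := by exact_mod_cast hN
  -- At least the fraction `δ` of the sample points `k / N` lies where `f` is large, and `δ` does
  -- not depend on `N`; truncating at `1` keeps `M ≤ N`.
  set M := ⌈δ * N⌉₊ with hM
  have hMN : M ≤ N := by
    rw [hM, Nat.ceil_le]
    exact mul_le_of_le_one_left hN'.le (min_le_right _ _)
  have h1 : (M : ℝ) * (‖x‖ ^ 2 / 2) ≤ ∑ k ∈ Finset.range N, f (k / N) := by
    calc (M : ℝ) * (‖x‖ ^ 2 / 2) = ∑ k ∈ Finset.range M, ‖x‖ ^ 2 / 2 := by simp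
      _ ≤ ∑ k ∈ Finset.range M, f (k / N) := by
        refine Finset.sum_le_sum fun k hk => (hfη _ ?_).le
        rw [Finset.mem_range, hM, Nat.lt_ceil] at hk
        rw [abs_of_nonneg (by positivity), div_lt_iff₀ hN']
        exact hk.trans_le (mul_le_mul_of_nonneg_right (min_le_left _ _) hN'.le)
      _ ≤ _ := Finset.sum_le_sum_of_subset_of_nonneg
        (Finset.range_subset_range.2 hMN) fun _ _ _ => hfn _
  have h2 : (θ (gaugeMean d N (star x * x))).re = (N : ℝ)⁻¹ * ∑ k ∈ Finset.range N, f (k / N) := by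
    rw [gaugeMean_apply, map_smul, map_sum, smul_eq_mul, ← Complex.ofReal_natCast,
      ← Complex.ofReal_inv, Complex.re_ofReal_mul, Complex.re_sum]
  calc δ * (‖x‖ ^ 2 / 2) ≤ (N : ℝ)⁻¹ * (M * (‖x‖ ^ 2 / 2)) := by
        rw [← mul_assoc]
        refine mul_le_mul_of_nonneg_right ?_ (by positivity)
        rw [le_inv_mul_iff₀ hN', mul_comm]
        exact Nat.le_ceil _
    _ ≤ (N : ℝ)⁻¹ * ∑ k ∈ Finset.range N, f (k / N) :=
        mul_le_mul_of_nonneg_left h1 (by positivity)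
    _ = (θ (gaugeMean d N (star x * x))).re := h2.symm
    _ ≤ ‖θ (gaugeMean d N (star x * x))‖ := Complex.re_le_norm _
    _ ≤ _ := θ.norm_apply_le _

end CuntzAlgebra

namespace CompactQuantumGroup.IsUnitaryRep

variable {A : Type u} [CStarAlgebra A] {G : CompactQuantumGroup A} {d : ℕ}
  {α : Matrix (Fin d) (Fin d) A}

/-- The gauge action commutes with `δ`, as is seen on the generators. -/
theorem gauge_mem (hα : G.IsUnitaryRep α) {x : CuntzAlgebra d} (hx : x ∈ hα.fixedPointAlgebra)
    (z : Circle) : gauge z x ∈ hα.fixedPointAlgebra := by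
  rw [mem_fixedPointAlgebra] at hx ⊢
  have h := hom_ext (f := hα.cuntzAction.comp (gauge z))
    (g := (MinTensor.map (gauge z) (StarAlgHom.id ℂ A)).comp hα.cuntzAction) (fun i => by
      simp only [StarAlgHom.comp_apply, gauge_S, map_smul, cuntzAction_S, map_sum, map_tmul,
        smul_tmul, Finset.smul_sum, StarAlgHom.coe_id, id_eq]) x
  rw [StarAlgHom.comp_apply, StarAlgHom.comp_apply, hx, map_tmul] at h
  simpa using h

theorem gaugeMean_mem (hα : G.IsUnitaryRep α) {x : CuntzAlgebra d}
    (hx : x ∈ hα.fixedPointAlgebra) (N : ℕ) : gaugeMean d N x ∈ hα.fixedPointAlgebra := by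
  rw [gaugeMean_apply]
  exact hα.fixedPointAlgebra.smul_mem (sum_mem fun k _ => hα.gauge_mem hx _) _

end CompactQuantumGroup.IsUnitaryRep
end

/-! ### Compression to scalars, and the theorem. -/

noncomputable section

open Matrix MinTensor CuntzAlgebra

namespace CuntzAlgebra

variable {d : ℕ}

theorem star_matrixHom {k : ℕ} (M : Matrix (Fin k → Fin d) (Fin k → Fin d) ℂ) :
    star (matrixHom d k M) = matrixHom d k Mᴴ := by
  simp only [matrixHom_apply, star_sum, star_smul, star_mul, star_star, conjTranspose_apply]
  exact Finset.sum_comm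

theorem tvec_ne_zero [Nontrivial (CuntzAlgebra d)] {ℓ : ℕ} {w : (Fin ℓ → Fin d) → ℂ}
    (hw : w ≠ 0) : tvec ℓ w ≠ 0 := by
  intro h
  have h1 := star_tvec_mul_tvec w w
  rw [h, mul_zero, eq_comm, smul_eq_zero_iff_left one_ne_zero] at h1
  open scoped ComplexOrder in
  exact hw (dotProduct_star_self_eq_zero.1 h1)

/-- A nonzero tensor is a nonzero multiple of an isometry. -/
theorem tvec_mul_ne_zero {ℓ : ℕ} {w : (Fin ℓ → Fin d) → ℂ} (hw : tvec ℓ w ≠ 0)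
    {x : CuntzAlgebra d} (hx : x ≠ 0) : tvec ℓ w * x ≠ 0 := by
  intro h
  have h1 := star_tvec_mul_tvec w w
  have h2 : (star w ⬝ᵥ w) • x = 0 := by
    rw [← one_mul x, ← smul_mul_assoc, ← h1, mul_assoc, h, mul_zero]
  rcases smul_eq_zero.1 h2 with h3 | h3
  · rw [h3, zero_smul, CStarRing.star_mul_self_eq_zero_iff] at h1
    exact hw h1
  · exact hx h3

theorem star_word_mul_shift_iterate {a : ℕ} (N : ℕ) (x : CuntzAlgebra d) (μ : Fin a → Fin d) :
    (shift d)^[N] x * star (word μ) = star (word μ) * (shift d)^[N + a] x := by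
  have h := congrArg star (shift_iterate_mul_word N (star x) μ)
  rw [star_mul, star_mul, shift_iterate_star, shift_iterate_star, star_star, star_star] at h
  exact h.symm

/-- When `a ≠ b` the two exponents differ; this is what lets projections detect the degree `a - b`.
-/
theorem word_mul_star_word_mul_shift_iterate {a b N : ℕ} (μ : Fin a → Fin d) (ν : Fin b → Fin d)
    (x : CuntzAlgebra d) : (shift d)^[N + a] x * (word μ * star (word ν)) =
      word μ * star (word ν) * (shift d)^[N + b] x := by
  rw [← mul_assoc, shift_iterate_mul_word, mul_assoc, star_word_mul_shift_iterate, mul_assoc]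

/-- Eigenvalues of maximal modulus of a self-adjoint matrix element. -/
theorem exists_mul_tvec_eq_smul [Nontrivial (CuntzAlgebra d)] {k : ℕ}
    {M : Matrix (Fin k → Fin d) (Fin k → Fin d) ℂ} (hM : IsSelfAdjoint (matrixHom d k M)) :
    ∃ (c : ℂ) (v : (Fin k → Fin d) → ℂ), v ≠ 0 ∧ ‖c‖ = ‖matrixHom d k M‖ ∧
      matrixHom d k M * tvec k v = c • tvec k v := by
  obtain ⟨c, hc, hcn⟩ := spectrum.exists_nnnorm_eq_spectralRadius (matrixHom d k M)
  -- A spectral value of maximal modulus in the Cuntz algebra is an eigenvalue of `M`; its modulus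
  -- is the norm because the element is self-adjoint.
  have hc' := AlgHom.spectrum_apply_subset (matrixHom d k) M hc
  rw [spectrum.mem_iff, Matrix.isUnit_iff_isUnit_det, isUnit_iff_ne_zero, not_not] at hc'
  obtain ⟨v, hv0, hv⟩ := Matrix.exists_mulVec_eq_zero_iff.2 hc'
  refine ⟨c, v, hv0, ?_, ?_⟩
  · rw [hM.spectralRadius_eq_nnnorm, ENNReal.coe_inj] at hcn
    exact congrArg NNReal.toReal hcn
  · have h : M *ᵥ v = c • v := by
      rw [sub_mulVec, Algebra.algebraMap_eq_smul_one, smul_mulVec, one_mulVec, sub_eq_zero] at hv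
      exact hv.symm
    rw [matrixHom_mul_tvec, h, map_smul]

/-- Tensor powers of a vector fixed by `p`. -/
theorem exists_tvec_shift_eq [Nontrivial (CuntzAlgebra d)] {p : CuntzAlgebra d}
    {v : (Fin 1 → Fin d) → ℂ} (hv : v ≠ 0) (hp : p * tvec 1 v = tvec 1 v) (k : ℕ) :
    ∃ w, tvec k w ≠ 0 ∧ ∀ j < k, (shift d)^[j] p * tvec k w = tvec k w := by
  induction k with
  | zero => exact ⟨fun _ => 1, by simp [tvec_apply], fun j hj => absurd hj (by omega)⟩
  | succ k ih =>
    obtain ⟨w, hw, hj⟩ := ih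
    -- Here `w` is the `k`-th tensor power of `v` and `x = w ⊗ v` is the next one.
    obtain ⟨x, hx⟩ := exists_tvec_mul w v
    refine ⟨x, ?_, fun j hjk => ?_⟩
    · rw [hx]
      exact tvec_mul_ne_zero hw (tvec_ne_zero hv)
    · rw [hx, ← mul_assoc]
      rcases Nat.lt_succ_iff_lt_or_eq.1 hjk with h | rfl
      · rw [hj j h]
      · have := shift_iterate_mul_tvec 0 p w
        rw [zero_add] at this
        rw [this, mul_assoc, Function.iterate_zero, id_eq, hp]

end CuntzAlgebra

namespace CompactQuantumGroup.IsUnitaryRep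

open MatrixRep

variable {A : Type u} [CStarAlgebra A] {G : CompactQuantumGroup A} {d : ℕ}
  {α : Matrix (Fin d) (Fin d) A}

/-- Intertwiners of the tensor powers are fixed. -/
theorem matrixHom_mem (hα : G.IsUnitaryRep α) {k : ℕ}
    {M : Matrix (Fin k → Fin d) (Fin k → Fin d) ℂ}
    (hM : MatrixRep.tensorPow α k * scal A M = scal A M * MatrixRep.tensorPow α k) :
    matrixHom d k M ∈ hα.fixedPointAlgebra := by
  set β := MatrixRep.tensorPow α k with hβ
  have h1 : β * scal A M * βᴴ = scal A M := by
    rw [hM, mul_assoc, (isUnitaryRep_iff.1 (hα.tensorPow k)).2.1, mul_one]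
  have h2 : ∀ μ' ν', ∑ μ, ∑ ν, M μ ν • (β μ' μ * star (β ν' ν)) = M μ' ν' • (1 : A) := by
    intro μ' ν'
    have := congrFun (congrFun h1 μ') ν'
    rw [mul_apply] at this
    simp only [mul_scal_apply, conjTranspose_apply, map_apply, Finset.sum_mul,
      smul_mul_assoc] at this
    rw [Finset.sum_comm, this, Algebra.algebraMap_eq_smul_one]
  rw [mem_fixedPointAlgebra]
  simp only [matrixHom_apply, map_sum, map_smul, cuntzAction_word_mul_star, sum_tmul, smul_tmul,
    Finset.smul_sum, ← tmul_smul]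
  rw [Fintype.sum_sum_comm]
  simp only [← tmul_sum, ← hβ, h2]

/-- A reducible representation gives a nontrivial projection in the fixed point algebra. -/
theorem exists_projection [Nontrivial A] (hα : G.IsUnitaryRep α) (hd : 0 < d)
    (hα' : ¬ MatrixRep.IsIrreducible α) :
    ∃ p ∈ hα.fixedPointAlgebra, star p = p ∧
      (∃ v, v ≠ 0 ∧ p * tvec 1 v = tvec 1 v) ∧ ∃ w, w ≠ 0 ∧ p * tvec 1 w = 0 := by
  have hn : Nonempty (Fin d) := ⟨⟨0, hd⟩⟩
  obtain ⟨W, hW, hW0, hW1⟩ : ∃ W : Submodule ℂ (Fin d → ℂ), IsInvariant α W ∧ W ≠ ⊥ ∧ W ≠ ⊤ := by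
    by_contra! h
    exact hα' ⟨hn, fun W hW => or_iff_not_imp_left.2 (h W hW)⟩
  obtain ⟨m, V, -, hVW, hVf⟩ := exists_isometry W
  have hP1 : ∀ x, (V * Vᴴ) *ᵥ x ∈ W := fun x => by rw [← mulVec_mulVec]; exact hVW _
  have hP2 : ∀ w ∈ W, (V * Vᴴ) *ᵥ w = w := fun w hw => by rw [← mulVec_mulVec]; exact hVf w hw
  have hP : (V * Vᴴ).IsHermitian := isHermitian_mul_conjTranspose_self V
  set P := V * Vᴴ
  have hcomm := hα.commute_of_invariant hP (isInvariant_eq hW hP1 hP2)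
  -- Words of length one are identified with letters, so that `P` becomes an element of degree `(1,
  -- 1)`.
  let e : (Fin 1 → Fin d) ≃ Fin d := Equiv.funUnique (Fin 1) (Fin d)
  have hpow : MatrixRep.tensorPow α 1 = α.submatrix e e := by
    ext μ ν
    simp [MatrixRep.tensorPow, e]
  have hmul (x : Fin d → ℂ) : P.submatrix e e *ᵥ (x ∘ e) = (P *ᵥ x) ∘ e := by
    rw [submatrix_mulVec_equiv, Function.comp_assoc, Equiv.self_comp_symm, Function.comp_id]
  have hne {x : Fin d → ℂ} (hx : x ≠ 0) : x ∘ e ≠ 0 := fun h =>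
    hx (e.surjective.injective_comp_right h)
  refine ⟨matrixHom d 1 (P.submatrix e e), hα.matrixHom_mem ?_, ?_, ?_, ?_⟩
  · have h1 : scal A (P.submatrix e e) = (scal A P).submatrix e e := rfl
    rw [hpow, h1, submatrix_mul_equiv, submatrix_mul_equiv, hcomm]
  · rw [star_matrixHom, conjTranspose_submatrix, hP.eq]
  · obtain ⟨v, hvW, hv0⟩ := W.ne_bot_iff.1 hW0
    refine ⟨v ∘ e, hne hv0, ?_⟩
    rw [matrixHom_mul_tvec, hmul, hP2 v hvW]
  · obtain ⟨x, hx⟩ : ∃ x, x ∉ W := by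
      by_contra! h
      exact hW1 (Submodule.eq_top_iff'.2 h)
    refine ⟨(x - P *ᵥ x) ∘ e, hne fun h => hx ?_, ?_⟩
    · rw [sub_eq_zero.1 h]
      exact hP1 x
    · rw [matrixHom_mul_tvec, hmul, mulVec_sub, hP2 _ (hP1 x), sub_self]
      exact map_zero (tvec 1)

/-- Compression of a fixed element of the dense core to a scalar. -/
theorem exists_compression [Nontrivial A] (hα : G.IsUnitaryRep α) (hd : 0 < d)
    (hC : G.HasPartners α) (hα' : ¬ MatrixRep.IsIrreducible α) {k N : ℕ} (hN : k < N)
    {T : CuntzAlgebra d} (hT : T ∈ core d k) (hTα : T ∈ hα.fixedPointAlgebra)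
    (hTs : IsSelfAdjoint T) :
    ∃ R ∈ hα.fixedPointAlgebra, ∃ c : ℂ, star R * R = 1 ∧ ‖c‖ = ‖gaugeMean d N T‖ ∧
      star R * T * R = c • 1 := by
  have := nontrivial_of_pos hd
  obtain ⟨p, hpα, hps, ⟨v₁, hv₁, hp₁⟩, v₂, hv₂, hp₂⟩ := hα.exists_projection hd hα'
  obtain ⟨M, hM⟩ := gaugeMean_mem_range hN hT
  have hYs : IsSelfAdjoint (matrixHom d k M) := by
    rw [hM, IsSelfAdjoint, ← gaugeMean_star, hTs.star_eq]
  have hYα : matrixHom d k M ∈ hα.fixedPointAlgebra := by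
    rw [hM]
    exact hα.gaugeMean_mem hTα N
  obtain ⟨c, v, hv, hcn, hcv⟩ := exists_mul_tvec_eq_smul hYs
  set Y := matrixHom d k M
  -- The equations for `R`: it lies in the `c`-eigenspace of `Y`, in the range of `p` on legs `k, …,
  -- 2k-1` and in the kernel of `p` on leg `2k`. The witness built below is `v ⊗ v₁^{⊗ k} ⊗ v₂`.
  let 𝒟 : Set (CuntzAlgebra d) := {D | D = Y - c • 1 ∨ (∃ j < k, D = (shift d)^[j + k] p - 1) ∨
    D = (shift d)^[k + k] p}
  have h𝒟 : ∀ D ∈ 𝒟, D ∈ hα.fixedPointAlgebra := by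
    rintro D (rfl | ⟨j, -, rfl⟩ | rfl)
    · exact sub_mem hYα (hα.fixedPointAlgebra.smul_mem (one_mem _) c)
    · exact sub_mem (hα.shift_iterate_mem hpα _) (one_mem _)
    · exact hα.shift_iterate_mem hpα _
  let W : Submodule ℂ ((Fin (k + k + 1) → Fin d) → ℂ) :=
    ⨅ D ∈ 𝒟, LinearMap.ker (LinearMap.mulLeft ℂ D ∘ₗ tvec (k + k + 1))
  have hW : ∀ w, w ∈ W ↔ ∀ D ∈ 𝒟, D * tvec (k + k + 1) w = 0 := by
    intro w
    simp [W, Submodule.mem_iInf]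
  have hW0 : W ≠ ⊥ := by
    obtain ⟨w, hw0, hw⟩ := exists_tvec_shift_eq hv₁ hp₁ k
    obtain ⟨y, hy⟩ := exists_tvec_mul v w
    obtain ⟨z, hz⟩ := exists_tvec_mul y v₂
    refine W.ne_bot_iff.2 ⟨z, (hW z).2 ?_, ?_⟩
    · rintro D (rfl | ⟨j, hj, rfl⟩ | rfl)
      · rw [hz, hy, sub_mul, ← mul_assoc, ← mul_assoc, hcv, smul_mul_assoc, smul_mul_assoc,
          smul_mul_assoc, one_mul, sub_self]
      · rw [hz, hy, sub_mul, one_mul, ← mul_assoc, ← mul_assoc, shift_iterate_mul_tvec,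
          mul_assoc (tvec k v), hw j hj, sub_self]
      · have := shift_iterate_mul_tvec 0 p y
        rw [zero_add] at this
        rw [hz, ← mul_assoc, this, mul_assoc, Function.iterate_zero, id_eq, hp₂, mul_zero]
    · rintro rfl
      rw [map_zero, hy] at hz
      exact tvec_mul_ne_zero (by rw [hy]; exact tvec_mul_ne_zero (tvec_ne_zero hv) hw0)
        (tvec_ne_zero hv₂) (hy ▸ hz.symm)
  obtain ⟨R, hRα, hR, hDR⟩ :=
    hα.exists_isometry_mem hC (hα.isInvariant_annihilator h𝒟 hW) hW0
  have hker : ∀ D ∈ 𝒟, D * R = 0 := fun D hD => hDR D fun w hw => (hW w).1 hw D hD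
  have hYR : Y * R = c • R := by
    have := hker _ (Or.inl rfl)
    rwa [sub_mul, smul_mul_assoc, one_mul, sub_eq_zero] at this
  have hpR (j : ℕ) (h1 : k ≤ j) (h2 : j < k + k) : (shift d)^[j] p * R = R := by
    have := hker _ (Or.inr (Or.inl ⟨j - k, by omega, rfl⟩))
    rwa [sub_mul, one_mul, sub_eq_zero, Nat.sub_add_cancel h1] at this
  have hpR0 : (shift d)^[k + k] p * R = 0 := hker _ (Or.inr (Or.inr rfl))
  have hstar (j : ℕ) : star R * (shift d)^[j] p = star ((shift d)^[j] p * R) := by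
    rw [StarMul.star_mul, ← shift_iterate_star, hps]
  -- Compression by `R` does not see the terms that the gauge average removes; by linearity one term
  -- `S_μ S_ν*` with `a ≠ b` suffices.
  have hgen (x : CuntzAlgebra d) (hx : x ∈ core d k) :
      star R * (x - gaugeMean d N x) * R = 0 := by
    refine Submodule.span_induction (p := fun x _ => star R * (x - gaugeMean d N x) * R = 0) ?_
      (by simp)
      (fun x y _ _ hx hy => by
        rw [map_add, add_sub_add_comm, mul_add, add_mul, hx, hy, add_zero])
      (fun c x _ hx => by
        rw [map_smul, ← smul_sub, mul_smul_comm, smul_mul_assoc, hx, smul_zero]) hx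
    rintro _ ⟨a, b, μ, ν, ha, hb, rfl⟩
    rw [gaugeMean_word_mul_star (by omega) (by omega)]
    split_ifs with hab
    · simp
    rw [sub_zero]
    rcases Nat.lt_or_gt_of_ne hab with hlt | hgt
    · have h1 : star R * (shift d)^[k + k - b + a] p = star R := by
        rw [hstar, hpR _ (by omega) (by omega)]
      rw [← h1, mul_assoc (star R), word_mul_star_word_mul_shift_iterate,
        Nat.sub_add_cancel (by omega), mul_assoc, mul_assoc, hpR0, mul_zero, mul_zero]
    -- The mirror case: the projection is inserted next to `R` on the right and moved to the left,
    -- where `R* φ^{2k}(p) = 0`.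
    · have h1 : (shift d)^[k + k - a + b] p * R = R := hpR _ (by omega) (by omega)
      have h2 : star R * (shift d)^[k + k] p = 0 := by rw [hstar, hpR0, star_zero]
      calc star R * (word μ * star (word ν)) * R
          = star R * (word μ * star (word ν) * (shift d)^[k + k - a + b] p) * R := by
            simp only [mul_assoc, h1]
        _ = 0 := by
          rw [← word_mul_star_word_mul_shift_iterate, Nat.sub_add_cancel (by omega), ← mul_assoc,
            h2, zero_mul, zero_mul]
  refine ⟨R, hRα, c, hR, by rw [hcn, hM], ?_⟩
  have h1 := hgen T hT
  rw [← hM, mul_sub, sub_mul, sub_eq_zero] at h1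
  rw [h1, mul_assoc, hYR, mul_smul_comm, hR]

/-- Every nonzero fixed element can be multiplied close to the unit. -/
theorem exists_mul_mul_near_one [Nontrivial A] (hα : G.IsUnitaryRep α) (hd : 0 < d)
    (hC : G.HasPartners α) (hα' : ¬ MatrixRep.IsIrreducible α) {T : CuntzAlgebra d}
    (hT : T ∈ hα.fixedPointAlgebra) (hT0 : T ≠ 0) {ε : ℝ} (hε : 0 < ε) :
    ∃ a ∈ hα.fixedPointAlgebra, ∃ b ∈ hα.fixedPointAlgebra, ‖a * T * b - 1‖ ≤ ε := by
  have := nontrivial_of_pos hd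
  obtain ⟨c, hc, hcN⟩ := exists_le_norm_gaugeMean hT0
  -- The first bound keeps `‖l‖ ≥ c / 2` after the approximation; the second makes the error at most
  -- `ε` after division by `l`.
  set ε' := min (c / 2) (ε * (c / 2)) with hε'
  have hε'0 : 0 < ε' := lt_min (by positivity) (by positivity)
  obtain ⟨k, y, hyk, hyα, hy⟩ := hα.exists_mem_core_near (mul_mem (star_mem hT) hT) hε'0
  -- Taking the self-adjoint part of `y` does not worsen the approximation, as `T* T` is
  -- self-adjoint; the eigenvalue argument needs self-adjointness but not positivity.
  let T' : CuntzAlgebra d := (1 / 2 : ℂ) • (y + star y)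
  have hT'k : T' ∈ core d k := Submodule.smul_mem _ _ (add_mem hyk (star_mem_core hyk))
  have hT'α : T' ∈ hα.fixedPointAlgebra :=
    hα.fixedPointAlgebra.smul_mem (add_mem hyα (star_mem hyα)) _
  have hT's : IsSelfAdjoint T' := by
    simp [IsSelfAdjoint, T', add_comm]
  have hTT' : ‖star T * T - T'‖ ≤ ε' := by
    have h1 : star T * T - T' =
        (1 / 2 : ℂ) • ((star T * T - y) + star (star T * T - y)) := by
      rw [star_sub, (IsSelfAdjoint.star_mul_self T).star_eq]
      module
    have h2 := norm_add_le (star T * T - y) (star (star T * T - y))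
    rw [norm_star] at h2
    rw [h1, norm_smul, show ‖(1 / 2 : ℂ)‖ = 1 / 2 by norm_num]
    linarith
  obtain ⟨R, hRα, l, hR, hl, hRl⟩ :=
    hα.exists_compression hd hC hα' (Nat.lt_succ_self k) hT'k hT'α hT's
  have hlc : c / 2 ≤ ‖l‖ := by
    have h1 := hcN (k + 1) k.succ_pos
    have h2 := norm_gaugeMean_le k.succ_pos (star T * T - T')
    rw [map_sub] at h2
    have h3 := norm_sub_norm_le (gaugeMean d (k + 1) (star T * T)) (gaugeMean d (k + 1) T')
    have h4 : ε' ≤ c / 2 := min_le_left _ _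
    rw [hl]
    simp only [Nat.succ_eq_add_one] at h1 h2 ⊢
    linarith
  have hl0 : l ≠ 0 := norm_pos_iff.1 (by linarith)
  have hR1 : ‖R‖ ≤ 1 := by
    have h1 := CStarRing.norm_star_mul_self (x := R)
    rw [hR, norm_one] at h1
    nlinarith [norm_nonneg R]
  refine ⟨l⁻¹ • (star R * star T), hα.fixedPointAlgebra.smul_mem
    (mul_mem (star_mem hRα) (star_mem hT)) _, R, hRα, ?_⟩
  have h1 : l⁻¹ • (star R * star T) * T * R - 1 = l⁻¹ • (star R * (star T * T - T') * R) := by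
    rw [mul_sub, sub_mul, hRl, smul_sub, smul_smul, inv_mul_cancel₀ hl0, one_smul]
    simp only [smul_mul_assoc, mul_assoc]
  have h2 : ‖star R * (star T * T - T') * R‖ ≤ ε' := by
    calc _ ≤ ‖star R‖ * ‖star T * T - T'‖ * ‖R‖ := norm_mul₃_le
      _ ≤ 1 * ε' * 1 := by
        gcongr
        rwa [norm_star]
      _ = ε' := by ring
  rw [h1, norm_smul, norm_inv, inv_mul_le_iff₀ (by linarith)]
  calc _ ≤ ε' := h2
    _ ≤ ε * (c / 2) := min_le_right _ _
    _ ≤ ‖l‖ * ε := by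
      rw [mul_comm]
      gcongr

end CompactQuantumGroup.IsUnitaryRep

/-- A nontrivial unital C*-algebra that is not reduced to the scalars, and in which every nonzero
element can be multiplied close to the unit, is simple and purely infinite. -/
theorem IsSimplePurelyInfinite.of_approx {C : Type u} [CStarAlgebra C] [Nontrivial C]
    (h : ∃ T : C, ∀ c : ℂ, T ≠ algebraMap ℂ C c)
    (h' : ∀ T : C, T ≠ 0 → ∀ ε : ℝ, 0 < ε → ∃ a b : C, ‖a * T * b - 1‖ ≤ ε) :
    IsSimplePurelyInfinite C where
  simple := ⟨{
    eq_bot_or_eq_top := fun I => by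
      refine or_iff_not_imp_left.2 fun hI => ?_
      obtain ⟨T, hTI, hT0⟩ : ∃ T ∈ I, T ≠ 0 := by
        by_contra! hT
        exact hI (le_bot_iff.1 fun x hx => (TwoSidedIdeal.mem_bot C).2 (hT x hx))
      obtain ⟨a, b, hab⟩ := h' T hT0 (1 / 2) (by norm_num)
      have hu : IsUnit (a * T * b) := by
        -- An ideal containing `T` contains `a T b`, which is invertible by the Neumann series.
        have := isUnit_one_sub_of_norm_lt_one (x := 1 - a * T * b)
          (by rw [norm_sub_rev]; linarith)
        rwa [sub_sub_cancel] at this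
      obtain ⟨s, hs⟩ := hu.exists_right_inv
      refine (TwoSidedIdeal.one_mem_iff I).1 ?_
      rw [← hs]
      exact I.mul_mem_right _ _ (I.mul_mem_right _ _ (I.mul_mem_left _ _ hTI)) }⟩
  not_scalar := h
  approx := h'

end

theorem mainTheorem2 {A : Type u} [CStarAlgebra A] (G : CompactQuantumGroup A) (d : ℕ)
    (hd : 0 < d) (α : Matrix (Fin d) (Fin d) A) (hα : G.IsUnitaryRep α)
    (hC1 : G.HasPartners α) (hC2 : ¬ MatrixRep.IsIrreducible α) :
    IsSimplePurelyInfinite hα.fixedPointAlgebra := by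
  have := G.nontrivial
  have := CuntzAlgebra.nontrivial_of_pos hd
  refine .of_approx ?_ fun T hT ε hε => ?_
  -- The projection fixes one nonzero tensor and kills another, so it is not a scalar.
  · obtain ⟨p, hp, -, ⟨v, hv, hpv⟩, w, hw, hpw⟩ := hα.exists_projection hd hC2
    refine ⟨⟨p, hp⟩, fun c hc => ?_⟩
    have hpc : p = c • 1 := by
      rw [← Algebra.algebraMap_eq_smul_one]
      exact congrArg Subtype.val hc
    rw [hpc, smul_mul_assoc, one_mul] at hpv hpw
    rcases smul_eq_zero.1 hpw with h | h
    · rw [h, zero_smul] at hpv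
      exact CuntzAlgebra.tvec_ne_zero hv hpv.symm
    · exact CuntzAlgebra.tvec_ne_zero hw h
  · obtain ⟨a, ha, b, hb, hab⟩ := hα.exists_mul_mul_near_one hd hC1 hC2 T.2
      (fun h => hT (Subtype.ext h)) hε
    exact ⟨⟨a, ha⟩, ⟨b, hb⟩, hab⟩
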